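/- \textbf{Setting.} Let $E\ge 2$. A pipeline consists of differentiable operators $a_e:\mathbb R^{d_{e-1}}\times\mathbb R^{d_{w_e}}\to\mathbb R^{d_e}$, $e=1,\dots,E$, with $d_E=1$. For data $x\in\mathbb R^{d_0}$ and parameters $\boldsymbol w=(w_1,\dots,w_E)$ put $y_0=x$, $y_e=a_e(y_{e-1},w_e)$, $L(x;\boldsymbol w)=y_E$ and $\ell(\boldsymbol w)=\mathbb E_{x\sim\mathcal D}L(x;\boldsymbol w)$, where $\mathcal D$ is a probability distribution. \textbf{Algorithm (Clapping-FC)} with constant step size $\gamma>0$, momentum $m\in(0,1)$, lazy-sampling probability $p\in(0,1]$ and randomized compressors $\mathcal C$ (fresh independent randomness at each use). Start with $\tilde y_e^{(0)}=0$, $\tilde v_e^{(0)}=0$, $\tilde u_e^{(0)}=0$ and a given $\boldsymbol w^{(1)}$. At iteration $t=1,2,\dots$: draw $x^{(1)}\sim\mathcal D$ if $t=1$; for $t\ge2$, with probability $p$ draw a fresh $x^{(t)}\sim\mathcal D$, otherwise set $x^{(t)}=x^{(t-1)}$. Set $\tilde y_0^{(t)}=x^{(t)}$ and $\tilde v_E^{(t)}=1$.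 For $e=1,\dots,E-1$, $$\tilde y_e^{(t)}=\tilde y_e^{(t-1)}+\mathcal C\big(a_e(\tilde y_{e-1}^{(t)},w_e^{(t)})-\tilde y_e^{(t-1)}\big);$$ for $e=E,\dots,2$, $$\tilde v_{e-1}^{(t)}=\tilde v_{e-1}^{(t-1)}+\mathcal C\big(\nabla_1a_e(\tilde y_{e-1}^{(t)},w_e^{(t)})^{\mathsf T}\tilde v_e^{(t)}-\tilde v_{e-1}^{(t-1)}\big);$$ and for $e=1,\dots,E$, $$\tilde u_e^{(t)}=(1-m)\tilde u_e^{(t-1)}+m\,\nabla_2a_e(\tilde y_{e-1}^{(t)},w_e^{(t)})^{\mathsf T}\tilde v_e^{(t)},\qquad w_e^{(t+1)}=w_e^{(t)}-\gamma\,\tilde u_e^{(t)}.$$ \textbf{Assumptions.} (1) $\ell$ is differentiable and $\nabla\ell$ is $L_{\nabla\ell}$-Lipschitz; for $e=1,\dots,E$ the partial derivatives $\nabla_1a_e,\nabla_2a_e$ are bounded by $C_a$ in operator norm; for $e=1,\dots,E-1$, $a_e$ is $L_a$-Lipschitz and $\nabla_1a_{e+1},\nabla_2a_{e+1}$ are $L_{\nabla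 a}$-Lipschitz in (activation, parameters); and $w\mapsto\nabla_2a_1(x,w)$ is $L_{\nabla a}$-Lipschitz for every $x$. (2) For all $\boldsymbol w$, $\mathbb E_x\nabla L(x;\boldsymbol w)=\nabla\ell(\boldsymbol w)$ and $\mathbb E_x\|\nabla L(x;\boldsymbol w)-\nabla\ell(\boldsymbol w)\|^2\le\sigma^2$. (3) $\mathbb E\|z-\mathcal C(z)\|^2\le\omega_F^2\|z\|^2$ for the compressors of the forward pass and $\le\omega_B^2\|z\|^2$ for those of the backward pass, for every vector $z$, where $\omega_F,\omega_B\in[0,1)$. (4) $\mathbb E\|x_1-x_2\|^2\le\varphi^2$ for independent $x_1,x_2\sim\mathcal D$. (5) $\ell(\boldsymbol w^{(1)})-\inf\ell\le\Delta$, and $\mathbb E_x\|y_e\|^2\le B^2$ for $1\le e\le E-1$ at $\boldsymbol w=\boldsymbol w^{(1)}$. \textbf{Theorem.} For all $E\ge 2$ and $L_{\nabla\ell},C_a,L_a,L_{\nabla a},\Delta,B,\kappa\ge0$ there is a constant $K>0$, depending only on these quantities, with the following property. For all $\sigma,\varphi\ge0$ such that $\varphi\le\kappa\sigma$ or $\sigma=0$,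 all $\omega_F,\omega_B\in[0,1)$ and all $T\ge1$ there are $\gamma>0$, $m\in(0,1)$ and $p\in(0,1]$ such that for every problem, all compressors and every $\boldsymbol w^{(1)}$ satisfying (1)--(5), the iterates of Clapping-FC satisfy $\mathbb E\|\nabla\ell(\boldsymbol w^{(t)})\|^2<\infty$ for $1\le t\le T$ and $$\frac1T\sum_{t=1}^T\mathbb E\|\nabla\ell(\boldsymbol w^{(t)})\|^2\le K\left(\frac{\sigma^{4/3}}{T^{1/3}(1-\omega_B)^{4(E-1)/3}(1-\omega_F)^{4(E-1)/3}}+\frac{\delta}{T}\right),$$ where $$\delta=\frac1{(1-\omega_F)^{E-1}(1-\omega_B)^{E-1}}+\frac{\omega_F^2+\omega_B}{(1-\omega_F)^2(1-\omega_B)^{2(E-1)}}+\frac1{(1-\omega_F)^{2(E-2)-1}}.$$ -/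

import Mathlib

open MeasureTheory ProbabilityTheory

noncomputable section

namespace Clapping

variable {E : ℕ}

/-- The space `ℝ^{d e}` of activations with index `e = 0, …, E`; index `0` is the data space. -/
abbrev Act (d : Fin (E + 1) → ℕ) (e : Fin (E + 1)) : Type := EuclideanSpace ℝ (Fin (d e))

/-- The parameter block of one worker. Workers are numbered `0, …, E - 1`: worker `e` maps
activations with index `e` to activations with index `e + 1`. -/
abbrev Blk (k : Fin E → ℕ) (e : Fin E) : Type := EuclideanSpace ℝ (Fin (k e))

/-- The full parameter vector, with the Euclidean norm. -/
abbrev Params (k : Fin E → ℕ) : Type := PiLp 2 (fun e : Fin E => Blk k e)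

/-- The operators of the pipeline. -/
abbrev Operators (d : Fin (E + 1) → ℕ) (k : Fin E → ℕ) : Type :=
  (e : Fin E) → Act d e.castSucc → Blk k e → Act d e.succ

/-- Randomized compressors, one for each activation index. The output is a function of an
independent random seed in `Ξ` and of the vector to be compressed. Only the indices
`1, …, E - 1` (the links between two consecutive workers) matter. -/
abbrev Compressors (d : Fin (E + 1) → ℕ) (Ξ : Type*) : Type _ :=
  (e : Fin (E + 1)) → Ξ → Act d e → Act d e

/-- The random draws of one iteration: the lazy-sampling coin (`true` means: draw a new sample),
a new data sample, the forward compression seeds and the backward compression seeds. -/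
abbrev Draw (d : Fin (E + 1) → ℕ) (Ξ : Type*) : Type _ :=
  Bool × Act d 0 × (Fin (E + 1) → Ξ) × (Fin (E + 1) → Ξ)

variable {d : Fin (E + 1) → ℕ} {k : Fin E → ℕ} {Ξ : Type*}

/-- The exact activations: `y_0 = x` and `y_{e+1} = a_e(y_e, w_e)`. -/
def forward (a : Operators d k) (x : Act d 0) (w : Params k) (e : Fin (E + 1)) : Act d e :=
  Fin.induction (motive := fun e => Act d e) x (fun e y => a e y (w e)) e

/-- The loss `L(x; w) = y_E`. It is used with `d_E = 1`, so that the sum has a single term. -/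
def loss (a : Operators d k) (x : Act d 0) (w : Params k) : ℝ :=
  ∑ i, forward a x w (Fin.last E) i

/-- The objective `ℓ(w) = 𝔼_{x ∼ D} L(x; w)`. -/
def risk (D : Measure (Act d 0)) (a : Operators d k) (w : Params k) : ℝ :=
  ∫ x, loss a x w ∂D

/-- The partial derivative of the operator of worker `e` in the activation. -/
def jac₁ (a : Operators d k) (e : Fin E) (y : Act d e.castSucc) (w : Blk k e) :
    Act d e.castSucc →L[ℝ] Act d e.succ :=
  fderiv ℝ (fun y' => a e y' w) y

/-- The partial derivative of the operator of worker `e` in its parameters. -/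
def jac₂ (a : Operators d k) (e : Fin E) (y : Act d e.castSucc) (w : Blk k e) :
    Blk k e →L[ℝ] Act d e.succ :=
  fderiv ℝ (fun w' => a e y w') w

/-! ### The algorithm -/

/-- The state of the algorithm: the current sample, the compressed activations `ỹ`, the compressed
activation gradients `ṽ`, the momentum `ũ` and the parameters. -/
structure State (d : Fin (E + 1) → ℕ) (k : Fin E → ℕ) where
  x : Act d 0
  y : (e : Fin (E + 1)) → Act d e
  v : (e : Fin (E + 1)) → Act d e
  u : Params k
  w : Params k

/-- Forward pass with error feedback: `ỹ_0 = x`, and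
`ỹ_{e+1} = ỹ_{e+1}^{old} + C(a_e(ỹ_e, w_e) - ỹ_{e+1}^{old})`.
The component with the last index `E` is never used. -/
def forwardPass (a : Operators d k) (CF : Compressors d Ξ) (seed : Fin (E + 1) → Ξ)
    (w : Params k) (x : Act d 0) (yOld : (e : Fin (E + 1)) → Act d e) (e : Fin (E + 1)) :
    Act d e :=
  Fin.induction (motive := fun e => Act d e) x
    (fun e y => yOld e.succ + CF e.succ (seed e.succ) (a e y (w e) - yOld e.succ)) e

/-- Backward pass with error feedback: `ṽ_E = 1`, and
`ṽ_e = ṽ_e^{old} + C(∇₁a_e(ỹ_e, w_e)ᵀ ṽ_{e+1} - ṽ_e^{old})`.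
The component with index `0` is never used. -/
def backwardPass (a : Operators d k) (CB : Compressors d Ξ) (seed : Fin (E + 1) → Ξ)
    (w : Params k) (y vOld : (e : Fin (E + 1)) → Act d e) (e : Fin (E + 1)) : Act d e :=
  Fin.reverseInduction (motive := fun e => Act d e)
    (WithLp.toLp 2 fun _ => (1 : ℝ))
    (fun e v => vOld e.castSucc + CB e.castSucc (seed e.castSucc)
      ((jac₁ a e (y e.castSucc) (w e)).adjoint v - vOld e.castSucc)) e

/-- One iteration on the sample `x`, with step size `γ` and momentum coefficient `m`; every
communication is compressed. -/
def iteration (γ m : ℝ) (a : Operators d k) (CF CB : Compressors d Ξ) (x : Act d 0)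
    (seedF seedB : Fin (E + 1) → Ξ) (s : State d k) : State d k :=
  let y := forwardPass a CF seedF s.w x s.y
  let v := backwardPass a CB seedB s.w y s.v
  let u : Params k := WithLp.toLp 2 fun e =>
    (1 - m) • s.u e + m • (jac₂ a e (y e.castSucc) (s.w e)).adjoint (v e.succ)
  { x := x, y := y, v := v, u := u, w := s.w - γ • u }

/-- Clapping-FC: `run … ζ t` is the state after `t` iterations, as a function of the draws `ζ`; in
particular `(run … ζ t).w` is the iterate `w^{(t+1)}`. The first iteration always draws a new
sample (so the sample stored in the initial state is irrelevant), each later one draws a new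
sample if its coin shows `true` and keeps the previous sample otherwise. -/
def run (γ m : ℝ) (a : Operators d k) (CF CB : Compressors d Ξ) (w₁ : Params k)
    (ζ : ℕ → Draw d Ξ) : ℕ → State d k
  | 0 => { x := 0, y := fun _ => 0, v := fun _ => 0, u := 0, w := w₁ }
  | t + 1 =>
    let s := run γ m a CF CB w₁ ζ t
    let x := if t = 0 ∨ (ζ t).1 = true then (ζ t).2.1 else s.x
    iteration γ m a CF CB x (ζ t).2.2.1 (ζ t).2.2.2 s

/-- The law of the draws of one iteration: a coin that shows `true` with probability `p`, a sample
from `D` and compression seeds with law `ν`, all independent. -/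
def drawLaw (p : ℝ) (D : Measure (Act d 0)) [MeasurableSpace Ξ] (ν : Measure Ξ) :
    Measure (Draw d Ξ) :=
  (ENNReal.ofReal p • Measure.dirac true + ENNReal.ofReal (1 - p) • Measure.dirac false).prod
    (D.prod ((Measure.pi fun _ => ν).prod (Measure.pi fun _ => ν)))

/-! ### The assumptions -/

/-- Smoothness. -/
structure Smooth (D : Measure (Act d 0)) (a : Operators d k) (Lℓ Ca La Lg : ℝ) : Prop where
  /-- The operators are differentiable. -/
  differentiable : ∀ e : Fin E,
    Differentiable ℝ (fun z : Act d e.castSucc × Blk k e => a e z.1 z.2)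
  /-- The objective is differentiable with `Lℓ`-Lipschitz gradient. -/
  risk_differentiable : Differentiable ℝ (risk D a)
  risk_gradient_lipschitz : ∀ w w' : Params k,
    ‖gradient (risk D a) w - gradient (risk D a) w'‖ ≤ Lℓ * ‖w - w'‖
  /-- The derivatives of all operators are bounded by `Ca`. -/
  jac_bounded : ∀ (e : Fin E) (y : Act d e.castSucc) (w : Blk k e),
    ‖jac₁ a e y w‖ ≤ Ca ∧ ‖jac₂ a e y w‖ ≤ Ca
  /-- All operators but the last one are `La`-Lipschitz. -/
  op_lipschitz : ∀ e : Fin E, e.val + 1 < E →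
    ∀ (y y' : Act d e.castSucc) (w w' : Blk k e),
      ‖a e y w - a e y' w'‖ ^ 2 ≤ La ^ 2 * (‖y - y'‖ ^ 2 + ‖w - w'‖ ^ 2)
  /-- The derivatives of all operators but the first one are `Lg`-Lipschitz. -/
  jac_lipschitz : ∀ e : Fin E, 0 < e.val →
    ∀ (y y' : Act d e.castSucc) (w w' : Blk k e),
      ‖jac₁ a e y w - jac₁ a e y' w'‖ ^ 2 ≤ Lg ^ 2 * (‖y - y'‖ ^ 2 + ‖w - w'‖ ^ 2) ∧
      ‖jac₂ a e y w - jac₂ a e y' w'‖ ^ 2 ≤ Lg ^ 2 * (‖y - y'‖ ^ 2 + ‖w - w'‖ ^ 2)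
  /-- For the first operator, the derivative in the parameters is `Lg`-Lipschitz in the
  parameters. -/
  jac_lipschitz_first : ∀ e : Fin E, e.val = 0 →
    ∀ (x : Act d e.castSucc) (w w' : Blk k e),
      ‖jac₂ a e x w - jac₂ a e x w'‖ ≤ Lg * ‖w - w'‖

/-- The stochastic gradient `∇L(x; w)` is unbiased with variance at most `σ²`. -/
structure UnbiasedGradient (D : Measure (Act d 0)) (a : Operators d k) (σ : ℝ) : Prop where
  integrable : ∀ w : Params k, Integrable (fun x => gradient (loss a x) w) D
  unbiased : ∀ w : Params k, ∫ x, gradient (loss a x) w ∂D = gradient (risk D a) w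
  variance_integrable : ∀ w : Params k,
    Integrable (fun x => ‖gradient (loss a x) w - gradient (risk D a) w‖ ^ 2) D
  variance_le : ∀ w : Params k,
    ∫ x, ‖gradient (loss a x) w - gradient (risk D a) w‖ ^ 2 ∂D ≤ σ ^ 2

/-- Contractive compressors on the links between consecutive workers, that is, for the activation
indices `1, …, E - 1`. -/
structure Contractive [MeasurableSpace Ξ] (ν : Measure Ξ) (C : Compressors d Ξ) (ω : ℝ) :
    Prop where
  measurable : ∀ e : Fin (E + 1), e ≠ 0 → e ≠ Fin.last E →
    Measurable (fun q : Ξ × Act d e => C e q.1 q.2)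
  integrable : ∀ e : Fin (E + 1), e ≠ 0 → e ≠ Fin.last E →
    ∀ z : Act d e, Integrable (fun ξ => ‖z - C e ξ z‖ ^ 2) ν
  contractive : ∀ e : Fin (E + 1), e ≠ 0 → e ≠ Fin.last E →
    ∀ z : Act d e, ∫ ξ, ‖z - C e ξ z‖ ^ 2 ∂ν ≤ ω ^ 2 * ‖z‖ ^ 2

/-- The mean squared distance of two independent samples is at most `φ²`. -/
structure SampleDispersion (D : Measure (Act d 0)) (φ : ℝ) : Prop where
  integrable : Integrable (fun q : Act d 0 × Act d 0 => ‖q.1 - q.2‖ ^ 2) (D.prod D)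
  dispersion_le : ∫ q : Act d 0 × Act d 0, ‖q.1 - q.2‖ ^ 2 ∂(D.prod D) ≤ φ ^ 2

/-- The constant `δ`. The last exponent is negative for `E = 2`. -/
def delta (E : ℕ) (ωF ωB : ℝ) : ℝ :=
  1 / ((1 - ωF) ^ (E - 1) * (1 - ωB) ^ (E - 1))
    + (ωF ^ 2 + ωB) / ((1 - ωF) ^ 2 * (1 - ωB) ^ (2 * (E - 1)))
    + 1 / (1 - ωF) ^ (2 * ((E : ℤ) - 2) - 1)

end Clapping

end

noncomputable section

namespace Clapping

/-! ### Scalar recursions -/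

/-! The gradient assembled at each iteration is split into ∇ℓ(w), a noise term ∇L(x; w) − ∇ℓ(w) at
the current sample, and a bias caused by compression. Bias and noise are summed in mean square over
time, and a descent argument with momentum combines them.

Bias. With error feedback, the vector compressed at one iteration is the residual of the previous
compression plus increments. The seed is independent of that vector, so the residual contracts in
root mean square by ωF or ωB. Each link is thus a first-order filter of ℓ² gain 1/(1 − ω), driven by
its neighbour, by the change of sample (mean square at most pφ²) and by the parameter step γ‖u‖. A
chain of E − 1 links costs (1 − ω)^(−2(E−1)) on the squared drive. The start from zero is subtler: a
direct estimate of the forward transient costs a power of 1/(1 − ωF) growing with E. But exact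
back-propagation is bounded as well as Lipschitz, so activation errors enter only through min(1, ·).
Writing the transient as an n-th power and using `min_one_pow_le` leaves (1 − ωF)^(−2); see
`forward_sum_le`. Backward errors are measured against exact back-propagation at the compressed
activations, a bounded quantity, and keep a factor ωB²; see `backward_sum_le`. Both meet in
`exists_bias_sum_le`.

Noise. Reusing samples makes the drive small, but correlates the noise in time and makes the sample
dependent on the parameters. If S is the momentum average of the noise n, a constant c is chosen so
that S + c·n contracts by 1 − m in conditional mean, up to parameter drift (`exists_correction`).
For m = p²/4 the averaged noise then has mean square of order pσ² per iteration, plus initial and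
drift terms (`sum_avgNoise_le`): a window of 1/m iterations holds about p/m = 4/p fresh samples.

Descent. `sum_gradient_le` bounds the squared gradients plus half the squared momenta. With q = (1 −
ωF)^(E−1) (1 − ωB)^(E−1) and γ at most a small multiple of m and of q, all squared momenta on the
right are absorbed on the left. Up to constants, 1/(p²T) + pσ²/q² + δ/T remains, and p³ = q²/(σ²T),
capped at p = 1, gives the rate (`exists_parameters`).

Independence enters through resampling: replacing one component of one draw by a fresh copy
preserves the law of the whole sequence (`measurePreserving_resample`), and quantities that ignore
this component are unchanged, so Fubini integrates the fresh copy first. -/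

theorem sum_le_of_recurrence {ρ : ℝ} {A B : ℕ → ℝ} (hρ : 0 ≤ ρ) (hA : ∀ t, 0 ≤ A t)
    (h : ∀ t, A (t + 1) ≤ ρ * A t + B t) (T : ℕ) :
    (1 - ρ) * ∑ t ∈ Finset.range (T + 1), A t ≤ A 0 + ∑ t ∈ Finset.range T, B t := by
  have key : ∀ T : ℕ, (1 - ρ) * ∑ t ∈ Finset.range T, A t + A T
      ≤ A 0 + ∑ t ∈ Finset.range T, B t := by
    intro T
    induction T with
    | zero => simp
    | succ T ih =>
      rw [Finset.sum_range_succ, Finset.sum_range_succ]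
      linarith [h T]
  have := key T
  rw [Finset.sum_range_succ]
  nlinarith [mul_nonneg hρ (hA T)]

/-- Convexity of the square at ρ·s + (1 − ρ)·(g/(1 − ρ)). -/
theorem sq_convex_bound {ρ s g : ℝ} (h0 : 0 ≤ ρ) (h1 : ρ < 1) :
    (ρ * s + g) ^ 2 ≤ ρ * s ^ 2 + g ^ 2 / (1 - ρ) := by
  have hp : 0 < 1 - ρ := by linarith
  rw [← sub_nonneg]
  have : ρ * s ^ 2 + g ^ 2 / (1 - ρ) - (ρ * s + g) ^ 2
      = ρ * (s * (1 - ρ) - g) ^ 2 / (1 - ρ) := by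
    field_simp
    ring
  rw [this]
  positivity

/-- A first-order filter has ℓ² gain 1/(1 − ρ). The input energy pays two powers of 1/(1 − ρ), the
initial value only one. -/
theorem sum_sq_le_of_recurrence {ρ : ℝ} {s g : ℕ → ℝ} (h0 : 0 ≤ ρ) (h1 : ρ < 1)
    (hs : ∀ t, 0 ≤ s t) (h : ∀ t, s (t + 1) ≤ ρ * s t + g t) (T : ℕ) :
    ∑ t ∈ Finset.range (T + 1), s t ^ 2
      ≤ s 0 ^ 2 / (1 - ρ) + (∑ t ∈ Finset.range T, g t ^ 2) / (1 - ρ) ^ 2 := by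
  have hp : 0 < 1 - ρ := by linarith
  have := sum_le_of_recurrence (A := fun t => s t ^ 2) (B := fun t => g t ^ 2 / (1 - ρ)) h0
    (fun t => sq_nonneg _)
    (fun t => (pow_le_pow_left₀ (hs _) (h t) 2).trans (sq_convex_bound h0 h1)) T
  rw [← Finset.sum_div] at this
  have e : s 0 ^ 2 / (1 - ρ) + (∑ t ∈ Finset.range T, g t ^ 2) / (1 - ρ) ^ 2
      = (s 0 ^ 2 + (∑ t ∈ Finset.range T, g t ^ 2) / (1 - ρ)) / (1 - ρ) := by
    field_simp
  rw [e, le_div_iff₀ hp]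
  linarith

theorem sum_range_shift_le {A : ℕ → ℝ} (hA : ∀ t, 0 ≤ A t) (T : ℕ) :
    ∑ t ∈ Finset.range T, A (t + 1) ≤ ∑ t ∈ Finset.range (T + 1), A t := by
  rw [Finset.sum_range_succ']
  linarith [hA 0]

theorem sum_range_prefix_le {A : ℕ → ℝ} (hA : ∀ t, 0 ≤ A t) (T : ℕ) :
    ∑ t ∈ Finset.range T, A t ≤ ∑ t ∈ Finset.range (T + 1), A t := by
  rw [Finset.sum_range_succ]
  linarith [hA T]

/-- The response of the filter with decay `ω` to the input `g`, started at zero. -/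
def response (ω : ℝ) (g : ℕ → ℝ) : ℕ → ℝ
  | 0 => 0
  | t + 1 => ω * response ω g t + g t

/-- The response of a cascade of filters. -/
def cascade (ω C : ℝ) (G : ℕ → ℝ) : ℕ → ℕ → ℝ
  | 0 => response ω fun t => C * G t
  | j + 1 => response ω fun t => C * (2 * cascade ω C G j (t + 1) + G t)

theorem response_nonneg {ω : ℝ} {g : ℕ → ℝ} (hω : 0 ≤ ω) (hg : ∀ t, 0 ≤ g t) (t : ℕ) :
    0 ≤ response ω g t := by
  induction t with
  | zero => simp [response]
  | succ t ih => exact add_nonneg (mul_nonneg hω ih) (hg t)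

theorem cascade_nonneg {ω C : ℝ} {G : ℕ → ℝ} (hω : 0 ≤ ω) (hC : 0 ≤ C) (hG : ∀ t, 0 ≤ G t)
    (j t : ℕ) : 0 ≤ cascade ω C G j t := by
  induction j generalizing t with
  | zero => exact response_nonneg hω (fun t => mul_nonneg hC (hG t)) t
  | succ j ih =>
    exact response_nonneg hω (fun t => mul_nonneg hC (by linarith [ih (t + 1), hG t])) t

/-- Each filter multiplies the energy by its squared gain (1 − ω)^(−2). The factor 10 = 8 + 2 comes
from (2a + b)² ≤ 8a² + 2b², where `1 ≤ C` lets the direct input `G` be absorbed into the bound for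
the previous stage. -/
theorem sum_sq_cascade_le {C : ℝ} (hC : 1 ≤ C) (j : ℕ) {ω : ℝ} {G : ℕ → ℝ} (h0 : 0 ≤ ω)
    (h1 : ω < 1) (hG : ∀ t, 0 ≤ G t) (T : ℕ) :
    ∑ t ∈ Finset.range (T + 1), cascade ω C G j t ^ 2
      ≤ (10 * C ^ 2) ^ (j + 1) / (1 - ω) ^ (2 * (j + 1)) * ∑ t ∈ Finset.range T, G t ^ 2 := by
  have hp : 0 < 1 - ω := by linarith
  have hp1 : 1 - ω ≤ 1 := by linarith
  have hC0 : 0 ≤ C := by linarith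
  have hS : 0 ≤ ∑ t ∈ Finset.range T, G t ^ 2 := Finset.sum_nonneg fun _ _ => sq_nonneg _
  induction j with
  | zero =>
    have := sum_sq_le_of_recurrence (s := cascade ω C G 0) (g := fun t => C * G t) h0 h1
      (cascade_nonneg h0 hC0 hG 0) (fun t => le_rfl) T
    refine this.trans ?_
    simp only [cascade, response, mul_pow, ← Finset.mul_sum]
    rw [div_mul_eq_mul_div, zero_add, mul_one, pow_one]
    simp only [ne_eq, OfNat.ofNat_ne_zero, not_false_eq_true, zero_pow, zero_div, zero_add, pow_one]
    gcongr
    nlinarith [mul_nonneg (sq_nonneg C) hS]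
  | succ j ih =>
    have := sum_sq_le_of_recurrence (s := cascade ω C G (j + 1))
      (g := fun t => C * (2 * cascade ω C G j (t + 1) + G t)) h0 h1
      (cascade_nonneg h0 hC0 hG (j + 1)) (fun t => le_rfl) T
    refine this.trans ?_
    have hz : cascade ω C G (j + 1) 0 = 0 := rfl
    rw [hz]
    set S := ∑ t ∈ Finset.range T, G t ^ 2
    have h2 : ∑ t ∈ Finset.range T, (C * (2 * cascade ω C G j (t + 1) + G t)) ^ 2
        ≤ C ^ 2 * (8 * ((10 * C ^ 2) ^ (j + 1) / (1 - ω) ^ (2 * (j + 1)) * S) + 2 * S) := by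
      calc _ ≤ ∑ t ∈ Finset.range T, C ^ 2 * (8 * cascade ω C G j (t + 1) ^ 2 + 2 * G t ^ 2) := by
            refine Finset.sum_le_sum fun t _ => ?_
            rw [mul_pow]
            gcongr
            nlinarith [sq_nonneg (2 * cascade ω C G j (t + 1) - G t)]
        _ = C ^ 2 * (8 * ∑ t ∈ Finset.range T, cascade ω C G j (t + 1) ^ 2 + 2 * S) := by
            rw [← Finset.mul_sum, Finset.sum_add_distrib, Finset.mul_sum, Finset.mul_sum]
        _ ≤ _ := by
            have := sum_range_shift_le (A := fun t => cascade ω C G j t ^ 2)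
              (fun t => sq_nonneg _) T
            gcongr
            exact this.trans ih
    have h3 : S ≤ (10 * C ^ 2) ^ (j + 1) / (1 - ω) ^ (2 * (j + 1)) * S := by
      refine le_mul_of_one_le_left hS ?_
      rw [one_le_div (by positivity)]
      exact (pow_le_one₀ hp.le hp1).trans (one_le_pow₀ (by nlinarith))
    calc _ = (∑ t ∈ Finset.range T, (C * (2 * cascade ω C G j (t + 1) + G t)) ^ 2)
          / (1 - ω) ^ 2 := by ring
      _ ≤ (10 * C ^ 2 * ((10 * C ^ 2) ^ (j + 1) / (1 - ω) ^ (2 * (j + 1)) * S))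
          / (1 - ω) ^ 2 := by
            gcongr
            refine h2.trans ?_
            have : 0 ≤ C ^ 2 := sq_nonneg C
            nlinarith
      _ = _ := by
            rw [show 2 * (j + 1 + 1) = 2 * (j + 1) + 2 by ring, pow_add (1 - ω),
              pow_succ (10 * C ^ 2) (j + 1)]
            field_simp

/-- Superposition: a transient caused by the initial values plus the forced response started at
zero. The common decay rate of all transients is written as an n-th power, which is the form
`min_one_pow_le` needs. -/
theorem forward_recursion_le {C : ℝ} (hC : 1 ≤ C) {n : ℕ} (hn : 0 < n) {ω : ℝ} (h0 : 0 ≤ ω)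
    (h1 : ω < 1) {z : ℕ → ℕ → ℝ} {G : ℕ → ℝ} (hi : ∀ j < n, z j 0 ≤ C)
    (hz0 : ∀ t, z 0 (t + 1) ≤ ω * z 0 t + C * G t)
    (hz : ∀ j, j + 1 < n → ∀ t,
      z (j + 1) (t + 1) ≤ ω * z (j + 1) t + C * (2 * z j (t + 1) + G t))
    (j : ℕ) (hj : j < n) (t : ℕ) :
    z j t ≤ C * (4 * C) ^ j / (1 - ω) ^ j * ((1 - (1 - ω) / (2 * n)) ^ n) ^ t
      + cascade ω C G j t := by
  have hp : 0 < 1 - ω := by linarith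
  have hp1 : 1 - ω ≤ 1 := by linarith
  have hn1 : (1 : ℝ) ≤ n := by exact_mod_cast hn
  set L : ℝ := (1 - (1 - ω) / (2 * n)) ^ n with hL
  have hx : (1 - ω) / (2 * n) ≤ 1 / 2 := by
    rw [div_le_div_iff₀ (by positivity) (by norm_num)]
    nlinarith
  have hx0 : 0 < (1 - ω) / (2 * n) := by positivity
  have hL1 : L ≤ 1 := pow_le_one₀ (by linarith) (by linarith)
  have hL0 : 0 ≤ L := pow_nonneg (by linarith) _
  -- Bernoulli's inequality. The rate `L` stays above ω by at least (1 − ω)/2, so a cascade of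
  -- filters with equal poles ω produces no polynomial factors in t.
  have hLb : 1 - (1 - ω) / 2 ≤ L := by
    have := one_add_mul_le_pow (a := -((1 - ω) / (2 * n))) (by linarith) n
    have e : (1 : ℝ) + n * -((1 - ω) / (2 * n)) = 1 - (1 - ω) / 2 := by
      field_simp
      ring
    rw [e] at this
    rwa [← sub_eq_add_neg] at this
  have hC0 : 0 ≤ C := by linarith
  induction j generalizing t with
  | zero =>
    induction t with
    | zero => simpa [cascade, response] using hi 0 hj
    | succ t ih =>
      have hLt : 0 ≤ L ^ t := pow_nonneg hL0 t
      have e : cascade ω C G 0 (t + 1) = ω * cascade ω C G 0 t + C * G t := rfl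
      rw [e, pow_succ]
      have h2 := hz0 t
      have h3 := mul_le_mul_of_nonneg_left ih h0
      simp only [pow_zero, mul_one, div_one] at h3 ⊢
      have : 0 ≤ C * L ^ t * (L - ω) := by
        refine mul_nonneg (mul_nonneg hC0 hLt) (by linarith)
      nlinarith
  | succ j ihj =>
    induction t with
    | zero =>
      have h2 := hi (j + 1) hj
      have : C ≤ C * (4 * C) ^ (j + 1) / (1 - ω) ^ (j + 1) := by
        rw [le_div_iff₀ (by positivity)]
        exact mul_le_mul_of_nonneg_left
          ((pow_le_one₀ hp.le hp1).trans (one_le_pow₀ (by linarith))) hC0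
      have e : cascade ω C G (j + 1) 0 = 0 := rfl
      rw [e, pow_zero]
      linarith
    | succ t ih =>
      have hLt : 0 ≤ L ^ t := pow_nonneg hL0 t
      have e : cascade ω C G (j + 1) (t + 1) = ω * cascade ω C G (j + 1) t
        + C * (2 * cascade ω C G j (t + 1) + G t) := rfl
      rw [e]
      have h2 := hz j hj t
      have h3 := mul_le_mul_of_nonneg_left ih h0
      have h4 := mul_le_mul_of_nonneg_left (ihj (by omega) (t + 1)) hC0
      set Q := C * (4 * C) ^ j / (1 - ω) ^ j with hQ
      have hQ0 : 0 ≤ Q := by positivity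
      -- One more link multiplies the amplitude by 4C/(1 − ω). Half of it times 1 − ω is 2CQ, which
      -- the gap L − ω provides and which pays for the input 2CQL of the previous link.
      have e2 : C * (4 * C) ^ (j + 1) / (1 - ω) ^ (j + 1) = 4 * C * Q / (1 - ω) := by
        rw [hQ, pow_succ, pow_succ]
        field_simp
      rw [e2] at h3 ⊢
      set A := 4 * C * Q / (1 - ω) with hA
      have hA' : A * (1 - ω) = 4 * C * Q := by rw [hA]; field_simp
      have hA0 : 0 ≤ A := by positivity
      rw [pow_succ] at h4 ⊢
      have : 0 ≤ L ^ t * (A * (L - ω) - 2 * C * Q * L) := by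
        refine mul_nonneg hLt ?_
        have : A * ((1 - ω) / 2) ≤ A * (L - ω) := mul_le_mul_of_nonneg_left (by linarith) hA0
        have h5 : C * Q * L ≤ C * Q := mul_le_of_le_one_right (by positivity) hL1
        nlinarith
      nlinarith

/-- For x ≤ 1 the power is below x; for x ≥ 1 the cap 1 is below Kx. Saturation thus replaces a
transient of size xⁿ by one of size x. -/
theorem min_one_pow_le {x : ℝ} (hx : 0 ≤ x) {n : ℕ} (hn : 0 < n) {K : ℝ} (hK : 1 ≤ K) :
    min 1 (K * x ^ n) ≤ K * x := by
  rcases le_total x 1 with h | h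
  · refine (min_le_right _ _).trans (mul_le_mul_of_nonneg_left ?_ (by linarith))
    exact pow_le_of_le_one hx h hn.ne'
  · refine (min_le_left _ _).trans ?_
    nlinarith

theorem sum_geometric_le {μ : ℝ} (h0 : 0 ≤ μ) (h1 : μ < 1) (T : ℕ) :
    ∑ t ∈ Finset.range T, μ ^ t ≤ 1 / (1 - μ) := by
  rw [geom_sum_eq h1.ne, ← neg_div_neg_eq]
  have := pow_nonneg h0 T
  exact div_le_div₀ zero_le_one (by linarith) (by linarith) (by linarith)

/-- A saturated transient is at most 1, so its square is bounded by its first power; the forced part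
remains quadratic. -/
theorem sq_min_add_le {a b : ℝ} (ha : 0 ≤ a) (hb : 0 ≤ b) :
    min 1 (a + b) ^ 2 ≤ 2 * min 1 a + 2 * b ^ 2 := by
  have h1 : min 1 (a + b) ≤ min 1 a + b := by
    rcases le_total 1 a with h | h
    · rw [min_eq_left h]
      exact (min_le_left _ _).trans (by linarith)
    · rw [min_eq_right h]
      exact min_le_right _ _
  have h2 : 0 ≤ min 1 a := le_min zero_le_one ha
  have h3 : min 1 a ≤ 1 := min_le_left _ _
  have h4 : 0 ≤ min 1 (a + b) := le_min zero_le_one (by linarith)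
  nlinarith [sq_nonneg (min 1 a - b)]

/-- Transients are at most a constant times (μ^t/(1 − ω))ⁿ with μ = 1 − (1 − ω)/(2n). After
saturation only μ^t/(1 − ω) is summed: one power of 1/(1 − ω) is the amplitude, the other the
geometric series, whatever the number n of links. The forced part has the energy of the cascade. -/
theorem forward_sum_le {C : ℝ} (hC : 1 ≤ C) {n : ℕ} (hn : 0 < n) :
    ∃ K : ℝ, 1 ≤ K ∧ ∀ (ω : ℝ) (z : ℕ → ℕ → ℝ) (G : ℕ → ℝ), 0 ≤ ω → ω < 1 →
      (∀ j t, 0 ≤ z j t) → (∀ t, 0 ≤ G t) → (∀ j < n, z j 0 ≤ C) →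
      (∀ t, z 0 (t + 1) ≤ ω * z 0 t + C * G t) →
      (∀ j, j + 1 < n → ∀ t,
        z (j + 1) (t + 1) ≤ ω * z (j + 1) t + C * (2 * z j (t + 1) + G t)) →
      ∀ T : ℕ, ∑ t ∈ Finset.range (T + 1), min 1 (∑ j ∈ Finset.range n, z j t) ^ 2
        ≤ K * (1 / (1 - ω) ^ 2 + 1 / (1 - ω) ^ (2 * n) * ∑ t ∈ Finset.range T, G t ^ 2) := by
  have hn1 : (1 : ℝ) ≤ n := by exact_mod_cast hn
  have hC0 : 0 ≤ C := by linarith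
  have h4C : 1 ≤ (4 * C) ^ n := one_le_pow₀ (by linarith)
  set K₁ : ℝ := n * (C * (4 * C) ^ n) with hK₁
  have hK₁1 : 1 ≤ K₁ := one_le_mul_of_one_le_of_one_le hn1
    (one_le_mul_of_one_le_of_one_le hC h4C)
  set K₂ : ℝ := 2 * (n * n * (10 * C ^ 2) ^ n) with hK₂
  have hK₂0 : 0 ≤ K₂ := by positivity
  refine ⟨4 * n * K₁ + K₂, by nlinarith, ?_⟩
  intro ω z G h0 h1 hz hG hi hz0 hzs T
  have hp : 0 < 1 - ω := by linarith
  have hp1 : 1 - ω ≤ 1 := by linarith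
  set μ : ℝ := 1 - (1 - ω) / (2 * n) with hμ
  have hx : (1 - ω) / (2 * n) ≤ 1 / 2 := by
    rw [div_le_div_iff₀ (by positivity) (by norm_num)]
    nlinarith
  have hx0 : 0 < (1 - ω) / (2 * n) := by positivity
  have hμ0 : 0 ≤ μ := by linarith
  have hμ1 : μ < 1 := by linarith
  set S := ∑ t ∈ Finset.range T, G t ^ 2
  have hS : 0 ≤ S := Finset.sum_nonneg fun _ _ => sq_nonneg _
  have hDn : ∀ j t, 0 ≤ cascade ω C G j t := cascade_nonneg h0 hC0 hG
  have step : ∀ t, min 1 (∑ j ∈ Finset.range n, z j t) ^ 2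
      ≤ 2 * (K₁ * (μ ^ t / (1 - ω))) + 2 * (∑ j ∈ Finset.range n, cascade ω C G j t) ^ 2 := by
    intro t
    have hsum : ∑ j ∈ Finset.range n, z j t
        ≤ K₁ * (μ ^ t / (1 - ω)) ^ n + ∑ j ∈ Finset.range n, cascade ω C G j t := by
      have : ∀ j ∈ Finset.range n, z j t
          ≤ C * (4 * C) ^ n * (μ ^ t / (1 - ω)) ^ n + cascade ω C G j t := by
        intro j hj
        rw [Finset.mem_range] at hj
        refine (forward_recursion_le hC hn h0 h1 hi hz0 hzs j hj t).trans ?_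
        rw [div_pow, ← pow_mul, ← pow_mul, mul_comm n t, div_mul_eq_mul_div, mul_div_assoc']
        refine add_le_add ?_ le_rfl
        refine div_le_div₀ (by positivity) ?_ (by positivity) ?_
        · gcongr
          · linarith
        · exact pow_le_pow_of_le_one hp.le hp1 hj.le
      refine (Finset.sum_le_sum this).trans ?_
      rw [Finset.sum_add_distrib, Finset.sum_const, Finset.card_range, nsmul_eq_mul]
      rw [hK₁]
      linarith
    have hD0 : 0 ≤ ∑ j ∈ Finset.range n, cascade ω C G j t :=
      Finset.sum_nonneg fun j _ => hDn j t
    have hI0 : 0 ≤ K₁ * (μ ^ t / (1 - ω)) ^ n := by positivity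
    have hz0' : 0 ≤ ∑ j ∈ Finset.range n, z j t := Finset.sum_nonneg fun j _ => hz j t
    calc _ ≤ min 1 (K₁ * (μ ^ t / (1 - ω)) ^ n + ∑ j ∈ Finset.range n, cascade ω C G j t) ^ 2 :=
          pow_le_pow_left₀ (le_min zero_le_one hz0') (min_le_min_left _ hsum) 2
      _ ≤ _ := sq_min_add_le hI0 hD0
      _ ≤ _ := by
          gcongr
          exact min_one_pow_le (by positivity) hn hK₁1
  refine (Finset.sum_le_sum fun t _ => step t).trans ?_
  rw [Finset.sum_add_distrib, ← Finset.mul_sum, ← Finset.mul_sum, ← Finset.mul_sum,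
    ← Finset.sum_div]
  have hgeo : ∑ t ∈ Finset.range (T + 1), μ ^ t ≤ 2 * n / (1 - ω) := by
    refine (sum_geometric_le hμ0 hμ1 _).trans (le_of_eq ?_)
    rw [hμ, sub_sub_cancel]
    field_simp
  have hcas : ∑ t ∈ Finset.range (T + 1), (∑ j ∈ Finset.range n, cascade ω C G j t) ^ 2
      ≤ n * n * (10 * C ^ 2) ^ n * (1 / (1 - ω) ^ (2 * n) * S) := by
    calc _ ≤ ∑ t ∈ Finset.range (T + 1), n * ∑ j ∈ Finset.range n, cascade ω C G j t ^ 2 := by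
          refine Finset.sum_le_sum fun t _ => ?_
          simpa using sq_sum_le_card_mul_sum_sq (s := Finset.range n)
            (f := fun j => cascade ω C G j t)
      _ = n * ∑ j ∈ Finset.range n, ∑ t ∈ Finset.range (T + 1), cascade ω C G j t ^ 2 := by
          rw [← Finset.mul_sum, Finset.sum_comm]
      _ ≤ n * ∑ j ∈ Finset.range n, (10 * C ^ 2) ^ n * (1 / (1 - ω) ^ (2 * n) * S) := by
          gcongr with j hj
          rw [Finset.mem_range] at hj
          refine (sum_sq_cascade_le hC j h0 h1 hG T).trans ?_
          rw [← mul_assoc, mul_one_div]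
          gcongr ?_ * S
          refine div_le_div₀ (by positivity) (pow_le_pow_right₀ (by nlinarith) hj) (by positivity)
            (pow_le_pow_of_le_one hp.le hp1 (by omega))
      _ = _ := by
          rw [Finset.sum_const, Finset.card_range, nsmul_eq_mul]
          ring
  have hR : 0 ≤ 1 / (1 - ω) ^ (2 * n) * S := by positivity
  have hR2 : 0 ≤ 1 / (1 - ω) ^ 2 := by positivity
  calc _ ≤ 2 * (K₁ * ((2 * n / (1 - ω)) / (1 - ω)))
        + 2 * (n * n * (10 * C ^ 2) ^ n * (1 / (1 - ω) ^ (2 * n) * S)) := by gcongr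
    _ = 4 * n * K₁ * (1 / (1 - ω) ^ 2) + K₂ * (1 / (1 - ω) ^ (2 * n) * S) := by
        rw [hK₂]
        field_simp
        ring
    _ ≤ _ := by
        have : 0 ≤ 4 * n * K₁ * (1 / (1 - ω) ^ (2 * n) * S) := by positivity
        have : 0 ≤ K₂ * (1 / (1 - ω) ^ 2) := by positivity
        nlinarith

/-- Induction along the links: the errors `ε j` drive the filter `s j`, and `ω * s j` is the error
created at the next link. Each link costs (1 − ω)^(−2). The factor ω² survives because every error
originates in a compression residual. The bound on `ε j 0` is carried along because it controls the
start `s j 0`. -/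
theorem backward_sum_le {C : ℝ} (hC : 1 ≤ C) (j : ℕ) :
    ∃ K : ℝ, 1 ≤ K ∧ ∀ (n : ℕ) (ω : ℝ) (s ε : ℕ → ℕ → ℝ) (h : ℕ → ℝ), j ≤ n → 0 ≤ ω → ω < 1 →
      (∀ j t, 0 ≤ s j t) → (∀ j t, 0 ≤ ε j t) → (∀ t, ε 0 t = 0) →
      (∀ j < n, ∀ t, ε (j + 1) t ≤ ω * s j t + C * ε j t) →
      (∀ j < n, s j 0 ≤ C * (1 + ε j 0)) →
      (∀ j < n, ∀ t, s j (t + 1) ≤ ω * s j t + C * (ε j (t + 1) + ε j t + h t)) →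
      ε j 0 ≤ K ∧ ∀ T : ℕ, ∑ t ∈ Finset.range (T + 1), ε j t ^ 2
        ≤ K * (ω ^ 2 / (1 - ω) ^ (2 * j) * (1 + ∑ t ∈ Finset.range T, h t ^ 2)) := by
  have hC0 : 0 ≤ C := by linarith
  induction j with
  | zero =>
    refine ⟨1, le_rfl, ?_⟩
    intro n ω s ε h _ h0 h1 _ _ hε0 _ _ _
    refine ⟨by rw [hε0]; exact zero_le_one, fun T => ?_⟩
    have : 0 ≤ ∑ t ∈ Finset.range T, h t ^ 2 := Finset.sum_nonneg fun _ _ => sq_nonneg _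
    simp only [hε0]
    simp only [ne_eq, OfNat.ofNat_ne_zero, not_false_eq_true, zero_pow, Finset.sum_const_zero]
    positivity
  | succ j ih =>
    obtain ⟨K, hK, ih⟩ := ih
    have hK0 : 0 ≤ K := by linarith
    refine ⟨2 * (C ^ 2 * (1 + K) ^ 2 + 6 * C ^ 2 * K + 3 * C ^ 2) + 2 * C ^ 2 * K
      + C * (1 + K) + C * K, by nlinarith [sq_nonneg C], ?_⟩
    intro n ω s ε h hj h0 h1 hs hε hε0 hstep hs0 hrec
    obtain ⟨hA, hsum⟩ := ih n ω s ε h (by omega) h0 h1 hs hε hε0 hstep hs0 hrec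
    have hj' : j < n := by omega
    have hp : 0 < 1 - ω := by linarith
    have hp1 : 1 - ω ≤ 1 := by linarith
    have hs0K : s j 0 ≤ C * (1 + K) := (hs0 j hj').trans (by gcongr)
    constructor
    · have h2 := hstep j hj' 0
      have h3 : ω * s j 0 ≤ s j 0 := mul_le_of_le_one_left (hs j 0) h1.le
      have h4 : C * ε j 0 ≤ C * K := by gcongr
      have : 0 ≤ 2 * (C ^ 2 * (1 + K) ^ 2 + 6 * C ^ 2 * K + 3 * C ^ 2) + 2 * C ^ 2 * K := by
        positivity
      linarith
    · intro T
      set H := ∑ t ∈ Finset.range T, h t ^ 2 with hH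
      have hH0 : 0 ≤ H := Finset.sum_nonneg fun _ _ => sq_nonneg _
      set Q := 1 / (1 - ω) ^ (2 * j) * (1 + H) with hQ
      have hb : 1 ≤ 1 / (1 - ω) ^ (2 * j) := by
        rw [le_div_iff₀ (by positivity), one_mul]
        exact pow_le_one₀ hp.le hp1
      have hQ1 : 1 + H ≤ Q := le_mul_of_one_le_left (by linarith) hb
      have hQ0 : 0 ≤ Q := by linarith
      set Eps := ∑ t ∈ Finset.range (T + 1), ε j t ^ 2 with hEps
      have hEpsK : Eps ≤ K * ω ^ 2 * Q := by
        refine (hsum T).trans (le_of_eq ?_)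
        rw [hQ]
        ring
      -- The factor ω² may be dropped inside the bound for `s j`, which enters the next error
      -- multiplied by ω.
      have hEpsK' : Eps ≤ K * Q := by
        refine hEpsK.trans ?_
        have : ω ^ 2 ≤ 1 := pow_le_one₀ h0 h1.le
        gcongr
        exact mul_le_of_le_one_right hK0 this
      have hin : ∑ t ∈ Finset.range T, (C * (ε j (t + 1) + ε j t + h t)) ^ 2
          ≤ 3 * C ^ 2 * (2 * Eps + H) := by
        calc _ ≤ ∑ t ∈ Finset.range T, 3 * C ^ 2 * (ε j (t + 1) ^ 2 + ε j t ^ 2 + h t ^ 2) := by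
              refine Finset.sum_le_sum fun t _ => ?_
              rw [mul_pow, mul_comm (3 : ℝ), mul_assoc]
              gcongr
              nlinarith [sq_nonneg (ε j (t + 1) - ε j t), sq_nonneg (ε j (t + 1) - h t),
                sq_nonneg (ε j t - h t)]
          _ = 3 * C ^ 2 * (∑ t ∈ Finset.range T, ε j (t + 1) ^ 2
              + ∑ t ∈ Finset.range T, ε j t ^ 2 + H) := by
              rw [← Finset.mul_sum, Finset.sum_add_distrib, Finset.sum_add_distrib]
          _ ≤ _ := by
              have e1 := sum_range_shift_le (A := fun t => ε j t ^ 2) (fun _ => sq_nonneg _) T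
              have e2 := sum_range_prefix_le (A := fun t => ε j t ^ 2) (fun _ => sq_nonneg _) T
              gcongr
              linarith
      have hP : ∑ t ∈ Finset.range (T + 1), s j t ^ 2
          ≤ (C ^ 2 * (1 + K) ^ 2 + 6 * C ^ 2 * K + 3 * C ^ 2) * (Q / (1 - ω) ^ 2) := by
        refine (sum_sq_le_of_recurrence h0 h1 (hs j) (hrec j hj') T).trans ?_
        have e1 : s j 0 ^ 2 / (1 - ω) ≤ C ^ 2 * (1 + K) ^ 2 * Q / (1 - ω) ^ 2 := by
          refine div_le_div₀ (by positivity) ?_ (by positivity) ?_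
          · rw [← mul_pow]
            exact (pow_le_pow_left₀ (hs j 0) hs0K 2).trans
              (le_mul_of_one_le_right (by positivity) (by linarith))
          · exact pow_le_of_le_one hp.le hp1 two_ne_zero
        have e2 : (∑ t ∈ Finset.range T, (C * (ε j (t + 1) + ε j t + h t)) ^ 2) / (1 - ω) ^ 2
            ≤ 3 * C ^ 2 * (2 * (K * Q) + Q) / (1 - ω) ^ 2 := by
          gcongr
          refine hin.trans ?_
          gcongr
          linarith
        refine (add_le_add e1 e2).trans (le_of_eq ?_)
        ring
      have hω2 : 0 ≤ ω ^ 2 := sq_nonneg ω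
      have hQb : Q ≤ Q / (1 - ω) ^ 2 := by
        rw [le_div_iff₀ (by positivity)]
        exact mul_le_of_le_one_right hQ0 (pow_le_one₀ hp.le hp1)
      calc ∑ t ∈ Finset.range (T + 1), ε (j + 1) t ^ 2
          ≤ ∑ t ∈ Finset.range (T + 1), (2 * ω ^ 2 * s j t ^ 2 + 2 * C ^ 2 * ε j t ^ 2) := by
            refine Finset.sum_le_sum fun t _ => ?_
            refine (pow_le_pow_left₀ (hε _ _) (hstep j hj' t) 2).trans ?_
            nlinarith [sq_nonneg (ω * s j t - C * ε j t)]
        _ = 2 * ω ^ 2 * ∑ t ∈ Finset.range (T + 1), s j t ^ 2 + 2 * C ^ 2 * Eps := by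
            rw [Finset.sum_add_distrib, Finset.mul_sum, Finset.mul_sum]
        _ ≤ 2 * ω ^ 2 * ((C ^ 2 * (1 + K) ^ 2 + 6 * C ^ 2 * K + 3 * C ^ 2)
              * (Q / (1 - ω) ^ 2)) + 2 * C ^ 2 * (K * ω ^ 2 * (Q / (1 - ω) ^ 2)) := by
            gcongr
            exact hEpsK.trans (by gcongr)
        _ = (2 * (C ^ 2 * (1 + K) ^ 2 + 6 * C ^ 2 * K + 3 * C ^ 2) + 2 * C ^ 2 * K)
              * (ω ^ 2 * (Q / (1 - ω) ^ 2)) := by ring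
        _ ≤ (2 * (C ^ 2 * (1 + K) ^ 2 + 6 * C ^ 2 * K + 3 * C ^ 2) + 2 * C ^ 2 * K
              + C * (1 + K) + C * K) * (ω ^ 2 * (Q / (1 - ω) ^ 2)) := by
            have : 0 ≤ C * (1 + K) + C * K := by positivity
            exact mul_le_mul_of_nonneg_right (by linarith) (by positivity)
        _ = _ := by
            congr 1
            rw [hQ, show 2 * (j + 1) = 2 * j + 2 by ring, pow_add]
            field_simp

variable {E : ℕ} {d : Fin (E + 1) → ℕ} {k : Fin E → ℕ} {Ξ : Type*}

/-! ### The gradient of the loss -/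

/-- Exact back-propagation through the operators linearized at the activations `y`. -/
def backprop (a : Operators d k) (w : Params k) (y : (e : Fin (E + 1)) → Act d e)
    (e : Fin (E + 1)) : Act d e :=
  Fin.reverseInduction (motive := fun e => Act d e)
    (WithLp.toLp 2 fun _ => (1 : ℝ))
    (fun e v => (jac₁ a e (y e.castSucc) (w e)).adjoint v) e

/-- The parameter gradient assembled from activations `y` and activation gradients `v`. -/
def paramGrad (a : Operators d k) (w : Params k) (y v : (e : Fin (E + 1)) → Act d e) :
    Params k :=
  WithLp.toLp 2 fun e => (jac₂ a e (y e.castSucc) (w e)).adjoint (v e.succ)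

/-- The gradient of the loss, computed by back-propagation. -/
def lossGrad (a : Operators d k) (x : Act d 0) (w : Params k) : Params k :=
  paramGrad a w (forward a x w) (backprop a w (forward a x w))

@[simp] theorem forward_zero (a : Operators d k) (x : Act d 0) (w : Params k) :
    forward a x w 0 = x := rfl

@[simp] theorem forward_succ (a : Operators d k) (x : Act d 0) (w : Params k) (e : Fin E) :
    forward a x w e.succ = a e (forward a x w e.castSucc) (w e) := by
  simp [forward]

@[simp] theorem backprop_last (a : Operators d k) (w : Params k)
    (y : (e : Fin (E + 1)) → Act d e) :
    backprop a w y (Fin.last E) = WithLp.toLp 2 fun _ => (1 : ℝ) := by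
  simp [backprop]

@[simp] theorem backprop_castSucc (a : Operators d k) (w : Params k)
    (y : (e : Fin (E + 1)) → Act d e) (e : Fin E) :
    backprop a w y e.castSucc = (jac₁ a e (y e.castSucc) (w e)).adjoint (backprop a w y e.succ) := by
  simp [backprop]

theorem norm_params_le_sum (w : Params k) : ‖w‖ ≤ ∑ e, ‖w e‖ := by
  rw [PiLp.norm_eq_of_L2]
  refine Real.sqrt_le_iff.mpr ⟨Finset.sum_nonneg fun _ _ => norm_nonneg _, ?_⟩
  exact Finset.sum_sq_le_sq_sum_of_nonneg fun _ _ => norm_nonneg _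

theorem norm_block_le (w : Params k) (e : Fin E) : ‖w e‖ ≤ ‖w‖ := PiLp.norm_apply_le w e

/-- Smoothness with one constant `C ≥ 1` in place of all constants, in linear form. -/
structure Regular (a : Operators d k) (C : ℝ) : Prop where
  one_le : 1 ≤ C
  dim_last : d (Fin.last E) = 1
  differentiable : ∀ e : Fin E,
    Differentiable ℝ (fun z : Act d e.castSucc × Blk k e => a e z.1 z.2)
  jac₁_le : ∀ (e : Fin E) (y : Act d e.castSucc) (w : Blk k e), ‖jac₁ a e y w‖ ≤ C
  jac₂_le : ∀ (e : Fin E) (y : Act d e.castSucc) (w : Blk k e), ‖jac₂ a e y w‖ ≤ C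
  op_sub_le : ∀ e : Fin E, e.succ ≠ Fin.last E → ∀ (y y' : Act d e.castSucc) (w w' : Blk k e),
    ‖a e y w - a e y' w'‖ ≤ C * (‖y - y'‖ + ‖w - w'‖)
  jac₁_sub_le : ∀ e : Fin E, e.castSucc ≠ 0 → ∀ (y y' : Act d e.castSucc) (w w' : Blk k e),
    ‖jac₁ a e y w - jac₁ a e y' w'‖ ≤ C * (‖y - y'‖ + ‖w - w'‖)
  jac₂_sub_le : ∀ e : Fin E, e.castSucc ≠ 0 → ∀ (y y' : Act d e.castSucc) (w w' : Blk k e),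
    ‖jac₂ a e y w - jac₂ a e y' w'‖ ≤ C * (‖y - y'‖ + ‖w - w'‖)
  jac₂_sub_le_first : ∀ e : Fin E, e.castSucc = 0 → ∀ (x : Act d e.castSucc) (w w' : Blk k e),
    ‖jac₂ a e x w - jac₂ a e x w'‖ ≤ C * ‖w - w'‖

theorem le_mul_add_of_sq_le {x y z L C : ℝ} (hL : 0 ≤ L) (hLC : L ≤ C) (hy : 0 ≤ y) (hz : 0 ≤ z)
    (h : x ^ 2 ≤ L ^ 2 * (y ^ 2 + z ^ 2)) : x ≤ C * (y + z) := by
  refine le_trans ?_ (mul_le_mul_of_nonneg_right hLC (by positivity))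
  refine le_of_sq_le_sq ?_ (by positivity)
  refine h.trans ?_
  rw [mul_pow]
  gcongr
  nlinarith [mul_nonneg hy hz]

theorem Smooth.regular {D : Measure (Act d 0)} {a : Operators d k} {Lℓ Ca La Lg C : ℝ}
    (h : Smooth D a Lℓ Ca La Lg) (hLa : 0 ≤ La) (hLg : 0 ≤ Lg) (hC : 1 ≤ C) (hCa : Ca ≤ C)
    (hLaC : La ≤ C) (hLgC : Lg ≤ C) (hd : d (Fin.last E) = 1) : Regular a C where
  one_le := hC
  dim_last := hd
  differentiable := h.differentiable
  jac₁_le e y w := (h.jac_bounded e y w).1.trans hCa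
  jac₂_le e y w := (h.jac_bounded e y w).2.trans hCa
  op_sub_le e he y y' w w' := by
    refine le_mul_add_of_sq_le hLa hLaC (norm_nonneg _) (norm_nonneg _)
      (h.op_lipschitz e ?_ y y' w w')
    have h1 := e.isLt
    have h2 : (e.succ : Fin (E + 1)).val ≠ E := fun hh => he (Fin.ext hh)
    simp only [Fin.val_succ] at h2
    omega
  jac₁_sub_le e he y y' w w' := by
    refine le_mul_add_of_sq_le hLg hLgC (norm_nonneg _) (norm_nonneg _)
      (h.jac_lipschitz e ?_ y y' w w').1
    exact Nat.pos_of_ne_zero fun hh => he (Fin.ext hh)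
  jac₂_sub_le e he y y' w w' := by
    refine le_mul_add_of_sq_le hLg hLgC (norm_nonneg _) (norm_nonneg _)
      (h.jac_lipschitz e ?_ y y' w w').2
    exact Nat.pos_of_ne_zero fun hh => he (Fin.ext hh)
  jac₂_sub_le_first e he x w w' := by
    refine (h.jac_lipschitz_first e ?_ x w w').trans
      (mul_le_mul_of_nonneg_right hLgC (norm_nonneg _))
    have := congrArg Fin.val he
    simpa using this

namespace Regular

variable {a : Operators d k} {C : ℝ}

theorem nonneg (h : Regular a C) : 0 ≤ C := zero_le_one.trans h.one_le

/-- Joint differentiability makes the total derivative the sum of its restrictions to the two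
factors, and these are the partial derivatives. -/
theorem hasFDerivAt_op (h : Regular a C) (e : Fin E) (y : Act d e.castSucc) (w : Blk k e) :
    HasFDerivAt (fun z : Act d e.castSucc × Blk k e => a e z.1 z.2)
      ((jac₁ a e y w).comp (ContinuousLinearMap.fst ℝ _ _)
        + (jac₂ a e y w).comp (ContinuousLinearMap.snd ℝ _ _)) (y, w) := by
  have hd := (h.differentiable e (y, w)).hasFDerivAt
  convert hd using 1
  have h1 : jac₁ a e y w = (fderiv ℝ (fun z : Act d e.castSucc × Blk k e => a e z.1 z.2)
      (y, w)).comp (ContinuousLinearMap.inl ℝ _ _) := by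
    have := hd.comp (f := fun y' : Act d e.castSucc => (y', w)) y (hasFDerivAt_prodMk_left y w)
    exact this.fderiv
  have h2 : jac₂ a e y w = (fderiv ℝ (fun z : Act d e.castSucc × Blk k e => a e z.1 z.2)
      (y, w)).comp (ContinuousLinearMap.inr ℝ _ _) := by
    have := hd.comp (f := fun w' : Blk k e => (y, w')) w (hasFDerivAt_prodMk_right y w)
    exact this.fderiv
  rw [h1, h2]
  refine ContinuousLinearMap.ext fun z => ?_
  simp only [add_apply, ContinuousLinearMap.comp_apply,
    ContinuousLinearMap.coe_fst', ContinuousLinearMap.coe_snd', ContinuousLinearMap.inl_apply,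
    ContinuousLinearMap.inr_apply, ← map_add]
  simp

/-- Duality of forward and reverse differentiation: moving the Jacobian of one worker to the other
side of the inner product turns `backprop` at `e.succ` into `backprop` at `e.castSucc` and splits
off that worker's block of the gradient. -/
theorem exists_hasFDerivAt_forward (h : Regular a C) (x : Act d 0) (w : Params k)
    (e : Fin (E + 1)) :
    ∃ F : Params k →L[ℝ] Act d e, HasFDerivAt (fun w => forward a x w e) F w ∧
      ∀ δ, inner ℝ (backprop a w (forward a x w) e) (F δ)
        = ∑ i : Fin E with i.castSucc < e, inner ℝ (lossGrad a x w i) (δ i) := by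
  induction e using Fin.induction with
  | zero =>
    refine ⟨0, ?_, fun δ => ?_⟩
    · simpa using hasFDerivAt_const x w
    · simp
  | succ e ih =>
    obtain ⟨F, hF, hsum⟩ := ih
    have hproj : HasFDerivAt (fun w : Params k => w e)
        (PiLp.proj (𝕜 := ℝ) 2 (fun e : Fin E => Blk k e) e) w :=
      (PiLp.proj (𝕜 := ℝ) 2 (fun e : Fin E => Blk k e) e).hasFDerivAt
    have hop := (h.hasFDerivAt_op e (forward a x w e.castSucc) (w e)).comp w (hF.prodMk hproj)
    refine ⟨_, hop.congr_of_eventuallyEq (Filter.Eventually.of_forall fun w' => ?_), fun δ => ?_⟩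
    · simp
    · have hset : Finset.univ.filter (fun i : Fin E => i.castSucc < e.succ)
          = insert e (Finset.univ.filter (fun i : Fin E => i.castSucc < e.castSucc)) := by
        ext i
        simp only [Finset.mem_filter, Finset.mem_insert, Finset.mem_univ, true_and]
        rw [Fin.lt_def, Fin.lt_def, Fin.ext_iff]
        simp only [Fin.val_castSucc, Fin.val_succ]
        omega
      rw [hset, Finset.sum_insert (by simp), ← hsum δ, backprop_castSucc]
      simp only [ContinuousLinearMap.comp_apply, add_apply,
        ContinuousLinearMap.prod_apply, ContinuousLinearMap.coe_fst',
        ContinuousLinearMap.coe_snd', inner_add_right, ContinuousLinearMap.adjoint_inner_left,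
        lossGrad, paramGrad, PiLp.proj_apply]
      ring

/-- At the last index the back-propagated vector consists of ones, so the duality identity reads off
the derivative of the loss, the sum over all workers. -/
theorem hasGradientAt_loss (h : Regular a C) (x : Act d 0) (w : Params k) :
    HasGradientAt (loss a x) (lossGrad a x w) w := by
  obtain ⟨F, hF, hsum⟩ := h.exists_hasFDerivAt_forward x w (Fin.last E)
  rw [hasGradientAt_iff_hasFDerivAt]
  have hin : HasFDerivAt (fun w => inner ℝ (WithLp.toLp 2 fun _ => (1 : ℝ) : Act d (Fin.last E))
      (forward a x w (Fin.last E)))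
      ((innerSL ℝ (WithLp.toLp 2 fun _ => (1 : ℝ) : Act d (Fin.last E))).comp F) w :=
    ((innerSL ℝ (WithLp.toLp 2 fun _ => (1 : ℝ) : Act d (Fin.last E))).hasFDerivAt).comp w hF
  have hloss : loss a x = fun w => inner ℝ (WithLp.toLp 2 fun _ => (1 : ℝ) : Act d (Fin.last E))
      (forward a x w (Fin.last E)) := by
    funext w
    simp [loss, PiLp.inner_apply]
  have hdual : InnerProductSpace.toDual ℝ (Params k) (lossGrad a x w)
      = (innerSL ℝ (WithLp.toLp 2 fun _ => (1 : ℝ) : Act d (Fin.last E))).comp F := by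
    refine ContinuousLinearMap.ext fun δ => ?_
    have := hsum δ
    rw [backprop_last] at this
    simp only [InnerProductSpace.toDual_apply_apply, ContinuousLinearMap.comp_apply,
      innerSL_apply_apply]
    rw [this, PiLp.inner_apply]
    refine Finset.sum_congr (Eq.symm ?_) fun _ _ => rfl
    ext i
    simp [Fin.castSucc_lt_last]
  rw [hloss, hdual]
  exact hin

theorem gradient_loss (h : Regular a C) (x : Act d 0) (w : Params k) :
    gradient (loss a x) w = lossGrad a x w :=
  (h.hasGradientAt_loss x w).gradient

end Regular

/-! ### Bounds and Lipschitz estimates for back-propagation -/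

theorem norm_adjoint_apply_le {X Y : Type*} [NormedAddCommGroup X] [InnerProductSpace ℝ X]
    [CompleteSpace X] [NormedAddCommGroup Y] [InnerProductSpace ℝ Y] [CompleteSpace Y]
    (A : X →L[ℝ] Y) (v : Y) : ‖A.adjoint v‖ ≤ ‖A‖ * ‖v‖ := by
  have := A.adjoint.le_opNorm v
  rwa [LinearIsometryEquiv.norm_map] at this

theorem norm_adjoint_apply_sub_le {X Y : Type*} [NormedAddCommGroup X] [InnerProductSpace ℝ X]
    [CompleteSpace X] [NormedAddCommGroup Y] [InnerProductSpace ℝ Y] [CompleteSpace Y]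
    (A A' : X →L[ℝ] Y) (v v' : Y) :
    ‖A.adjoint v - A'.adjoint v'‖ ≤ ‖A - A'‖ * ‖v‖ + ‖A'‖ * ‖v - v'‖ := by
  have h : A.adjoint v - A'.adjoint v' = (A - A').adjoint v + A'.adjoint (v - v') := by
    simp
  rw [h]
  exact (norm_add_le _ _).trans
    (add_le_add (norm_adjoint_apply_le _ _) (norm_adjoint_apply_le _ _))

/-- The total distance of two families of activations with indices `1, …, E - 1`. -/
def actDist (y y' : (e : Fin (E + 1)) → Act d e) : ℝ :=
  ∑ e : Fin E with e.castSucc ≠ 0, ‖y e.castSucc - y' e.castSucc‖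

theorem actDist_nonneg (y y' : (e : Fin (E + 1)) → Act d e) : 0 ≤ actDist y y' :=
  Finset.sum_nonneg fun _ _ => norm_nonneg _

theorem norm_sub_le_actDist (y y' : (e : Fin (E + 1)) → Act d e) {e : Fin E}
    (he : e.castSucc ≠ 0) : ‖y e.castSucc - y' e.castSucc‖ ≤ actDist y y' :=
  Finset.single_le_sum (f := fun e : Fin E => ‖y e.castSucc - y' e.castSucc‖)
    (fun _ _ => norm_nonneg _) (by simpa using he)

/-- A common bound and Lipschitz constant for back-propagated gradients. -/
def gradConst (E : ℕ) (C : ℝ) : ℝ := 2 * E * (C ^ (E + 1) + E * C ^ (E + 1) * C ^ (E + 1))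

theorem one_le_gradConst (hE : 1 ≤ E) {C : ℝ} (hC : 1 ≤ C) : 1 ≤ gradConst E C := by
  have h1 : (1 : ℝ) ≤ E := by exact_mod_cast hE
  have h2 : 1 ≤ C ^ (E + 1) := one_le_pow₀ hC
  have h3 : 0 ≤ (E : ℝ) * C ^ (E + 1) * C ^ (E + 1) := by positivity
  unfold gradConst
  nlinarith

theorem le_mul_min {x K R : ℝ} (hK : 0 ≤ K) (h1 : x ≤ K) (h2 : x ≤ K * R) :
    x ≤ K * min 1 R := by
  rw [mul_min_of_nonneg _ _ hK, mul_one]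
  exact le_min h1 h2

namespace Regular

variable {a : Operators d k} {C : ℝ}

theorem norm_backprop_le (h : Regular a C) (w : Params k) (y : (e : Fin (E + 1)) → Act d e)
    (e : Fin (E + 1)) : ‖backprop a w y e‖ ≤ C ^ (E - e.val) := by
  induction e using Fin.reverseInduction with
  | last =>
    rw [backprop_last, EuclideanSpace.norm_eq]
    simp [h.dim_last]
  | cast e ih =>
    rw [backprop_castSucc]
    refine (norm_adjoint_apply_le _ _).trans ?_
    have he := e.isLt
    rw [Fin.val_castSucc, show E - e.val = E - (e.val + 1) + 1 by omega, pow_succ, mul_comm]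
    exact mul_le_mul ih (h.jac₁_le _ _ _) (norm_nonneg _) (pow_nonneg h.nonneg _)

theorem norm_backprop_le' (h : Regular a C) (w : Params k) (y : (e : Fin (E + 1)) → Act d e)
    (e : Fin (E + 1)) : ‖backprop a w y e‖ ≤ C ^ E :=
  (h.norm_backprop_le w y e).trans (pow_le_pow_right₀ h.one_le (Nat.sub_le _ _))

/-- Going upstream, each worker amplifies the difference by at most C and adds its own Jacobian
increment applied to a bounded vector. Index 0 is left out: ∇₁ of the first operator has no
Lipschitz bound, and the gradient at the data is never needed. -/
theorem norm_backprop_sub_le_pow (h : Regular a C) (w w' : Params k)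
    (y y' : (e : Fin (E + 1)) → Act d e) (e : Fin (E + 1)) (he : e ≠ 0) :
    ‖backprop a w y e - backprop a w' y' e‖
      ≤ (E - e.val : ℕ) * C ^ (E - e.val) * C ^ (E + 1) * (actDist y y' + ‖w - w'‖) := by
  induction e using Fin.reverseInduction with
  | last => simp
  | cast e ih =>
    specialize ih (Fin.succ_ne_zero e)
    have hC := h.nonneg
    set R := actDist y y' + ‖w - w'‖ with hR
    have hR0 : 0 ≤ R := add_nonneg (actDist_nonneg _ _) (norm_nonneg _)
    rw [backprop_castSucc, backprop_castSucc]
    refine (norm_adjoint_apply_sub_le _ _ _ _).trans ?_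
    have h1 : ‖jac₁ a e (y e.castSucc) (w e) - jac₁ a e (y' e.castSucc) (w' e)‖ ≤ C * R := by
      refine (h.jac₁_sub_le e he _ _ _ _).trans ?_
      gcongr
      exact add_le_add (norm_sub_le_actDist y y' he) (norm_block_le (w - w') e)
    have h2 := h.norm_backprop_le' w y e.succ
    have h3 := h.jac₁_le e (y' e.castSucc) (w' e)
    have hlt := e.isLt
    rw [Fin.val_castSucc, show E - e.val = (E - (e.val + 1)) + 1 by omega]
    rw [Fin.val_succ] at ih
    set j := E - (e.val + 1)
    calc _ ≤ C * R * C ^ E + C * (j * C ^ j * C ^ (E + 1) * R) := by gcongr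
      _ = 1 * (C ^ (E + 1) * R) + j * C ^ (j + 1) * (C ^ (E + 1) * R) := by ring
      _ ≤ C ^ (j + 1) * (C ^ (E + 1) * R) + j * C ^ (j + 1) * (C ^ (E + 1) * R) := by
        gcongr
        exact one_le_pow₀ h.one_le
      _ = _ := by
        push_cast
        ring

theorem norm_backprop_sub_le_aux (h : Regular a C) (w w' : Params k)
    (y y' : (e : Fin (E + 1)) → Act d e) (e : Fin (E + 1)) (he : e ≠ 0) :
    ‖backprop a w y e - backprop a w' y' e‖
      ≤ E * C ^ E * C ^ (E + 1) * (actDist y y' + ‖w - w'‖) := by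
  refine (h.norm_backprop_sub_le_pow w w' y y' e he).trans ?_
  have hC := h.nonneg
  have hR0 : 0 ≤ actDist y y' + ‖w - w'‖ := add_nonneg (actDist_nonneg _ _) (norm_nonneg _)
  gcongr
  · exact Nat.sub_le _ _
  · exact h.one_le
  · exact Nat.sub_le _ _

/-- Boundedness and Lipschitz continuity in one estimate. This saturation keeps the transient of the
forward pass cheap. -/
theorem norm_backprop_sub_le (h : Regular a C) (hE : 1 ≤ E) (w w' : Params k)
    (y y' : (e : Fin (E + 1)) → Act d e) (e : Fin (E + 1)) (he : e ≠ 0) :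
    ‖backprop a w y e - backprop a w' y' e‖
      ≤ gradConst E C * min 1 (actDist y y' + ‖w - w'‖) := by
  have hC := h.nonneg
  have hE1 : (1 : ℝ) ≤ E := by exact_mod_cast hE
  have h0 : C ^ E ≤ C ^ (E + 1) := pow_le_pow_right₀ h.one_le (Nat.le_succ _)
  have hA : 0 ≤ C ^ (E + 1) := by positivity
  have hR0 : 0 ≤ actDist y y' + ‖w - w'‖ := add_nonneg (actDist_nonneg _ _) (norm_nonneg _)
  have hEA : 0 ≤ (E : ℝ) * C ^ (E + 1) * C ^ (E + 1) := by positivity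
  refine le_mul_min (zero_le_one.trans (one_le_gradConst hE h.one_le)) ?_ ?_
  · refine (norm_sub_le _ _).trans ?_
    have h1 := h.norm_backprop_le' w y e
    have h2 := h.norm_backprop_le' w' y' e
    unfold gradConst
    nlinarith
  · refine (h.norm_backprop_sub_le_aux w w' y y' e he).trans ?_
    refine mul_le_mul_of_nonneg_right ?_ hR0
    calc (E : ℝ) * C ^ E * C ^ (E + 1) ≤ E * C ^ (E + 1) * C ^ (E + 1) := by gcongr
      _ ≤ _ := by unfold gradConst; nlinarith

theorem norm_paramGrad_le (h : Regular a C) (w : Params k) (y v : (e : Fin (E + 1)) → Act d e) :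
    ‖paramGrad a w y v‖ ≤ C * ∑ e : Fin E, ‖v e.succ‖ := by
  refine (norm_params_le_sum _).trans ?_
  rw [Finset.mul_sum]
  refine Finset.sum_le_sum fun e _ => ?_
  exact (norm_adjoint_apply_le _ _).trans
    (mul_le_mul_of_nonneg_right (h.jac₂_le _ _ _) (norm_nonneg _))

theorem norm_paramGrad_sub_le (h : Regular a C) (w : Params k)
    (y v v' : (e : Fin (E + 1)) → Act d e) :
    ‖paramGrad a w y v - paramGrad a w y v'‖ ≤ C * ∑ e : Fin E, ‖v e.succ - v' e.succ‖ := by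
  have : paramGrad a w y v - paramGrad a w y v' = paramGrad a w y (fun e => v e - v' e) := by
    refine PiLp.ext fun e => ?_
    simp [paramGrad]
  rw [this]
  exact h.norm_paramGrad_le w y _

theorem norm_backGrad_le_aux (h : Regular a C) (w : Params k)
    (y : (e : Fin (E + 1)) → Act d e) :
    ‖paramGrad a w y (backprop a w y)‖ ≤ E * C ^ (E + 1) := by
  have hC := h.nonneg
  refine (h.norm_paramGrad_le w y _).trans ?_
  calc _ ≤ C * ∑ e : Fin E, C ^ E := by
        gcongr with e
        exact h.norm_backprop_le' w y e.succ
    _ = _ := by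
        rw [Finset.sum_const, Finset.card_univ, Fintype.card_fin, nsmul_eq_mul]
        ring

theorem norm_backGrad_le (h : Regular a C) (w : Params k)
    (y : (e : Fin (E + 1)) → Act d e) :
    ‖paramGrad a w y (backprop a w y)‖ ≤ gradConst E C := by
  refine (h.norm_backGrad_le_aux w y).trans ?_
  have hC := h.nonneg
  have h1 : 0 ≤ (E : ℝ) * C ^ (E + 1) := by positivity
  have h2 : 0 ≤ (E : ℝ) * (E * C ^ (E + 1) * C ^ (E + 1)) := by positivity
  unfold gradConst
  nlinarith

/-- The two families must agree at the data index, because the first operator's parameter derivative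
is Lipschitz in the parameters only. -/
theorem norm_backGrad_sub_le (h : Regular a C) (hE : 1 ≤ E) (w w' : Params k)
    (y y' : (e : Fin (E + 1)) → Act d e) (h0 : y 0 = y' 0) :
    ‖paramGrad a w y (backprop a w y) - paramGrad a w' y' (backprop a w' y')‖
      ≤ gradConst E C * min 1 (actDist y y' + ‖w - w'‖) := by
  have hC := h.nonneg
  have hA : 0 ≤ C ^ (E + 1) := by positivity
  set R := actDist y y' + ‖w - w'‖ with hR
  have hR0 : 0 ≤ R := add_nonneg (actDist_nonneg _ _) (norm_nonneg _)
  have hE0 : (0 : ℝ) ≤ E := by positivity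
  refine le_mul_min (zero_le_one.trans (one_le_gradConst hE h.one_le)) ?_ ?_
  · refine (norm_sub_le _ _).trans ?_
    have h1 := h.norm_backGrad_le_aux w y
    have h2 := h.norm_backGrad_le_aux w' y'
    have h3 : 0 ≤ (E : ℝ) * (E * C ^ (E + 1) * C ^ (E + 1)) := by positivity
    unfold gradConst
    nlinarith
  · refine (norm_params_le_sum _).trans ?_
    have hterm : ∀ e : Fin E, ‖(paramGrad a w y (backprop a w y)
        - paramGrad a w' y' (backprop a w' y')) e‖
        ≤ (C ^ (E + 1) + E * C ^ (E + 1) * C ^ (E + 1)) * R := by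
      intro e
      have h1 : ‖jac₂ a e (y e.castSucc) (w e) - jac₂ a e (y' e.castSucc) (w' e)‖ ≤ C * R := by
        by_cases he : e.castSucc = 0
        · have hy : y e.castSucc = y' e.castSucc := by
            rw [he]
            exact h0
          rw [hy]
          refine (h.jac₂_sub_le_first e he _ _ _).trans ?_
          gcongr
          have := norm_block_le (w - w') e
          exact this.trans (le_add_of_nonneg_left (actDist_nonneg _ _))
        · refine (h.jac₂_sub_le e he _ _ _ _).trans ?_
          gcongr
          exact add_le_add (norm_sub_le_actDist y y' he) (norm_block_le (w - w') e)
      have h2 := h.norm_backprop_sub_le_aux w w' y y' e.succ (Fin.succ_ne_zero e)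
      refine (norm_adjoint_apply_sub_le _ _ _ _).trans ?_
      calc _ ≤ C * R * C ^ E + C * (E * C ^ E * C ^ (E + 1) * R) := by
            gcongr
            · exact h.norm_backprop_le' w y e.succ
            · exact h.jac₂_le _ _ _
        _ = _ := by ring
    refine (Finset.sum_le_sum fun e _ => hterm e).trans ?_
    rw [Finset.sum_const, Finset.card_univ, Fintype.card_fin, nsmul_eq_mul]
    have : 0 ≤ (E : ℝ) * ((C ^ (E + 1) + E * C ^ (E + 1) * C ^ (E + 1)) * R) := by positivity
    unfold gradConst
    nlinarith

theorem norm_lossGrad_le (h : Regular a C) (x : Act d 0) (w : Params k) :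
    ‖lossGrad a x w‖ ≤ gradConst E C := h.norm_backGrad_le w _

theorem norm_forward_sub_le (h : Regular a C) (x x' : Act d 0) (w w' : Params k)
    (e : Fin (E + 1)) (he : e ≠ Fin.last E) :
    ‖forward a x w e - forward a x' w' e‖ ≤ C ^ E * (‖x - x'‖ + E * ‖w - w'‖) := by
  have hC := h.nonneg
  have key : ∀ e : Fin (E + 1), e ≠ Fin.last E →
      ‖forward a x w e - forward a x' w' e‖
        ≤ C ^ e.val * (‖x - x'‖ + e.val * ‖w - w'‖) := by
    intro e
    induction e using Fin.induction with
    | zero => simp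
    | succ e ih =>
      intro he
      rw [forward_succ, forward_succ]
      refine (h.op_sub_le e he _ _ _ _).trans ?_
      have h1 := ih (Fin.castSucc_lt_last e).ne
      have h2 := norm_block_le (w - w') e
      rw [Fin.val_castSucc] at h1
      rw [Fin.val_succ]
      calc _ ≤ C * (C ^ e.val * (‖x - x'‖ + e.val * ‖w - w'‖) + 1 * ‖w - w'‖) := by
            rw [one_mul]
            gcongr
            exact h2
        _ ≤ C * (C ^ e.val * (‖x - x'‖ + e.val * ‖w - w'‖) + C ^ e.val * ‖w - w'‖) := by
            gcongr
            exact one_le_pow₀ h.one_le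
        _ = _ := by
            push_cast
            ring
  refine (key e he).trans ?_
  gcongr
  · exact h.one_le
  · exact e.is_le
  · exact e.is_le

theorem norm_lossGrad_sub_le (h : Regular a C) (hE : 1 ≤ E) (x : Act d 0) (w w' : Params k) :
    ‖lossGrad a x w - lossGrad a x w'‖
      ≤ gradConst E C * (E * (C ^ E * E) + 1) * ‖w - w'‖ := by
  have hC := h.nonneg
  have hK := zero_le_one.trans (one_le_gradConst hE h.one_le)
  have hdist : actDist (forward a x w) (forward a x w') ≤ E * (C ^ E * E) * ‖w - w'‖ := by
    calc actDist (forward a x w) (forward a x w')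
        ≤ ∑ e : Fin E with e.castSucc ≠ 0, C ^ E * E * ‖w - w'‖ := by
          refine Finset.sum_le_sum fun e _ => ?_
          have := h.norm_forward_sub_le x x w w' e.castSucc (Fin.castSucc_lt_last e).ne
          rw [sub_self, norm_zero, zero_add] at this
          rwa [mul_assoc]
      _ ≤ ∑ _e : Fin E, C ^ E * E * ‖w - w'‖ :=
          Finset.sum_le_sum_of_subset_of_nonneg (Finset.filter_subset _ _)
            fun _ _ _ => by positivity
      _ = _ := by
          rw [Finset.sum_const, Finset.card_univ, Fintype.card_fin, nsmul_eq_mul]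
          ring
  have hmain : ‖lossGrad a x w - lossGrad a x w'‖ ≤ gradConst E C
      * min 1 (actDist (forward a x w) (forward a x w') + ‖w - w'‖) :=
    h.norm_backGrad_sub_le hE w w' (forward a x w) (forward a x w')
      ((forward_zero a x w).trans (forward_zero a x w').symm)
  refine hmain.trans ?_
  rw [mul_assoc]
  refine mul_le_mul_of_nonneg_left ((min_le_right _ _).trans ?_) hK
  linarith

end Regular

/-! ### Resampling a part of one coordinate of a product measure -/

theorem measurable_update_resample {ι X A : Type*} [DecidableEq ι] [MeasurableSpace X]
    [MeasurableSpace A] (t : ι) {r : X × A → X} (hr : Measurable r) :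
    Measurable (fun q : (ι → X) × A => Function.update q.1 t (r (q.1 t, q.2))) := by
  refine measurable_pi_iff.mpr fun i => ?_
  by_cases hi : i = t
  · subst hi
    simp only [Function.update_self]
    exact hr.comp (((measurable_pi_apply i).comp measurable_fst).prodMk measurable_snd)
  · simp only [Function.update_of_ne hi]
    exact (measurable_pi_apply i).comp measurable_fst

/-- Checked on finite boxes: for a fixed auxiliary variable, the preimage of a box is again a box
with only its t-th side changed, and averaging the measure of this side over the auxiliary variable
restores the original one. This serves in place of conditional expectations. -/
theorem measurePreserving_resample {ι X A : Type*} [DecidableEq ι] [MeasurableSpace X]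
    [MeasurableSpace A] {π : Measure X} [IsProbabilityMeasure π] {α : Measure A}
    [IsProbabilityMeasure α] (t : ι) {r : X × A → X} (hr : MeasurePreserving r (π.prod α) π) :
    MeasurePreserving (fun q : (ι → X) × A => Function.update q.1 t (r (q.1 t, q.2)))
      ((Measure.infinitePi fun _ : ι => π).prod α) (Measure.infinitePi fun _ : ι => π) := by
  have hm := measurable_update_resample (ι := ι) t hr.measurable
  refine ⟨hm, Measure.eq_infinitePi _ fun s B hB => ?_⟩
  have hbox : MeasurableSet (Set.pi (s : Set ι) B) :=
    MeasurableSet.pi s.countable_toSet fun i _ => hB i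
  rw [Measure.map_apply hm hbox, Measure.prod_apply_symm (hm hbox)]
  have hslice : ∀ a : A, MeasurableSet {x | r (x, a) ∈ B t} := fun a =>
    (hr.measurable.comp (measurable_id.prodMk measurable_const)) (hB t)
  have hset : ∀ a : A, (fun ζ : ι → X => (ζ, a)) ⁻¹'
      ((fun q : (ι → X) × A => Function.update q.1 t (r (q.1 t, q.2))) ⁻¹' Set.pi (s : Set ι) B)
      = Set.pi (s : Set ι) (Function.update B t {x | r (x, a) ∈ B t}) := by
    intro a
    ext ζ
    simp only [Set.mem_preimage, Set.mem_pi]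
    refine forall₂_congr fun i _ => ?_
    by_cases hi : i = t
    · subst hi
      simp
    · simp [Function.update_of_ne hi]
  have hmeas : ∀ a i, MeasurableSet (Function.update B t {x | r (x, a) ∈ B t} i) := by
    intro a i
    by_cases hi : i = t
    · subst hi
      simpa using hslice a
    · simpa [Function.update_of_ne hi] using hB i
  simp_rw [hset]
  have hpi : ∀ a, (Measure.infinitePi fun _ : ι => π)
      (Set.pi (s : Set ι) (Function.update B t {x | r (x, a) ∈ B t}))
      = ∏ i ∈ s, π (Function.update B t {x | r (x, a) ∈ B t} i) := fun a =>
    Measure.infinitePi_pi (fun _ : ι => π) (fun i _ => hmeas a i)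
  simp_rw [hpi]
  by_cases ht : t ∈ s
  · have hprod : ∀ a, ∏ i ∈ s, π (Function.update B t {x | r (x, a) ∈ B t} i)
        = π {x | r (x, a) ∈ B t} * ∏ i ∈ s.erase t, π (B i) := by
      intro a
      rw [← Finset.mul_prod_erase s _ ht, Function.update_self]
      congr 1
      refine Finset.prod_congr rfl fun i hi => ?_
      rw [Function.update_of_ne (Finset.ne_of_mem_erase hi)]
    simp_rw [hprod]
    rw [lintegral_mul_const, ← Finset.mul_prod_erase s _ ht]
    · congr 1
      have h1 := hr.measure_preimage (hB t).nullMeasurableSet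
      rw [Measure.prod_apply_symm (hr.measurable (hB t))] at h1
      exact h1
    · exact measurable_measure_prodMk_right (hr.measurable (hB t))
  · have hprod : ∀ a, ∏ i ∈ s, π (Function.update B t {x | r (x, a) ∈ B t} i)
        = ∏ i ∈ s, π (B i) := by
      intro a
      refine Finset.prod_congr rfl fun i hi => ?_
      rw [Function.update_of_ne (fun h => ht (by rw [← h]; exact hi))]
    simp_rw [hprod]
    simp

theorem measurePreserving_pi_update {ι X : Type*} [Fintype ι] [DecidableEq ι] [MeasurableSpace X]
    (ν : Measure X) [IsProbabilityMeasure ν] (t : ι) :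
    MeasurePreserving (fun q : (ι → X) × X => Function.update q.1 t q.2)
      ((Measure.pi fun _ : ι => ν).prod ν) (Measure.pi fun _ : ι => ν) := by
  have := measurePreserving_resample (ι := ι) (π := ν) (α := ν) t (r := Prod.snd)
    measurePreserving_snd
  simpa only [Measure.infinitePi_eq_pi] using this

theorem MeasurePreserving.lift_right {X Y A : Type*} [MeasurableSpace X] [MeasurableSpace Y]
    [MeasurableSpace A] {π : Measure X} {ρ : Measure Y} {α : Measure A} [IsProbabilityMeasure π]
    [IsProbabilityMeasure ρ] [IsProbabilityMeasure α] {r : X × A → X}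
    (hr : MeasurePreserving r (π.prod α) π) :
    MeasurePreserving (fun q : (Y × X) × A => (q.1.1, r (q.1.2, q.2)))
      ((ρ.prod π).prod α) (ρ.prod π) :=
  ((MeasurePreserving.id ρ).prod hr).comp (measurePreserving_prodAssoc ρ π α)

theorem MeasurePreserving.lift_left {X Y A : Type*} [MeasurableSpace X] [MeasurableSpace Y]
    [MeasurableSpace A] {π : Measure X} {ρ : Measure Y} {α : Measure A} [IsProbabilityMeasure π]
    [IsProbabilityMeasure ρ] [IsProbabilityMeasure α] {r : X × A → X}
    (hr : MeasurePreserving r (π.prod α) π) :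
    MeasurePreserving (fun q : (X × Y) × A => (r (q.1.1, q.2), q.1.2))
      ((π.prod ρ).prod α) (π.prod ρ) :=
  Measure.measurePreserving_swap.comp
    ((MeasurePreserving.lift_right (ρ := ρ) hr).comp
      (Measure.measurePreserving_swap.prod (MeasurePreserving.id α)))

/-! ### Resampling one component of a single draw. -/

section Draws

variable [MeasurableSpace Ξ]

/-- The law of the lazy-sampling coin. -/
def coinLaw (p : ℝ) : Measure Bool :=
  ENNReal.ofReal p • Measure.dirac true + ENNReal.ofReal (1 - p) • Measure.dirac false

theorem isProbabilityMeasure_coinLaw {p : ℝ} (h0 : 0 ≤ p) (h1 : p ≤ 1) :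
    IsProbabilityMeasure (coinLaw p) := by
  refine ⟨?_⟩
  simp only [coinLaw, Measure.add_apply, Measure.smul_apply, measure_univ, smul_eq_mul, mul_one]
  rw [← ENNReal.ofReal_add h0 (by linarith)]
  simp

/-- Replace the forward seed of one link. -/
def setF (e : Fin (E + 1)) (q : Draw d Ξ × Ξ) : Draw d Ξ :=
  (q.1.1, q.1.2.1, Function.update q.1.2.2.1 e q.2, q.1.2.2.2)

/-- Replace the backward seed of one link. -/
def setB (e : Fin (E + 1)) (q : Draw d Ξ × Ξ) : Draw d Ξ :=
  (q.1.1, q.1.2.1, q.1.2.2.1, Function.update q.1.2.2.2 e q.2)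

/-- Replace the coin and the data sample. -/
def setX (q : Draw d Ξ × (Bool × Act d 0)) : Draw d Ξ :=
  (q.2.1, q.2.2, q.1.2.2)

variable {p : ℝ} {D : Measure (Act d 0)} [IsProbabilityMeasure D] {ν : Measure Ξ}
  [IsProbabilityMeasure ν]

theorem isProbabilityMeasure_drawLaw (h0 : 0 ≤ p) (h1 : p ≤ 1) :
    IsProbabilityMeasure (drawLaw p D ν) := by
  have := isProbabilityMeasure_coinLaw h0 h1
  change IsProbabilityMeasure ((coinLaw p).prod _)
  infer_instance

theorem measurePreserving_setF (h0 : 0 ≤ p) (h1 : p ≤ 1) (e : Fin (E + 1)) :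
    MeasurePreserving (setF e) ((drawLaw p D ν).prod ν) (drawLaw p D ν) := by
  have := isProbabilityMeasure_coinLaw h0 h1
  exact MeasurePreserving.lift_right (ρ := coinLaw p) (MeasurePreserving.lift_right (ρ := D)
    (MeasurePreserving.lift_left (ρ := Measure.pi fun _ : Fin (E + 1) => ν)
      (measurePreserving_pi_update ν e)))

theorem measurePreserving_setB (h0 : 0 ≤ p) (h1 : p ≤ 1) (e : Fin (E + 1)) :
    MeasurePreserving (setB e) ((drawLaw p D ν).prod ν) (drawLaw p D ν) := by
  have := isProbabilityMeasure_coinLaw h0 h1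
  exact MeasurePreserving.lift_right (ρ := coinLaw p) (MeasurePreserving.lift_right (ρ := D)
    (MeasurePreserving.lift_right (ρ := Measure.pi fun _ : Fin (E + 1) => ν)
      (measurePreserving_pi_update ν e)))

theorem measurePreserving_setX (h0 : 0 ≤ p) (h1 : p ≤ 1) :
    MeasurePreserving setX ((drawLaw p D ν).prod ((coinLaw p).prod D)) (drawLaw p D ν) := by
  have := isProbabilityMeasure_coinLaw h0 h1
  have hsnd : MeasurePreserving (fun q : Draw d Ξ => q.2.2) (drawLaw p D ν)
      ((Measure.pi fun _ => ν).prod (Measure.pi fun _ => ν)) :=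
    measurePreserving_snd.comp (measurePreserving_snd (μ := coinLaw p))
  have := isProbabilityMeasure_drawLaw (D := D) (ν := ν) h0 h1
  exact (measurePreserving_prodAssoc (coinLaw p) D _).comp
    (((MeasurePreserving.id ((coinLaw p).prod D)).prod hsnd).comp
      Measure.measurePreserving_swap)

end Draws

/-! ### Second moments -/

section Moments

variable {Ω : Type*} [MeasurableSpace Ω] {P : Measure Ω}
variable {F₀ F₁ F₂ F₃ F₄ : Type*} [NormedAddCommGroup F₀] [NormedAddCommGroup F₁]
  [NormedAddCommGroup F₂] [NormedAddCommGroup F₃] [NormedAddCommGroup F₄]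

theorem lpNorm_two_sq {X : Ω → F₀} (hX : MemLp X 2 P) : lpNorm X 2 P ^ 2 = ∫ ω, ‖X ω‖ ^ 2 ∂P := by
  rw [lpNorm_eq_integral_norm_rpow_toReal two_ne_zero ENNReal.ofNat_ne_top
    hX.aestronglyMeasurable]
  have h0 : 0 ≤ ∫ ω, ‖X ω‖ ^ 2 ∂P := integral_nonneg fun _ => sq_nonneg _
  simp only [ENNReal.toReal_ofNat, Real.rpow_ofNat]
  rw [← Real.rpow_natCast, ← Real.rpow_mul h0]
  simp

/-- Minkowski's inequality for a pointwise bound, yielding square integrability and the norm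
estimate together. -/
theorem memLp_and_lpNorm_le₂ {X : Ω → F₀} {Y₁ : Ω → F₁} {Y₂ : Ω → F₂} {c₁ c₂ : ℝ}
    (h₁ : 0 ≤ c₁) (h₂ : 0 ≤ c₂) (hX : AEStronglyMeasurable X P) (hY₁ : MemLp Y₁ 2 P)
    (hY₂ : MemLp Y₂ 2 P) (h : ∀ ω, ‖X ω‖ ≤ c₁ * ‖Y₁ ω‖ + c₂ * ‖Y₂ ω‖) :
    MemLp X 2 P ∧ lpNorm X 2 P ≤ c₁ * lpNorm Y₁ 2 P + c₂ * lpNorm Y₂ 2 P := by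
  have m₁ : MemLp (fun ω => c₁ * ‖Y₁ ω‖) 2 P := hY₁.norm.const_mul c₁
  have m₂ : MemLp (fun ω => c₂ * ‖Y₂ ω‖) 2 P := hY₂.norm.const_mul c₂
  refine ⟨(m₁.add m₂).mono' hX (Filter.Eventually.of_forall h), ?_⟩
  refine (lpNorm_mono_real (m₁.add m₂) h).trans ((lpNorm_add_le m₁ one_le_two).trans ?_)
  rw [← lpNorm_norm hY₁.aestronglyMeasurable, ← lpNorm_norm hY₂.aestronglyMeasurable]
  have e₁ := lpNorm_const_smul (p := 2) c₁ (fun ω => ‖Y₁ ω‖) P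
  have e₂ := lpNorm_const_smul (p := 2) c₂ (fun ω => ‖Y₂ ω‖) P
  rw [coe_nnnorm, Real.norm_of_nonneg h₁] at e₁
  rw [coe_nnnorm, Real.norm_of_nonneg h₂] at e₂
  exact le_of_eq (congrArg₂ _ e₁ e₂)

theorem memLp_and_lpNorm_le₃ {X : Ω → F₀} {Y₁ : Ω → F₁} {Y₂ : Ω → F₂} {Y₃ : Ω → F₃}
    {c₁ c₂ c₃ : ℝ} (h₁ : 0 ≤ c₁) (h₂ : 0 ≤ c₂) (h₃ : 0 ≤ c₃) (hX : AEStronglyMeasurable X P)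
    (hY₁ : MemLp Y₁ 2 P) (hY₂ : MemLp Y₂ 2 P) (hY₃ : MemLp Y₃ 2 P)
    (h : ∀ ω, ‖X ω‖ ≤ c₁ * ‖Y₁ ω‖ + c₂ * ‖Y₂ ω‖ + c₃ * ‖Y₃ ω‖) :
    MemLp X 2 P ∧ lpNorm X 2 P ≤ c₁ * lpNorm Y₁ 2 P + c₂ * lpNorm Y₂ 2 P + c₃ * lpNorm Y₃ 2 P := by
  have m : MemLp (fun ω => c₁ * ‖Y₁ ω‖ + c₂ * ‖Y₂ ω‖) 2 P :=
    (hY₁.norm.const_mul c₁).add (hY₂.norm.const_mul c₂)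
  have hn : ∀ ω, ‖c₁ * ‖Y₁ ω‖ + c₂ * ‖Y₂ ω‖‖ = c₁ * ‖Y₁ ω‖ + c₂ * ‖Y₂ ω‖ :=
    fun ω => Real.norm_of_nonneg (by positivity)
  have a := memLp_and_lpNorm_le₂ h₁ h₂ m.aestronglyMeasurable hY₁ hY₂ fun ω => (hn ω).le
  have b := memLp_and_lpNorm_le₂ zero_le_one h₃ hX m hY₃ fun ω => by
    rw [hn, one_mul]
    exact h ω
  exact ⟨b.1, b.2.trans (by linarith [a.2])⟩

theorem memLp_and_lpNorm_le₄ {X : Ω → F₀} {Y₁ : Ω → F₁} {Y₂ : Ω → F₂} {Y₃ : Ω → F₃}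
    {Y₄ : Ω → F₄} {c₁ c₂ c₃ c₄ : ℝ} (h₁ : 0 ≤ c₁) (h₂ : 0 ≤ c₂) (h₃ : 0 ≤ c₃) (h₄ : 0 ≤ c₄)
    (hX : AEStronglyMeasurable X P) (hY₁ : MemLp Y₁ 2 P) (hY₂ : MemLp Y₂ 2 P)
    (hY₃ : MemLp Y₃ 2 P) (hY₄ : MemLp Y₄ 2 P)
    (h : ∀ ω, ‖X ω‖ ≤ c₁ * ‖Y₁ ω‖ + c₂ * ‖Y₂ ω‖ + c₃ * ‖Y₃ ω‖ + c₄ * ‖Y₄ ω‖) :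
    MemLp X 2 P ∧ lpNorm X 2 P
      ≤ c₁ * lpNorm Y₁ 2 P + c₂ * lpNorm Y₂ 2 P + c₃ * lpNorm Y₃ 2 P + c₄ * lpNorm Y₄ 2 P := by
  have m : MemLp (fun ω => c₁ * ‖Y₁ ω‖ + c₂ * ‖Y₂ ω‖) 2 P :=
    (hY₁.norm.const_mul c₁).add (hY₂.norm.const_mul c₂)
  have hn : ∀ ω, ‖c₁ * ‖Y₁ ω‖ + c₂ * ‖Y₂ ω‖‖ = c₁ * ‖Y₁ ω‖ + c₂ * ‖Y₂ ω‖ :=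
    fun ω => Real.norm_of_nonneg (by positivity)
  have a := memLp_and_lpNorm_le₂ h₁ h₂ m.aestronglyMeasurable hY₁ hY₂ fun ω => (hn ω).le
  have b := memLp_and_lpNorm_le₃ zero_le_one h₃ h₄ hX m hY₃ hY₄ fun ω => by
    rw [hn, one_mul]
    exact h ω
  exact ⟨b.1, b.2.trans (by linarith [a.2])⟩

/-- Stated with lower integrals, so that the square integrability of `X` is a conclusion. -/
theorem memLp_two_of_lintegral_le {X : Ω → F₀} {Y : Ω → F₁} {c : ℝ} (hc : 0 ≤ c)
    (hX : AEStronglyMeasurable X P) (hY : MemLp Y 2 P)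
    (h : ∫⁻ ω, ENNReal.ofReal (‖X ω‖ ^ 2) ∂P
      ≤ ENNReal.ofReal (c ^ 2) * ∫⁻ ω, ENNReal.ofReal (‖Y ω‖ ^ 2) ∂P) :
    MemLp X 2 P ∧ lpNorm X 2 P ≤ c * lpNorm Y 2 P := by
  have hYi : Integrable (fun ω => ‖Y ω‖ ^ 2) P := (memLp_two_iff_integrable_sq_norm
    hY.aestronglyMeasurable).mp hY
  have hYl := ofReal_integral_eq_lintegral_ofReal hYi
    (Filter.Eventually.of_forall fun _ => sq_nonneg _)
  rw [← hYl, ← ENNReal.ofReal_mul (sq_nonneg c)] at h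
  have hXm : AEStronglyMeasurable (fun ω => ‖X ω‖ ^ 2) P := hX.norm.pow 2
  have hXi : Integrable (fun ω => ‖X ω‖ ^ 2) P := by
    refine ⟨hXm, ?_⟩
    rw [hasFiniteIntegral_iff_ofReal (Filter.Eventually.of_forall fun _ => sq_nonneg _)]
    exact h.trans_lt ENNReal.ofReal_lt_top
  have hXL : MemLp X 2 P := (memLp_two_iff_integrable_sq_norm hX).mpr hXi
  refine ⟨hXL, ?_⟩
  rw [← ofReal_integral_eq_lintegral_ofReal hXi
    (Filter.Eventually.of_forall fun _ => sq_nonneg _)] at h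
  have h0 : 0 ≤ ∫ ω, ‖Y ω‖ ^ 2 ∂P := integral_nonneg fun _ => sq_nonneg _
  rw [ENNReal.ofReal_le_ofReal_iff (by positivity), ← lpNorm_two_sq hXL, ← lpNorm_two_sq hY,
    ← mul_pow] at h
  exact le_of_sq_le_sq h (mul_nonneg hc lpNorm_nonneg)

end Moments

set_option linter.unusedSectionVars false

/-! ### The iterates as functions of the draws -/

/-- The data that determine the iterates of the algorithm as functions of the draws. -/
structure Algo (d : Fin (E + 1) → ℕ) (k : Fin E → ℕ) (Ξ : Type*) where
  γ : ℝ
  m : ℝ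
  op : Operators d k
  CF : Compressors d Ξ
  CB : Compressors d Ξ
  w₁ : Params k

namespace Algo

variable (A : Algo d k Ξ)

/-- The state before iteration `t`. -/
def st (t : ℕ) (ζ : ℕ → Draw d Ξ) : State d k := run A.γ A.m A.op A.CF A.CB A.w₁ ζ t

/-- The parameters before iteration `t`. -/
def w (t : ℕ) (ζ : ℕ → Draw d Ξ) : Params k := (A.st t ζ).w

/-- The momentum before iteration `t`. -/
def u (t : ℕ) (ζ : ℕ → Draw d Ξ) : Params k := (A.st t ζ).u

/-- The compressed activations before iteration `t`. -/
def y (t : ℕ) (ζ : ℕ → Draw d Ξ) (e : Fin (E + 1)) : Act d e := (A.st t ζ).y e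

/-- The compressed activation gradients before iteration `t`. -/
def v (t : ℕ) (ζ : ℕ → Draw d Ξ) (e : Fin (E + 1)) : Act d e := (A.st t ζ).v e

/-- The sample of iteration `t`. -/
def x (t : ℕ) (ζ : ℕ → Draw d Ξ) : Act d 0 := (A.st (t + 1) ζ).x

@[simp] theorem w_zero (ζ : ℕ → Draw d Ξ) : A.w 0 ζ = A.w₁ := rfl
@[simp] theorem u_zero (ζ : ℕ → Draw d Ξ) : A.u 0 ζ = 0 := rfl
@[simp] theorem y_zero (ζ : ℕ → Draw d Ξ) (e : Fin (E + 1)) : A.y 0 ζ e = 0 := rfl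
@[simp] theorem v_zero (ζ : ℕ → Draw d Ξ) (e : Fin (E + 1)) : A.v 0 ζ e = 0 := rfl

theorem x_zero (ζ : ℕ → Draw d Ξ) : A.x 0 ζ = (ζ 0).2.1 := by
  simp [x, st, run, iteration]

theorem x_succ (t : ℕ) (ζ : ℕ → Draw d Ξ) :
    A.x (t + 1) ζ = if (ζ (t + 1)).1 = true then (ζ (t + 1)).2.1 else A.x t ζ := by
  rw [x, st, run]
  simp [iteration, x, st]

theorem w_succ (t : ℕ) (ζ : ℕ → Draw d Ξ) :
    A.w (t + 1) ζ = A.w t ζ - A.γ • A.u (t + 1) ζ := rfl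

theorem u_succ (t : ℕ) (ζ : ℕ → Draw d Ξ) :
    A.u (t + 1) ζ = (1 - A.m) • A.u t ζ
      + A.m • paramGrad A.op (A.w t ζ) (A.y (t + 1) ζ) (A.v (t + 1) ζ) := rfl

theorem y_succ_zero (t : ℕ) (ζ : ℕ → Draw d Ξ) : A.y (t + 1) ζ 0 = A.x t ζ := rfl

theorem y_succ_succ (t : ℕ) (ζ : ℕ → Draw d Ξ) (e : Fin E) :
    A.y (t + 1) ζ e.succ = A.y t ζ e.succ + A.CF e.succ ((ζ t).2.2.1 e.succ)
      (A.op e (A.y (t + 1) ζ e.castSucc) (A.w t ζ e) - A.y t ζ e.succ) := by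
  simp only [y, w, st, run, iteration, forwardPass, Fin.induction_succ]

theorem v_succ_last (t : ℕ) (ζ : ℕ → Draw d Ξ) :
    A.v (t + 1) ζ (Fin.last E) = WithLp.toLp 2 fun _ => (1 : ℝ) := by
  simp only [v, st, run, iteration, backwardPass, Fin.reverseInduction_last]

theorem v_succ_castSucc (t : ℕ) (ζ : ℕ → Draw d Ξ) (e : Fin E) :
    A.v (t + 1) ζ e.castSucc = A.v t ζ e.castSucc + A.CB e.castSucc ((ζ t).2.2.2 e.castSucc)
      ((jac₁ A.op e (A.y (t + 1) ζ e.castSucc) (A.w t ζ e)).adjoint (A.v (t + 1) ζ e.succ)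
        - A.v t ζ e.castSucc) := by
  simp only [v, y, w, st, run, iteration, backwardPass, Fin.reverseInduction_castSucc]

/-! ### Dependence on the draws -/

theorem st_congr {ζ ζ' : ℕ → Draw d Ξ} {t : ℕ} (h : ∀ s < t, ζ s = ζ' s) :
    A.st t ζ = A.st t ζ' := by
  induction t with
  | zero => rfl
  | succ t ih =>
    have h1 := ih fun s hs => h s (hs.trans (Nat.lt_succ_self t))
    simp only [st] at h1
    simp only [st, run, h1, h t (Nat.lt_succ_self t)]

theorem st_update (t : ℕ) (ζ : ℕ → Draw d Ξ) (z : Draw d Ξ) :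
    A.st t (Function.update ζ t z) = A.st t ζ :=
  A.st_congr fun _ hs => Function.update_of_ne hs.ne _ _

theorem w_update (t : ℕ) (ζ : ℕ → Draw d Ξ) (z : Draw d Ξ) :
    A.w t (Function.update ζ t z) = A.w t ζ := by rw [w, st_update, w]

theorem y_update (t : ℕ) (ζ : ℕ → Draw d Ξ) (z : Draw d Ξ) :
    A.y t (Function.update ζ t z) = A.y t ζ := by
  funext e
  rw [y, st_update, y]

theorem v_update (t : ℕ) (ζ : ℕ → Draw d Ξ) (z : Draw d Ξ) :
    A.v t (Function.update ζ t z) = A.v t ζ := by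
  funext e
  rw [v, st_update, v]

theorem x_update (t : ℕ) (ζ : ℕ → Draw d Ξ) (z : Draw d Ξ) :
    A.x t (Function.update ζ (t + 1) z) = A.x t ζ := by
  rw [x, st_update, x]

theorem x_update_of_eq (t : ℕ) (ζ : ℕ → Draw d Ξ) (z : Draw d Ξ) (h1 : z.1 = (ζ t).1)
    (h2 : z.2.1 = (ζ t).2.1) : A.x t (Function.update ζ t z) = A.x t ζ := by
  cases t with
  | zero => simp [x_zero, h2]
  | succ t =>
    rw [x_succ, x_succ, x_update]
    simp [h1, h2]

/-- The forward pass is causal: an activation depends on the seeds of its own link and of the links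
before it only. -/
theorem y_update_setF (t : ℕ) (ζ : ℕ → Draw d Ξ) (e₀ : Fin (E + 1)) (ξ : Ξ) (e : Fin (E + 1))
    (he : e < e₀) :
    A.y (t + 1) (Function.update ζ t (setF e₀ (ζ t, ξ))) e = A.y (t + 1) ζ e := by
  induction e using Fin.induction with
  | zero =>
    rw [y_succ_zero, y_succ_zero]
    exact A.x_update_of_eq t ζ _ rfl rfl
  | succ e ih =>
    have h1 := ih ((Fin.castSucc_lt_succ (i := e)).trans he)
    rw [y_succ_succ, y_succ_succ, h1, w_update, y_update]
    simp [setF, Function.update_of_ne he.ne]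

/-- Backward seeds are used after the forward pass is complete. -/
theorem y_update_setB (t : ℕ) (ζ : ℕ → Draw d Ξ) (e₀ : Fin (E + 1)) (ξ : Ξ) :
    A.y (t + 1) (Function.update ζ t (setB e₀ (ζ t, ξ))) = A.y (t + 1) ζ := by
  funext e
  induction e using Fin.induction with
  | zero =>
    rw [y_succ_zero, y_succ_zero]
    exact A.x_update_of_eq t ζ _ rfl rfl
  | succ e ih =>
    rw [y_succ_succ, y_succ_succ, ih, w_update, y_update]
    simp [setB]

theorem v_update_setB (t : ℕ) (ζ : ℕ → Draw d Ξ) (e₀ : Fin (E + 1)) (ξ : Ξ) (e : Fin (E + 1))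
    (he : e₀ < e) :
    A.v (t + 1) (Function.update ζ t (setB e₀ (ζ t, ξ))) e = A.v (t + 1) ζ e := by
  induction e using Fin.reverseInduction with
  | last => rw [v_succ_last, v_succ_last]
  | cast e ih =>
    have h1 := ih (he.trans (Fin.castSucc_lt_succ (i := e)))
    rw [v_succ_castSucc, v_succ_castSucc, h1, w_update, v_update, y_update_setB]
    simp [setB, Function.update_of_ne he.ne']

end Algo

/-! ### Measurability -/

theorem measurable_euclidean {ι Ω : Type*} [MeasurableSpace Ω] {g : Ω → EuclideanSpace ℝ ι}
    (h : ∀ i, Measurable fun ω => g ω i) : Measurable g :=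
  (WithLp.measurable_toLp 2 (ι → ℝ)).comp (measurable_pi_iff.mpr h)

theorem measurable_params {Ω : Type*} [MeasurableSpace Ω] {g : Ω → Params k}
    (h : ∀ e, Measurable fun ω => g ω e) : Measurable g :=
  (WithLp.measurable_toLp 2 ((e : Fin E) → Blk k e)).comp (measurable_pi_iff.mpr h)

theorem measurable_block {Ω : Type*} [MeasurableSpace Ω] {g : Ω → Params k} (h : Measurable g)
    (e : Fin E) : Measurable fun ω => g ω e :=
  (measurable_pi_apply e).comp ((WithLp.measurable_ofLp 2 _).comp h)

/-- The coordinates of `(L ω).adjoint (V ω)` are inner products of `V ω` with the images of basis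
vectors, so it is enough that `L` is measurable when applied to fixed vectors. -/
theorem measurable_adjoint_apply {n n' : ℕ} {Ω : Type*} [MeasurableSpace Ω]
    {L : Ω → EuclideanSpace ℝ (Fin n) →L[ℝ] EuclideanSpace ℝ (Fin n')}
    {V : Ω → EuclideanSpace ℝ (Fin n')} (hL : ∀ z, Measurable fun ω => L ω z)
    (hV : Measurable V) : Measurable fun ω => (L ω).adjoint (V ω) := by
  refine measurable_euclidean fun i => ?_
  have : (fun ω => (L ω).adjoint (V ω) i)
      = fun ω => inner ℝ (L ω (EuclideanSpace.single i 1)) (V ω) := by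
    funext ω
    rw [← ContinuousLinearMap.adjoint_inner_right, EuclideanSpace.inner_single_left]
    simp
  rw [this]
  exact (hL _).inner hV

namespace Regular

variable {a : Operators d k} {C : ℝ} {Ω : Type*} [MeasurableSpace Ω]

theorem continuous_op (h : Regular a C) (e : Fin E) :
    Continuous (fun z : Act d e.castSucc × Blk k e => a e z.1 z.2) :=
  (h.differentiable e).continuous

theorem measurable_op (h : Regular a C) (e : Fin E) {Y : Ω → Act d e.castSucc} {W : Ω → Blk k e}
    (hY : Measurable Y) (hW : Measurable W) : Measurable fun ω => a e (Y ω) (W ω) :=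
  (h.continuous_op e).measurable.comp (hY.prodMk hW)

theorem measurable_jac₁_adjoint (h : Regular a C) (e : Fin E) {Y : Ω → Act d e.castSucc}
    {W : Ω → Blk k e} {V : Ω → Act d e.succ}
    (hY : Measurable Y) (hW : Measurable W) (hV : Measurable V) :
    Measurable fun ω => (jac₁ a e (Y ω) (W ω)).adjoint (V ω) := by
  refine measurable_adjoint_apply (fun z => ?_) hV
  have hc : Continuous (Function.uncurry fun (w : Blk k e) (y : Act d e.castSucc) => a e y w) :=
    (h.continuous_op e).comp continuous_swap
  exact (measurable_fderiv_apply_const_with_param ℝ hc z).comp (hW.prodMk hY)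

theorem measurable_jac₂_adjoint (h : Regular a C) (e : Fin E) {Y : Ω → Act d e.castSucc}
    {W : Ω → Blk k e} {V : Ω → Act d e.succ}
    (hY : Measurable Y) (hW : Measurable W) (hV : Measurable V) :
    Measurable fun ω => (jac₂ a e (Y ω) (W ω)).adjoint (V ω) := by
  refine measurable_adjoint_apply (fun z => ?_) hV
  have hc : Continuous (Function.uncurry fun (y : Act d e.castSucc) (w : Blk k e) => a e y w) :=
    h.continuous_op e
  exact (measurable_fderiv_apply_const_with_param ℝ hc z).comp (hY.prodMk hW)

theorem measurable_forward (h : Regular a C) {X : Ω → Act d 0} {W : Ω → Params k}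
    (hX : Measurable X) (hW : Measurable W) (e : Fin (E + 1)) :
    Measurable fun ω => forward a (X ω) (W ω) e := by
  induction e using Fin.induction with
  | zero => exact hX
  | succ e ih =>
    simp only [forward_succ]
    exact h.measurable_op e ih (measurable_block hW e)

theorem measurable_backprop (h : Regular a C) {W : Ω → Params k}
    {Y : Ω → (e : Fin (E + 1)) → Act d e} (hW : Measurable W)
    (hY : ∀ e, e ≠ Fin.last E → Measurable fun ω => Y ω e) (e : Fin (E + 1)) :
    Measurable fun ω => backprop a (W ω) (Y ω) e := by
  induction e using Fin.reverseInduction with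
  | last =>
    simp only [backprop_last]
    exact measurable_const
  | cast e ih =>
    simp only [backprop_castSucc]
    exact h.measurable_jac₁_adjoint e (hY _ (Fin.castSucc_lt_last e).ne) (measurable_block hW e) ih

theorem measurable_paramGrad (h : Regular a C) {W : Ω → Params k}
    {Y V : Ω → (e : Fin (E + 1)) → Act d e} (hW : Measurable W)
    (hY : ∀ e, e ≠ Fin.last E → Measurable fun ω => Y ω e)
    (hV : ∀ e, e ≠ 0 → Measurable fun ω => V ω e) :
    Measurable fun ω => paramGrad a (W ω) (Y ω) (V ω) :=
  measurable_params fun e => h.measurable_jac₂_adjoint e (hY _ (Fin.castSucc_lt_last e).ne)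
    (measurable_block hW e) (hV _ (Fin.succ_ne_zero e))

theorem measurable_lossGrad (h : Regular a C) {X : Ω → Act d 0} {W : Ω → Params k}
    (hX : Measurable X) (hW : Measurable W) : Measurable fun ω => lossGrad a (X ω) (W ω) :=
  h.measurable_paramGrad hW (fun e _ => h.measurable_forward hX hW e)
    fun e _ => h.measurable_backprop hW (fun e _ => h.measurable_forward hX hW e) e

end Regular

namespace Algo

variable [MeasurableSpace Ξ] {A : Algo d k Ξ} {C : ℝ}

/-- Measurability of all compressors in use. -/
structure MeasurableCompressors (A : Algo d k Ξ) : Prop where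
  forward : ∀ e : Fin (E + 1), e ≠ 0 → e ≠ Fin.last E →
    Measurable (fun q : Ξ × Act d e => A.CF e q.1 q.2)
  backward : ∀ e : Fin (E + 1), e ≠ 0 → e ≠ Fin.last E →
    Measurable (fun q : Ξ × Act d e => A.CB e q.1 q.2)

theorem measurable_x (A : Algo d k Ξ) (t : ℕ) : Measurable (A.x t) := by
  have hd : ∀ s : ℕ, Measurable fun ζ : ℕ → Draw d Ξ => (ζ s).2.1 := fun s =>
    measurable_fst.comp (measurable_snd.comp (measurable_pi_apply s))
  induction t with
  | zero =>
    have : A.x 0 = fun ζ => (ζ 0).2.1 := funext A.x_zero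
    rw [this]
    exact hd 0
  | succ t ih =>
    have : A.x (t + 1) = fun ζ => if (ζ (t + 1)).1 = true then (ζ (t + 1)).2.1 else A.x t ζ :=
      funext (A.x_succ t)
    rw [this]
    refine Measurable.ite ?_ (hd _) ih
    exact (measurable_fst.comp (measurable_pi_apply (t + 1)))
      (measurableSet_singleton true)

theorem measurable_components (hr : Regular A.op C) (hc : A.MeasurableCompressors) (t : ℕ) :
    Measurable (A.w t) ∧ Measurable (A.u t)
      ∧ (∀ e, e ≠ Fin.last E → Measurable fun ζ => A.y t ζ e)
      ∧ (∀ e, e ≠ 0 → Measurable fun ζ => A.v t ζ e) := by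
  induction t with
  | zero =>
    exact ⟨measurable_const, measurable_const, fun _ _ => measurable_const,
      fun _ _ => measurable_const⟩
  | succ t ih =>
    obtain ⟨hw, hu, hy, hv⟩ := ih
    have hseed : ∀ e, Measurable fun ζ : ℕ → Draw d Ξ => (ζ t).2.2.1 e := fun e =>
      (measurable_pi_apply e).comp (measurable_fst.comp (measurable_snd.comp
        (measurable_snd.comp (measurable_pi_apply t))))
    have hseed' : ∀ e, Measurable fun ζ : ℕ → Draw d Ξ => (ζ t).2.2.2 e := fun e =>
      (measurable_pi_apply e).comp (measurable_snd.comp (measurable_snd.comp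
        (measurable_snd.comp (measurable_pi_apply t))))
    have hy' : ∀ e, e ≠ Fin.last E → Measurable fun ζ => A.y (t + 1) ζ e := by
      intro e
      induction e using Fin.induction with
      | zero =>
        intro _
        simp only [y_succ_zero]
        exact A.measurable_x t
      | succ e ih =>
        intro he
        simp only [y_succ_succ]
        refine (hy _ he).add ((hc.forward _ (Fin.succ_ne_zero e) he).comp
          ((hseed _).prodMk (Measurable.sub ?_ (hy _ he))))
        exact hr.measurable_op e (ih (Fin.castSucc_lt_last e).ne) (measurable_block hw e)
    have hv' : ∀ e, e ≠ 0 → Measurable fun ζ => A.v (t + 1) ζ e := by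
      intro e
      induction e using Fin.reverseInduction with
      | last =>
        intro _
        simp only [v_succ_last]
        exact measurable_const
      | cast e ih =>
        intro he
        simp only [v_succ_castSucc]
        refine (hv _ he).add ((hc.backward _ he (Fin.castSucc_lt_last e).ne).comp
          ((hseed' _).prodMk (Measurable.sub ?_ (hv _ he))))
        exact hr.measurable_jac₁_adjoint e (hy' _ (Fin.castSucc_lt_last e).ne)
          (measurable_block hw e) (ih (Fin.succ_ne_zero e))
    have hu' : Measurable (A.u (t + 1)) :=
      (hu.const_smul (1 - A.m)).add ((hr.measurable_paramGrad hw hy' hv').const_smul A.m)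
    exact ⟨hw.sub (hu'.const_smul A.γ), hu', hy', hv'⟩

/-- Contraction in mean square for a random input: `Z` does not depend on the seed in use, so the
seed may be exchanged for a fresh one and the pointwise contraction integrated over it. -/
theorem memLp_compress {ω : ℝ} (hω : 0 ≤ ω) {ν : Measure Ξ} [IsProbabilityMeasure ν]
    {π : Measure (Draw d Ξ)} [IsProbabilityMeasure π] {r : Draw d Ξ × Ξ → Draw d Ξ}
    (hr : MeasurePreserving r (π.prod ν) π) {seed : Draw d Ξ → Ξ} (hseed : Measurable seed)
    (hrs : ∀ z ξ, seed (r (z, ξ)) = ξ) {n : ℕ}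
    {c : Ξ → EuclideanSpace ℝ (Fin n) → EuclideanSpace ℝ (Fin n)}
    (hc : Measurable fun q : Ξ × EuclideanSpace ℝ (Fin n) => c q.1 q.2)
    (hci : ∀ z, Integrable (fun ξ => ‖z - c ξ z‖ ^ 2) ν)
    (hcl : ∀ z, ∫ ξ, ‖z - c ξ z‖ ^ 2 ∂ν ≤ ω ^ 2 * ‖z‖ ^ 2) (t : ℕ)
    {Z : (ℕ → Draw d Ξ) → EuclideanSpace ℝ (Fin n)} (hZ : Measurable Z)
    (hZr : ∀ ζ ξ, Z (Function.update ζ t (r (ζ t, ξ))) = Z ζ)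
    (hZL : MemLp Z 2 (Measure.infinitePi fun _ : ℕ => π)) :
    MemLp (fun ζ => Z ζ - c (seed (ζ t)) (Z ζ)) 2 (Measure.infinitePi fun _ : ℕ => π) ∧
      lpNorm (fun ζ => Z ζ - c (seed (ζ t)) (Z ζ)) 2 (Measure.infinitePi fun _ : ℕ => π)
        ≤ ω * lpNorm Z 2 (Measure.infinitePi fun _ : ℕ => π) := by
  set P := Measure.infinitePi fun _ : ℕ => π
  have hm : Measurable fun ζ : ℕ → Draw d Ξ => Z ζ - c (seed (ζ t)) (Z ζ) :=
    hZ.sub (hc.comp ((hseed.comp (measurable_pi_apply t)).prodMk hZ))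
  have hG : Measurable fun ζ : ℕ → Draw d Ξ =>
      ENNReal.ofReal (‖Z ζ - c (seed (ζ t)) (Z ζ)‖ ^ 2) := (hm.norm.pow_const 2).ennreal_ofReal
  refine memLp_two_of_lintegral_le hω hm.aestronglyMeasurable hZL ?_
  -- Pass to the resampled sequence. There `Z` is unchanged and the seed is the new variable, so
  -- Fubini applies with the seed integrated first.
  have hmp := measurePreserving_resample (ι := ℕ) t hr
  rw [← hmp.lintegral_comp hG, ← lintegral_const_mul _ (hZ.norm.pow_const 2).ennreal_ofReal]
  simp only [hZr, Function.update_self, hrs]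
  have hm' : Measurable fun q : (ℕ → Draw d Ξ) × Ξ =>
      ENNReal.ofReal (‖Z q.1 - c q.2 (Z q.1)‖ ^ 2) :=
    (((hZ.comp measurable_fst).sub (hc.comp (measurable_snd.prodMk
      (hZ.comp measurable_fst)))).norm.pow_const 2).ennreal_ofReal
  rw [lintegral_prod _ hm'.aemeasurable]
  refine lintegral_mono fun ζ => ?_
  rw [← ofReal_integral_eq_lintegral_ofReal (hci (Z ζ))
    (Filter.Eventually.of_forall fun _ => sq_nonneg _), ← ENNReal.ofReal_mul (sq_nonneg ω)]
  exact ENNReal.ofReal_le_ofReal (hcl (Z ζ))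

end Algo

attribute [irreducible] Algo.st Algo.w Algo.u Algo.y Algo.v Algo.x

variable [MeasurableSpace Ξ]

/-! ### Second moments along the iterates -/

/-- The law of the sequence of draws when one draw has law `π`. -/
abbrev path (π : Measure (Draw d Ξ)) : Measure (ℕ → Draw d Ξ) := Measure.infinitePi fun _ => π

/-- The root mean square of a function of the draws. -/
abbrev rms {F : Type*} [NormedAddCommGroup F] (π : Measure (Draw d Ξ))
    (X : (ℕ → Draw d Ξ) → F) : ℝ := lpNorm X 2 (path π)

namespace Algo

/-- The vectors compressed in the forward pass. -/
def fwdIn (A : Algo d k Ξ) (t : ℕ) (e : Fin E) (ζ : ℕ → Draw d Ξ) : Act d e.succ :=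
  A.op e (A.y (t + 1) ζ e.castSucc) (A.w t ζ e) - A.y t ζ e.succ

/-- The compression residuals of the forward pass. -/
def fwdRes (A : Algo d k Ξ) (t : ℕ) (e : Fin E) (ζ : ℕ → Draw d Ξ) : Act d e.succ :=
  A.op e (A.y (t + 1) ζ e.castSucc) (A.w t ζ e) - A.y (t + 1) ζ e.succ

/-- The vectors compressed in the backward pass. -/
def bwdIn (A : Algo d k Ξ) (t : ℕ) (e : Fin E) (ζ : ℕ → Draw d Ξ) : Act d e.castSucc :=
  (jac₁ A.op e (A.y (t + 1) ζ e.castSucc) (A.w t ζ e)).adjoint (A.v (t + 1) ζ e.succ)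
    - A.v t ζ e.castSucc

/-- The compression residuals of the backward pass. -/
def bwdRes (A : Algo d k Ξ) (t : ℕ) (e : Fin E) (ζ : ℕ → Draw d Ξ) : Act d e.castSucc :=
  (jac₁ A.op e (A.y (t + 1) ζ e.castSucc) (A.w t ζ e)).adjoint (A.v (t + 1) ζ e.succ)
    - A.v (t + 1) ζ e.castSucc

/-- The errors of the compressed activations. -/
def yErr (A : Algo d k Ξ) (t : ℕ) (e : Fin (E + 1)) (ζ : ℕ → Draw d Ξ) : Act d e :=
  A.y (t + 1) ζ e - forward A.op (A.x t ζ) (A.w t ζ) e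

/-- The errors of the compressed activation gradients, relative to the exact back-propagation
at the compressed activations. -/
def vErr (A : Algo d k Ξ) (t : ℕ) (e : Fin (E + 1)) (ζ : ℕ → Draw d Ξ) : Act d e :=
  A.v (t + 1) ζ e - backprop A.op (A.w t ζ) (A.y (t + 1) ζ) e

/-- The increments of the compressed activations. -/
def yStep (A : Algo d k Ξ) (t : ℕ) (e : Fin (E + 1)) (ζ : ℕ → Draw d Ξ) : Act d e :=
  A.y (t + 2) ζ e - A.y (t + 1) ζ e

/-- The increments of the exact back-propagation at the compressed activations. -/
def vStep (A : Algo d k Ξ) (t : ℕ) (e : Fin (E + 1)) (ζ : ℕ → Draw d Ξ) : Act d e :=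
  backprop A.op (A.w (t + 1) ζ) (A.y (t + 2) ζ) e - backprop A.op (A.w t ζ) (A.y (t + 1) ζ) e

/-- The stochastic gradient used by the algorithm. -/
def grad (A : Algo d k Ξ) (t : ℕ) (ζ : ℕ → Draw d Ξ) : Params k :=
  paramGrad A.op (A.w t ζ) (A.y (t + 1) ζ) (A.v (t + 1) ζ)

theorem fwdRes_eq (A : Algo d k Ξ) (t : ℕ) (e : Fin E) (ζ : ℕ → Draw d Ξ) :
    A.fwdRes t e ζ = A.fwdIn t e ζ
      - A.CF e.succ ((ζ t).2.2.1 e.succ) (A.fwdIn t e ζ) := by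
  rw [fwdRes, y_succ_succ, fwdIn]
  abel

theorem bwdRes_eq (A : Algo d k Ξ) (t : ℕ) (e : Fin E) (ζ : ℕ → Draw d Ξ) :
    A.bwdRes t e ζ = A.bwdIn t e ζ
      - A.CB e.castSucc ((ζ t).2.2.2 e.castSucc) (A.bwdIn t e ζ) := by
  rw [bwdRes, v_succ_castSucc, bwdIn]
  abel

/-- The standing assumptions, with one constant `C` for all smoothness constants. -/
structure Valid (A : Algo d k Ξ) (p : ℝ) (D : Measure (Act d 0)) (ν : Measure Ξ)
    (π : Measure (Draw d Ξ)) (C B ωF ωB φ : ℝ) : Prop where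
  two_le : 2 ≤ E
  reg : Regular A.op C
  γ_pos : 0 < A.γ
  cF : Contractive ν A.CF ωF
  cB : Contractive ν A.CB ωB
  ωF_nonneg : 0 ≤ ωF
  ωF_lt : ωF < 1
  ωB_nonneg : 0 ≤ ωB
  ωB_lt : ωB < 1
  p_pos : 0 < p
  p_le : p ≤ 1
  law : π = drawLaw p D ν
  disp : SampleDispersion D φ
  φ_nonneg : 0 ≤ φ
  B_nonneg : 0 ≤ B
  init : ∀ e : Fin (E + 1), e ≠ 0 → e ≠ Fin.last E →
    ∫ x, ‖forward A.op x A.w₁ e‖ ^ 2 ∂D ≤ B ^ 2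

namespace Valid

variable {A : Algo d k Ξ} {p : ℝ} {D : Measure (Act d 0)} {ν : Measure Ξ}
  {π : Measure (Draw d Ξ)} {C B ωF ωB φ : ℝ} [IsProbabilityMeasure D] [IsProbabilityMeasure ν]
  [IsProbabilityMeasure π]

theorem measurableCompressors (h : A.Valid p D ν π C B ωF ωB φ) : A.MeasurableCompressors :=
  ⟨h.cF.measurable, h.cB.measurable⟩

theorem measurable_w (h : A.Valid p D ν π C B ωF ωB φ) (t : ℕ) : Measurable (A.w t) :=
  (measurable_components h.reg h.measurableCompressors t).1

theorem measurable_u (h : A.Valid p D ν π C B ωF ωB φ) (t : ℕ) : Measurable (A.u t) :=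
  (measurable_components h.reg h.measurableCompressors t).2.1

theorem measurable_y (h : A.Valid p D ν π C B ωF ωB φ) (t : ℕ) {e : Fin (E + 1)}
    (he : e ≠ Fin.last E) : Measurable fun ζ => A.y t ζ e :=
  (measurable_components h.reg h.measurableCompressors t).2.2.1 e he

theorem measurable_v (h : A.Valid p D ν π C B ωF ωB φ) (t : ℕ) {e : Fin (E + 1)}
    (he : e ≠ 0) : Measurable fun ζ => A.v t ζ e :=
  (measurable_components h.reg h.measurableCompressors t).2.2.2 e he

theorem measurable_fwdIn (h : A.Valid p D ν π C B ωF ωB φ) (t : ℕ) {e : Fin E}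
    (he : e.succ ≠ Fin.last E) : Measurable (A.fwdIn t e) :=
  (h.reg.measurable_op e (h.measurable_y (t + 1) (Fin.castSucc_lt_last e).ne)
    (measurable_block (h.measurable_w t) e)).sub (h.measurable_y t he)

theorem measurable_bwdIn (h : A.Valid p D ν π C B ωF ωB φ) (t : ℕ) {e : Fin E}
    (he : e.castSucc ≠ 0) : Measurable (A.bwdIn t e) :=
  (h.reg.measurable_jac₁_adjoint e (h.measurable_y (t + 1) (Fin.castSucc_lt_last e).ne)
    (measurable_block (h.measurable_w t) e) (h.measurable_v (t + 1) (Fin.succ_ne_zero e))).sub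
    (h.measurable_v t he)

theorem measurable_backprop (h : A.Valid p D ν π C B ωF ωB φ) (t : ℕ) (e : Fin (E + 1)) :
    Measurable fun ζ => backprop A.op (A.w t ζ) (A.y (t + 1) ζ) e :=
  h.reg.measurable_backprop (h.measurable_w t) (fun _ he => h.measurable_y (t + 1) he) e

theorem measurable_forward (h : A.Valid p D ν π C B ωF ωB φ) (t : ℕ) (e : Fin (E + 1)) :
    Measurable fun ζ => forward A.op (A.x t ζ) (A.w t ζ) e :=
  h.reg.measurable_forward (A.measurable_x t) (h.measurable_w t) e

theorem measurable_yErr (h : A.Valid p D ν π C B ωF ωB φ) (t : ℕ) {e : Fin (E + 1)}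
    (he : e ≠ Fin.last E) : Measurable (A.yErr t e) :=
  (h.measurable_y (t + 1) he).sub (h.measurable_forward t e)

theorem measurable_vErr (h : A.Valid p D ν π C B ωF ωB φ) (t : ℕ) {e : Fin (E + 1)}
    (he : e ≠ 0) : Measurable (A.vErr t e) :=
  (h.measurable_v (t + 1) he).sub (h.measurable_backprop t e)

theorem measurable_yStep (h : A.Valid p D ν π C B ωF ωB φ) (t : ℕ) {e : Fin (E + 1)}
    (he : e ≠ Fin.last E) : Measurable (A.yStep t e) :=
  (h.measurable_y (t + 2) he).sub (h.measurable_y (t + 1) he)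

theorem measurable_grad (h : A.Valid p D ν π C B ωF ωB φ) (t : ℕ) : Measurable (A.grad t) :=
  h.reg.measurable_paramGrad (h.measurable_w t) (fun _ he => h.measurable_y (t + 1) he)
    (fun _ he => h.measurable_v (t + 1) he)

/-- The compressed vector is built from the previous state and from forward seeds of earlier links,
hence the seed of this link is fresh. -/
theorem memLp_fwdRes (h : A.Valid p D ν π C B ωF ωB φ) (t : ℕ) {e : Fin E}
    (he : e.succ ≠ Fin.last E) (hz : MemLp (A.fwdIn t e) 2 (path π)) :
    MemLp (A.fwdRes t e) 2 (path π) ∧ rms π (A.fwdRes t e) ≤ ωF * rms π (A.fwdIn t e) := by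
  have h0 := Fin.succ_ne_zero e
  have hmp : MeasurePreserving (setF e.succ) (π.prod ν) π := by
    rw [h.law]
    exact measurePreserving_setF h.p_pos.le h.p_le e.succ
  have hseed : Measurable fun z : Draw d Ξ => z.2.2.1 e.succ :=
    (measurable_pi_apply e.succ).comp (measurable_fst.comp (measurable_snd.comp measurable_snd))
  have hinv : ∀ ζ ξ, A.fwdIn t e (Function.update ζ t (setF e.succ (ζ t, ξ)))
      = A.fwdIn t e ζ := by
    intro ζ ξ
    rw [fwdIn, fwdIn, w_update, y_update,
      y_update_setF _ _ _ _ _ _ (Fin.castSucc_lt_succ (i := e))]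
  have hrs : ∀ (z : Draw d Ξ) (ξ : Ξ), (setF e.succ (z, ξ)).2.2.1 e.succ = ξ := fun z ξ =>
    Function.update_self _ _ _
  have heq : A.fwdRes t e = fun ζ => A.fwdIn t e ζ
      - A.CF e.succ ((ζ t).2.2.1 e.succ) (A.fwdIn t e ζ) := funext (A.fwdRes_eq t e)
  have key := memLp_compress h.ωF_nonneg hmp hseed hrs (h.cF.measurable _ h0 he)
    (h.cF.integrable _ h0 he) (h.cF.contractive _ h0 he) t (h.measurable_fwdIn t he) hinv hz
  rw [rms, heq]
  exact key

/-- As in the forward pass: the compressed vector involves backward seeds of later links only. -/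
theorem memLp_bwdRes (h : A.Valid p D ν π C B ωF ωB φ) (t : ℕ) {e : Fin E}
    (he : e.castSucc ≠ 0) (hz : MemLp (A.bwdIn t e) 2 (path π)) :
    MemLp (A.bwdRes t e) 2 (path π) ∧ rms π (A.bwdRes t e) ≤ ωB * rms π (A.bwdIn t e) := by
  have h0 := (Fin.castSucc_lt_last e).ne
  have hmp : MeasurePreserving (setB e.castSucc) (π.prod ν) π := by
    rw [h.law]
    exact measurePreserving_setB h.p_pos.le h.p_le e.castSucc
  have hseed : Measurable fun z : Draw d Ξ => z.2.2.2 e.castSucc :=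
    (measurable_pi_apply e.castSucc).comp
      (measurable_snd.comp (measurable_snd.comp measurable_snd))
  have hinv : ∀ ζ ξ, A.bwdIn t e (Function.update ζ t (setB e.castSucc (ζ t, ξ)))
      = A.bwdIn t e ζ := by
    intro ζ ξ
    rw [bwdIn, bwdIn, w_update, v_update, y_update_setB,
      v_update_setB _ _ _ _ _ _ (Fin.castSucc_lt_succ (i := e))]
  have hrs : ∀ (z : Draw d Ξ) (ξ : Ξ), (setB e.castSucc (z, ξ)).2.2.2 e.castSucc = ξ := fun z ξ =>
    Function.update_self _ _ _
  have heq : A.bwdRes t e = fun ζ => A.bwdIn t e ζ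
      - A.CB e.castSucc ((ζ t).2.2.2 e.castSucc) (A.bwdIn t e ζ) := funext (A.bwdRes_eq t e)
  have key := memLp_compress h.ωB_nonneg hmp hseed hrs (h.cB.measurable _ he h0)
    (h.cB.integrable _ he h0) (h.cB.contractive _ he h0) t (h.measurable_bwdIn t he) hinv hz
  rw [rms, heq]
  exact key

/-- The increment is the compressed vector minus its residual, whence 1 + ωF ≤ 2. -/
theorem memLp_yStep_succ (h : A.Valid p D ν π C B ωF ωB φ) (t : ℕ) {e : Fin E}
    (he : e.succ ≠ Fin.last E) (hz : MemLp (A.fwdIn (t + 1) e) 2 (path π)) :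
    MemLp (A.yStep t e.succ) 2 (path π)
      ∧ rms π (A.yStep t e.succ) ≤ 2 * rms π (A.fwdIn (t + 1) e) := by
  have hr := h.memLp_fwdRes (t + 1) he hz
  have := memLp_and_lpNorm_le₂ (c₁ := 1) (c₂ := 1) zero_le_one zero_le_one
    (h.measurable_yStep t he).aestronglyMeasurable hz hr.1 (fun ζ => by
      have : A.yStep t e.succ ζ = A.fwdIn (t + 1) e ζ - A.fwdRes (t + 1) e ζ := by
        rw [yStep, fwdIn, fwdRes]
        abel
      rw [this, one_mul, one_mul]
      exact norm_sub_le _ _)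
  refine ⟨this.1, this.2.trans ?_⟩
  have h1 : ωF * rms π (A.fwdIn (t + 1) e) ≤ rms π (A.fwdIn (t + 1) e) :=
    mul_le_of_le_one_left lpNorm_nonneg h.ωF_lt.le
  linarith [hr.2]

theorem norm_w_step (h : A.Valid p D ν π C B ωF ωB φ) (t : ℕ) (ζ : ℕ → Draw d Ξ) :
    ‖A.w (t + 1) ζ - A.w t ζ‖ = A.γ * ‖A.u (t + 1) ζ‖ := by
  rw [w_succ, sub_sub_cancel_left, norm_neg, norm_smul, Real.norm_of_nonneg h.γ_pos.le]

/-- Error feedback: the next vector to compress is the previous residual plus the change of the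
operator's exact output on its compressed inputs. -/
theorem memLp_fwdIn_succ (h : A.Valid p D ν π C B ωF ωB φ) (t : ℕ) {e : Fin E}
    (he : e.succ ≠ Fin.last E) (hz : MemLp (A.fwdIn t e) 2 (path π))
    (hy : MemLp (A.yStep t e.castSucc) 2 (path π)) (hu : MemLp (A.u (t + 1)) 2 (path π)) :
    MemLp (A.fwdIn (t + 1) e) 2 (path π)
      ∧ rms π (A.fwdIn (t + 1) e) ≤ ωF * rms π (A.fwdIn t e)
        + C * (rms π (A.yStep t e.castSucc) + A.γ * rms π (A.u (t + 1))) := by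
  have hr := h.memLp_fwdRes t he hz
  have hC := h.reg.nonneg
  have hγ := h.γ_pos.le
  have := memLp_and_lpNorm_le₃ (c₁ := 1) (c₂ := C) (c₃ := C * A.γ) zero_le_one hC
    (mul_nonneg hC hγ) (h.measurable_fwdIn (t + 1) he).aestronglyMeasurable hr.1 hy hu
    (fun ζ => by
      have e1 : A.fwdIn (t + 1) e ζ = A.fwdRes t e ζ
          + (A.op e (A.y (t + 2) ζ e.castSucc) (A.w (t + 1) ζ e)
            - A.op e (A.y (t + 1) ζ e.castSucc) (A.w t ζ e)) := by
        rw [fwdIn, fwdRes]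
        abel
      have e2 := h.reg.op_sub_le e he (A.y (t + 2) ζ e.castSucc) (A.y (t + 1) ζ e.castSucc)
        (A.w (t + 1) ζ e) (A.w t ζ e)
      have e3 := (norm_block_le (A.w (t + 1) ζ - A.w t ζ) e).trans (h.norm_w_step t ζ).le
      rw [e1, one_mul, add_assoc]
      refine (norm_add_le _ _).trans (add_le_add le_rfl (e2.trans ?_))
      rw [mul_assoc, ← mul_add]
      exact mul_le_mul_of_nonneg_left (add_le_add le_rfl e3) hC)
  exact ⟨this.1, this.2.trans (le_of_eq_of_le (by ring) (add_le_add hr.2 le_rfl))⟩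

theorem memLp_yErr_succ (h : A.Valid p D ν π C B ωF ωB φ) (t : ℕ) {e : Fin E}
    (he : e.succ ≠ Fin.last E) (hz : MemLp (A.fwdIn t e) 2 (path π))
    (hy : MemLp (A.yErr t e.castSucc) 2 (path π)) :
    MemLp (A.yErr t e.succ) 2 (path π)
      ∧ rms π (A.yErr t e.succ) ≤ rms π (A.fwdIn t e) + C * rms π (A.yErr t e.castSucc) := by
  have hr := h.memLp_fwdRes t he hz
  have hC := h.reg.nonneg
  have := memLp_and_lpNorm_le₂ (c₁ := 1) (c₂ := C) zero_le_one hC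
    (h.measurable_yErr t he).aestronglyMeasurable hr.1 hy
    (fun ζ => by
      have e1 : A.yErr t e.succ ζ = (A.op e (A.y (t + 1) ζ e.castSucc) (A.w t ζ e)
            - A.op e (forward A.op (A.x t ζ) (A.w t ζ) e.castSucc) (A.w t ζ e))
          - A.fwdRes t e ζ := by
        rw [yErr, fwdRes, forward_succ]
        abel
      have e2 := h.reg.op_sub_le e he (A.y (t + 1) ζ e.castSucc)
        (forward A.op (A.x t ζ) (A.w t ζ) e.castSucc) (A.w t ζ e) (A.w t ζ e)
      rw [sub_self, norm_zero, add_zero] at e2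
      rw [e1, one_mul]
      exact ((norm_sub_le _ _).trans (add_le_add e2 le_rfl)).trans_eq (add_comm _ _))
  refine ⟨this.1, this.2.trans ?_⟩
  have h1 : ωF * rms π (A.fwdIn t e) ≤ rms π (A.fwdIn t e) :=
    mul_le_of_le_one_left lpNorm_nonneg h.ωF_lt.le
  linarith [hr.2]

theorem yErr_zero (A : Algo d k Ξ) (t : ℕ) : A.yErr t 0 = fun _ => 0 := by
  funext ζ
  rw [yErr, y_succ_zero, forward_zero, sub_self]

theorem memLp_yErr (h : A.Valid p D ν π C B ωF ωB φ) (t : ℕ)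
    (hz : ∀ e : Fin E, e.succ ≠ Fin.last E → MemLp (A.fwdIn t e) 2 (path π)) (e : Fin (E + 1))
    (he : e ≠ Fin.last E) : MemLp (A.yErr t e) 2 (path π) := by
  induction e using Fin.induction with
  | zero =>
    rw [yErr_zero]
    exact MemLp.zero'
  | succ e ih => exact (h.memLp_yErr_succ t he (hz e he) (ih (Fin.castSucc_lt_last e).ne)).1

/-- Since the compressed activations start at zero, the first vector to compress is an activation
itself, hence within the upstream error of an exact one. -/
theorem memLp_fwdIn_zero (h : A.Valid p D ν π C B ωF ωB φ) {e : Fin E}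
    (he : e.succ ≠ Fin.last E)
    (hf : MemLp (fun ζ => forward A.op (A.x 0 ζ) A.w₁ e.succ) 2 (path π))
    (hfB : rms π (fun ζ => forward A.op (A.x 0 ζ) A.w₁ e.succ) ≤ B)
    (hy : MemLp (A.yErr 0 e.castSucc) 2 (path π)) :
    MemLp (A.fwdIn 0 e) 2 (path π)
      ∧ rms π (A.fwdIn 0 e) ≤ B + C * rms π (A.yErr 0 e.castSucc) := by
  have hC := h.reg.nonneg
  have := memLp_and_lpNorm_le₂ (c₁ := 1) (c₂ := C) zero_le_one hC
    (h.measurable_fwdIn 0 he).aestronglyMeasurable hf hy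
    (fun ζ => by
      have e1 : A.fwdIn 0 e ζ = (A.op e (A.y 1 ζ e.castSucc) (A.w₁ e)
            - A.op e (forward A.op (A.x 0 ζ) A.w₁ e.castSucc) (A.w₁ e))
          + forward A.op (A.x 0 ζ) A.w₁ e.succ := by
        rw [fwdIn, forward_succ, y_zero, w_zero, zero_add]
        abel
      have e2 := h.reg.op_sub_le e he (A.y 1 ζ e.castSucc)
        (forward A.op (A.x 0 ζ) A.w₁ e.castSucc) (A.w₁ e) (A.w₁ e)
      rw [sub_self, norm_zero, add_zero] at e2
      have e3 : A.yErr 0 e.castSucc ζ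
          = A.y 1 ζ e.castSucc - forward A.op (A.x 0 ζ) A.w₁ e.castSucc := by
        rw [yErr, w_zero, zero_add]
      rw [e1, e3, one_mul]
      exact ((norm_add_le _ _).trans (add_le_add e2 le_rfl)).trans_eq (add_comm _ _))
  exact ⟨this.1, this.2.trans (by linarith)⟩

theorem vErr_last (A : Algo d k Ξ) (t : ℕ) : A.vErr t (Fin.last E) = fun _ => 0 := by
  funext ζ
  rw [vErr, v_succ_last, backprop_last, sub_self]

/-- The error is the transported downstream error minus the compression residual. The factor ωB is
kept, whereas its forward analogue replaces ωF by 1; it leads to the ωB² in the bias. -/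
theorem memLp_vErr_castSucc (h : A.Valid p D ν π C B ωF ωB φ) (t : ℕ) {e : Fin E}
    (he : e.castSucc ≠ 0) (hz : MemLp (A.bwdIn t e) 2 (path π))
    (hv : MemLp (A.vErr t e.succ) 2 (path π)) :
    MemLp (A.vErr t e.castSucc) 2 (path π) ∧ rms π (A.vErr t e.castSucc)
      ≤ ωB * rms π (A.bwdIn t e) + C * rms π (A.vErr t e.succ) := by
  have hr := h.memLp_bwdRes t he hz
  have hC := h.reg.nonneg
  have := memLp_and_lpNorm_le₂ (c₁ := 1) (c₂ := C) zero_le_one hC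
    (h.measurable_vErr t he).aestronglyMeasurable hr.1 hv
    (fun ζ => by
      have e1 : A.vErr t e.castSucc ζ
          = (jac₁ A.op e (A.y (t + 1) ζ e.castSucc) (A.w t ζ e)).adjoint (A.vErr t e.succ ζ)
            - A.bwdRes t e ζ := by
        rw [vErr, vErr, bwdRes, backprop_castSucc, map_sub]
        abel
      have e2 := (norm_adjoint_apply_le (jac₁ A.op e (A.y (t + 1) ζ e.castSucc) (A.w t ζ e))
        (A.vErr t e.succ ζ)).trans
          (mul_le_mul_of_nonneg_right (h.reg.jac₁_le _ _ _) (norm_nonneg _))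
      rw [e1, one_mul]
      exact ((norm_sub_le _ _).trans (add_le_add e2 le_rfl)).trans_eq (add_comm _ _))
  exact ⟨this.1, this.2.trans (by linarith [hr.2])⟩

theorem memLp_vErr (h : A.Valid p D ν π C B ωF ωB φ) (t : ℕ)
    (hz : ∀ e : Fin E, e.castSucc ≠ 0 → MemLp (A.bwdIn t e) 2 (path π)) (e : Fin (E + 1))
    (he : e ≠ 0) : MemLp (A.vErr t e) 2 (path π) := by
  induction e using Fin.reverseInduction with
  | last =>
    rw [vErr_last]
    exact MemLp.zero'
  | cast e ih => exact (h.memLp_vErr_castSucc t he (hz e he) (ih (Fin.succ_ne_zero e))).1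

theorem memLp_backprop (h : A.Valid p D ν π C B ωF ωB φ) (t : ℕ) (e : Fin (E + 1)) :
    MemLp (fun ζ => backprop A.op (A.w t ζ) (A.y (t + 1) ζ) e) 2 (path π) :=
  MemLp.of_bound (h.measurable_backprop t e).aestronglyMeasurable (C ^ E)
    (Filter.Eventually.of_forall fun _ => h.reg.norm_backprop_le' _ _ _)

theorem memLp_vStep (h : A.Valid p D ν π C B ωF ωB φ) (t : ℕ) (e : Fin (E + 1)) :
    MemLp (A.vStep t e) 2 (path π) := (h.memLp_backprop (t + 1) e).sub (h.memLp_backprop t e)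

/-- The transported vector is exact back-propagation plus a Jacobian applied to `vErr`. In this form
the change of the Jacobian only meets the exact vector, which is bounded; applied to the compressed
gradient `v`, known only in mean square, it could not be controlled by products of norms. -/
theorem memLp_bwdIn_succ (h : A.Valid p D ν π C B ωF ωB φ) (t : ℕ) {e : Fin E}
    (he : e.castSucc ≠ 0) (hz : MemLp (A.bwdIn t e) 2 (path π))
    (hv : MemLp (A.vErr t e.succ) 2 (path π)) (hv' : MemLp (A.vErr (t + 1) e.succ) 2 (path π)) :
    MemLp (A.bwdIn (t + 1) e) 2 (path π)
      ∧ rms π (A.bwdIn (t + 1) e) ≤ ωB * rms π (A.bwdIn t e)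
        + C * (rms π (A.vErr (t + 1) e.succ) + rms π (A.vErr t e.succ)
          + rms π (A.vStep t e.castSucc)) := by
  have hr := h.memLp_bwdRes t he hz
  have hC := h.reg.nonneg
  have := memLp_and_lpNorm_le₄ (c₁ := 1) (c₂ := C) (c₃ := C) (c₄ := 1) zero_le_one hC hC
    zero_le_one (h.measurable_bwdIn (t + 1) he).aestronglyMeasurable hr.1 hv' hv
    (h.memLp_vStep t e.castSucc)
    (fun ζ => by
      have e1 : A.bwdIn (t + 1) e ζ = A.bwdRes t e ζ
          + (jac₁ A.op e (A.y (t + 2) ζ e.castSucc) (A.w (t + 1) ζ e)).adjoint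
              (A.vErr (t + 1) e.succ ζ)
          - (jac₁ A.op e (A.y (t + 1) ζ e.castSucc) (A.w t ζ e)).adjoint (A.vErr t e.succ ζ)
          + A.vStep t e.castSucc ζ := by
        rw [bwdIn, bwdRes, vStep, vErr, vErr, backprop_castSucc, backprop_castSucc, map_sub,
          map_sub]
        abel
      have e2 := (norm_adjoint_apply_le (jac₁ A.op e (A.y (t + 1) ζ e.castSucc) (A.w t ζ e))
        (A.vErr t e.succ ζ)).trans
          (mul_le_mul_of_nonneg_right (h.reg.jac₁_le _ _ _) (norm_nonneg _))
      have e3 := (norm_adjoint_apply_le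
        (jac₁ A.op e (A.y (t + 2) ζ e.castSucc) (A.w (t + 1) ζ e))
        (A.vErr (t + 1) e.succ ζ)).trans
          (mul_le_mul_of_nonneg_right (h.reg.jac₁_le _ _ _) (norm_nonneg _))
      rw [e1, one_mul, one_mul]
      exact (norm_add_le _ _).trans (add_le_add ((norm_sub_le _ _).trans
        (add_le_add ((norm_add_le _ _).trans (add_le_add le_rfl e3)) e2)) le_rfl))
  refine ⟨this.1, this.2.trans ?_⟩
  have h1 : rms π (A.vStep t e.castSucc) ≤ C * rms π (A.vStep t e.castSucc) :=
    le_mul_of_one_le_left lpNorm_nonneg h.reg.one_le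
  linarith [hr.2]

/-- The first vector to compress is a full transported gradient: a bounded exact part plus the
transported error. -/
theorem memLp_bwdIn_zero (h : A.Valid p D ν π C B ωF ωB φ) {e : Fin E}
    (he : e.castSucc ≠ 0) (hv : MemLp (A.vErr 0 e.succ) 2 (path π)) :
    MemLp (A.bwdIn 0 e) 2 (path π)
      ∧ rms π (A.bwdIn 0 e) ≤ C * C ^ E + C * rms π (A.vErr 0 e.succ) := by
  have hC := h.reg.nonneg
  have hconst : MemLp (fun _ : ℕ → Draw d Ξ => C ^ E) 2 (path π) := memLp_const _
  have := memLp_and_lpNorm_le₂ (c₁ := C) (c₂ := C) hC hC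
    (h.measurable_bwdIn 0 he).aestronglyMeasurable hconst hv
    (fun ζ => by
      have e1 : A.bwdIn 0 e ζ
          = (jac₁ A.op e (A.y 1 ζ e.castSucc) (A.w 0 ζ e)).adjoint
              (backprop A.op (A.w 0 ζ) (A.y 1 ζ) e.succ)
            + (jac₁ A.op e (A.y 1 ζ e.castSucc) (A.w 0 ζ e)).adjoint (A.vErr 0 e.succ ζ) := by
        rw [bwdIn, vErr, v_zero, map_sub]
        simp
      have e2 := fun x => (norm_adjoint_apply_le (jac₁ A.op e (A.y 1 ζ e.castSucc) (A.w 0 ζ e))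
        x).trans (mul_le_mul_of_nonneg_right (h.reg.jac₁_le _ _ _) (norm_nonneg _))
      rw [e1]
      refine (norm_add_le _ _).trans (add_le_add ((e2 _).trans ?_) (e2 _))
      rw [Real.norm_of_nonneg (by positivity)]
      exact mul_le_mul_of_nonneg_left (h.reg.norm_backprop_le' _ _ _) hC)
  refine ⟨this.1, this.2.trans ?_⟩
  rw [lpNorm_const' two_ne_zero ENNReal.ofNat_ne_top, Real.norm_of_nonneg (by positivity)]
  simp

theorem memLp_v (h : A.Valid p D ν π C B ωF ωB φ) (t : ℕ)
    (hz : ∀ e : Fin E, e.castSucc ≠ 0 → MemLp (A.bwdIn t e) 2 (path π)) {e : Fin (E + 1)}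
    (he : e ≠ 0) : MemLp (fun ζ => A.v (t + 1) ζ e) 2 (path π) := by
  have := (h.memLp_vErr t hz e he).add (h.memLp_backprop t e)
  refine this.congr_norm (h.measurable_v (t + 1) he).aestronglyMeasurable
    (Filter.Eventually.of_forall fun ζ => ?_)
  simp [vErr]

theorem memLp_grad (h : A.Valid p D ν π C B ωF ωB φ) (t : ℕ)
    (hz : ∀ e : Fin E, e.castSucc ≠ 0 → MemLp (A.bwdIn t e) 2 (path π)) :
    MemLp (A.grad t) 2 (path π) := by
  have : MemLp (fun ζ => C * ∑ e : Fin E, ‖A.v (t + 1) ζ e.succ‖) 2 (path π) :=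
    (memLp_finsetSum _ fun e _ => (h.memLp_v t hz (Fin.succ_ne_zero e)).norm).const_mul C
  exact this.mono' (h.measurable_grad t).aestronglyMeasurable
    (Filter.Eventually.of_forall fun ζ => h.reg.norm_paramGrad_le _ _ _)

end Valid

end Algo

/-! ### Lazy sampling -/

theorem lintegral_coinLaw (p : ℝ) (g : Bool → ENNReal) :
    ∫⁻ c, g c ∂(coinLaw p) = ENNReal.ofReal p * g true + ENNReal.ofReal (1 - p) * g false := by
  rw [coinLaw, lintegral_add_measure, lintegral_smul_measure, lintegral_smul_measure,
    lintegral_dirac, lintegral_dirac, smul_eq_mul, smul_eq_mul]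

theorem integral_coinLaw {p : ℝ} (h0 : 0 ≤ p) (h1 : p ≤ 1) (g : Bool → ℝ) :
    ∫ c, g c ∂(coinLaw p) = p * g true + (1 - p) * g false := by
  have := isProbabilityMeasure_coinLaw h0 h1
  rw [coinLaw, integral_add_measure, integral_smul_measure, integral_smul_measure,
    integral_dirac, integral_dirac, ENNReal.toReal_ofReal h0,
    ENNReal.toReal_ofReal (by linarith), smul_eq_mul, smul_eq_mul]
  · exact Integrable.smul_measure (integrable_dirac (by finiteness)) ENNReal.ofReal_ne_top
  · exact Integrable.smul_measure (integrable_dirac (by finiteness)) ENNReal.ofReal_ne_top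

namespace Algo.Valid

variable {A : Algo d k Ξ} {p : ℝ} {D : Measure (Act d 0)} {ν : Measure Ξ}
  {π : Measure (Draw d Ξ)} {C B ωF ωB φ : ℝ} [IsProbabilityMeasure D] [IsProbabilityMeasure ν]
  [IsProbabilityMeasure π]

theorem measurePreserving_setX' (h : A.Valid p D ν π C B ωF ωB φ) :
    MeasurePreserving setX (π.prod ((coinLaw p).prod D)) π := by
  rw [h.law]
  exact measurePreserving_setX h.p_pos.le h.p_le

/-- Conditioning on the coin. The functional `Φ` ignores the draw `t + 1`, so with probability p its
argument is a sample independent of it, and otherwise the old sample. -/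
theorem lintegral_x_succ (h : A.Valid p D ν π C B ωF ωB φ) (t : ℕ)
    {Φ : (ℕ → Draw d Ξ) → Act d 0 → ENNReal} (hΦ : Measurable (Function.uncurry Φ))
    (hinv : ∀ ζ z, Φ (Function.update ζ (t + 1) z) = Φ ζ) :
    ∫⁻ ζ, Φ ζ (A.x (t + 1) ζ) ∂(path π)
      = ENNReal.ofReal p * ∫⁻ ζ, ∫⁻ x, Φ ζ x ∂D ∂(path π)
        + ENNReal.ofReal (1 - p) * ∫⁻ ζ, Φ ζ (A.x t ζ) ∂(path π) := by
  have := isProbabilityMeasure_coinLaw h.p_pos.le h.p_le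
  have hmp := measurePreserving_resample (ι := ℕ) (t + 1) h.measurePreserving_setX'
  have hG : Measurable fun ζ => Φ ζ (A.x (t + 1) ζ) :=
    hΦ.comp (measurable_id.prodMk (A.measurable_x (t + 1)))
  have hG' : Measurable fun ζ => Φ ζ (A.x t ζ) :=
    hΦ.comp (measurable_id.prodMk (A.measurable_x t))
  have hstep : ∀ q : (ℕ → Draw d Ξ) × (Bool × Act d 0),
      Φ (Function.update q.1 (t + 1) (setX (q.1 (t + 1), q.2)))
        (A.x (t + 1) (Function.update q.1 (t + 1) (setX (q.1 (t + 1), q.2))))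
      = if q.2.1 = true then Φ q.1 q.2.2 else Φ q.1 (A.x t q.1) := by
    intro q
    rw [hinv, x_succ, x_update, Function.update_self]
    simp only [setX]
    exact apply_ite (Φ q.1) _ _ _
  have hm : Measurable fun q : (ℕ → Draw d Ξ) × (Bool × Act d 0) =>
      if q.2.1 = true then Φ q.1 q.2.2 else Φ q.1 (A.x t q.1) := by
    refine Measurable.ite ((measurable_fst.comp measurable_snd) (measurableSet_singleton true))
      (hΦ.comp (measurable_fst.prodMk (measurable_snd.comp measurable_snd)))
      (hG'.comp measurable_fst)
  rw [← hmp.lintegral_comp hG]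
  simp only [hstep]
  rw [lintegral_prod _ hm.aemeasurable]
  have hinner : ∀ ζ, ∫⁻ c : Bool × Act d 0, (if c.1 = true then Φ ζ c.2 else Φ ζ (A.x t ζ))
      ∂((coinLaw p).prod D)
      = ENNReal.ofReal p * ∫⁻ x, Φ ζ x ∂D + ENNReal.ofReal (1 - p) * Φ ζ (A.x t ζ) := by
    intro ζ
    have hmζ : Measurable fun c : Bool × Act d 0 =>
        if c.1 = true then Φ ζ c.2 else Φ ζ (A.x t ζ) :=
      hm.comp (measurable_const.prodMk measurable_id)
    rw [lintegral_prod _ hmζ.aemeasurable, lintegral_coinLaw]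
    simp
  have hmi : Measurable fun ζ => ∫⁻ x, Φ ζ x ∂D := hΦ.lintegral_prod_right'
  simp only [hinner]
  rw [lintegral_add_right _ (hG'.const_mul _), lintegral_const_mul _ hG',
    lintegral_const_mul _ hmi]

theorem integral_x_succ (h : A.Valid p D ν π C B ωF ωB φ) (t : ℕ)
    {Φ : (ℕ → Draw d Ξ) → Act d 0 → ℝ} (hΦ : Measurable (Function.uncurry Φ)) {K : ℝ}
    (hK : ∀ ζ x, |Φ ζ x| ≤ K) (hinv : ∀ ζ z, Φ (Function.update ζ (t + 1) z) = Φ ζ) :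
    ∫ ζ, Φ ζ (A.x (t + 1) ζ) ∂(path π)
      = p * ∫ ζ, ∫ x, Φ ζ x ∂D ∂(path π) + (1 - p) * ∫ ζ, Φ ζ (A.x t ζ) ∂(path π) := by
  have := isProbabilityMeasure_coinLaw h.p_pos.le h.p_le
  have hmp := measurePreserving_resample (ι := ℕ) (t + 1) h.measurePreserving_setX'
  have hG : Measurable fun ζ => Φ ζ (A.x (t + 1) ζ) :=
    hΦ.comp (measurable_id.prodMk (A.measurable_x (t + 1)))
  have hG' : Measurable fun ζ => Φ ζ (A.x t ζ) :=
    hΦ.comp (measurable_id.prodMk (A.measurable_x t))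
  have hstep : ∀ q : (ℕ → Draw d Ξ) × (Bool × Act d 0),
      Φ (Function.update q.1 (t + 1) (setX (q.1 (t + 1), q.2)))
        (A.x (t + 1) (Function.update q.1 (t + 1) (setX (q.1 (t + 1), q.2))))
      = if q.2.1 = true then Φ q.1 q.2.2 else Φ q.1 (A.x t q.1) := by
    intro q
    rw [hinv, x_succ, x_update, Function.update_self]
    simp only [setX]
    exact apply_ite (Φ q.1) _ _ _
  have hm : Measurable fun q : (ℕ → Draw d Ξ) × (Bool × Act d 0) =>
      if q.2.1 = true then Φ q.1 q.2.2 else Φ q.1 (A.x t q.1) := by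
    refine Measurable.ite ((measurable_fst.comp measurable_snd) (measurableSet_singleton true))
      (hΦ.comp (measurable_fst.prodMk (measurable_snd.comp measurable_snd)))
      (hG'.comp measurable_fst)
  have hmK : ∀ q : (ℕ → Draw d Ξ) × (Bool × Act d 0),
      ‖if q.2.1 = true then Φ q.1 q.2.2 else Φ q.1 (A.x t q.1)‖ ≤ K := by
    intro q
    split_ifs
    · exact hK _ _
    · exact hK _ _
  have e1 : ∫ ζ, Φ ζ (A.x (t + 1) ζ) ∂(path π)
      = ∫ q : (ℕ → Draw d Ξ) × (Bool × Act d 0),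
        (if q.2.1 = true then Φ q.1 q.2.2 else Φ q.1 (A.x t q.1))
          ∂((path π).prod ((coinLaw p).prod D)) := by
    conv_lhs => rw [path, ← hmp.map_eq]
    rw [integral_map hmp.measurable.aemeasurable hG.aestronglyMeasurable]
    simp only [hstep]
  rw [e1, integral_prod _ (Integrable.of_bound hm.aestronglyMeasurable K
    (Filter.Eventually.of_forall hmK))]
  have hinner : ∀ ζ, ∫ c : Bool × Act d 0, (if c.1 = true then Φ ζ c.2 else Φ ζ (A.x t ζ))
      ∂((coinLaw p).prod D)
      = p * ∫ x, Φ ζ x ∂D + (1 - p) * Φ ζ (A.x t ζ) := by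
    intro ζ
    have hmζ : Measurable fun c : Bool × Act d 0 =>
        if c.1 = true then Φ ζ c.2 else Φ ζ (A.x t ζ) :=
      hm.comp (measurable_const.prodMk measurable_id)
    rw [integral_prod _ (Integrable.of_bound hmζ.aestronglyMeasurable K
      (Filter.Eventually.of_forall fun c => hmK (ζ, c))), integral_coinLaw h.p_pos.le h.p_le]
    simp
  simp only [hinner]
  have hi1 : Integrable (fun ζ => ∫ x, Φ ζ x ∂D) (path π) := by
    refine Integrable.of_bound
      (hΦ.stronglyMeasurable.integral_prod_right').aestronglyMeasurable K
      (Filter.Eventually.of_forall fun ζ => ?_)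
    have := norm_integral_le_of_norm_le_const (μ := D) (f := Φ ζ)
      (Filter.Eventually.of_forall fun x => hK ζ x)
    simpa using this
  have hi2 : Integrable (fun ζ => Φ ζ (A.x t ζ)) (path π) :=
    Integrable.of_bound hG'.aestronglyMeasurable K
      (Filter.Eventually.of_forall fun ζ => hK ζ _)
  rw [integral_add (hi1.const_mul _) (hi2.const_mul _), integral_const_mul, integral_const_mul]

/-- Each sample is either fresh or the previous one, so the marginal law stays `D`, although the
sample is not independent of the parameters. -/
theorem measurePreserving_x (h : A.Valid p D ν π C B ωF ωB φ) (t : ℕ) :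
    MeasurePreserving (A.x t) (path π) D := by
  have hp := h.p_pos.le
  have hp1 := h.p_le
  induction t with
  | zero =>
    have : A.x 0 = fun ζ => (ζ 0).2.1 := funext A.x_zero
    rw [this]
    have hc := isProbabilityMeasure_coinLaw hp hp1
    have e1 : MeasurePreserving (fun z : Draw d Ξ => z.2.1) π D := by
      rw [h.law]
      exact measurePreserving_fst.comp (measurePreserving_snd (μ := coinLaw p))
    exact e1.comp (measurePreserving_eval_infinitePi (fun _ : ℕ => π) 0)
  | succ t ih =>
    refine ⟨A.measurable_x (t + 1), Measure.ext fun s hs => ?_⟩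
    have hm : Measurable (s.indicator (1 : Act d 0 → ENNReal)) := measurable_one.indicator hs
    have key := h.lintegral_x_succ t (Φ := fun _ x => s.indicator 1 x)
      (hm.comp measurable_snd) (fun _ _ => rfl)
    have e : ∀ r, Measurable r → ∀ P : Measure (ℕ → Draw d Ξ),
        ∫⁻ ζ, s.indicator (1 : Act d 0 → ENNReal) (r ζ) ∂P = P.map r s := by
      intro r hr P
      rw [← lintegral_map hm hr, lintegral_indicator_one hs]
    rw [e _ (A.measurable_x (t + 1)), e _ (A.measurable_x t), ih.map_eq,
      lintegral_indicator_one hs, lintegral_const, measure_univ, mul_one, ← add_mul,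
      ← ENNReal.ofReal_add hp (by linarith)] at key
    simpa using key

/-- The sample moves with probability p only, and then between two independent points of law `D`. -/
theorem memLp_yStep_zero (h : A.Valid p D ν π C B ωF ωB φ) (t : ℕ) :
    MemLp (A.yStep t 0) 2 (path π) ∧ rms π (A.yStep t 0) ^ 2 ≤ p * φ ^ 2 := by
  have heq : A.yStep t 0 = fun ζ => A.x (t + 1) ζ - A.x t ζ := by
    funext ζ
    rw [yStep, y_succ_zero, y_succ_zero]
  have hm : Measurable (A.yStep t 0) := by
    rw [heq]
    exact (A.measurable_x (t + 1)).sub (A.measurable_x t)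
  have hΦ : Measurable (Function.uncurry fun (ζ : ℕ → Draw d Ξ) (x : Act d 0) =>
      ENNReal.ofReal (‖x - A.x t ζ‖ ^ 2)) :=
    ((measurable_snd.sub ((A.measurable_x t).comp measurable_fst)).norm.pow_const 2).ennreal_ofReal
  have key := h.lintegral_x_succ t hΦ (fun ζ z => by
    funext x
    rw [x_update])
  have hD : Measurable fun q : Act d 0 × Act d 0 => ENNReal.ofReal (‖q.1 - q.2‖ ^ 2) :=
    ((measurable_fst.sub measurable_snd).norm.pow_const 2).ennreal_ofReal
  have h1 : ∫⁻ ζ, ∫⁻ x, ENNReal.ofReal (‖x - A.x t ζ‖ ^ 2) ∂D ∂(path π)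
      = ∫⁻ q : Act d 0 × Act d 0, ENNReal.ofReal (‖q.1 - q.2‖ ^ 2) ∂(D.prod D) := by
    rw [lintegral_prod_symm _ hD.aemeasurable]
    exact (h.measurePreserving_x t).lintegral_comp
      (f := fun x' => ∫⁻ x, ENNReal.ofReal (‖x - x'‖ ^ 2) ∂D) hD.lintegral_prod_left'
  rw [h1, ← ofReal_integral_eq_lintegral_ofReal h.disp.integrable
    (Filter.Eventually.of_forall fun _ => sq_nonneg _)] at key
  simp only [sub_self, norm_zero, ne_eq, OfNat.ofNat_ne_zero, not_false_eq_true, zero_pow,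
    ENNReal.ofReal_zero, lintegral_const, zero_mul, mul_zero, add_zero] at key
  rw [← ENNReal.ofReal_mul h.p_pos.le] at key
  have hX : AEStronglyMeasurable (A.yStep t 0) (path π) := hm.aestronglyMeasurable
  have hint : Integrable (fun ζ => ‖A.yStep t 0 ζ‖ ^ 2) (path π) := by
    refine ⟨hX.norm.pow 2, ?_⟩
    rw [hasFiniteIntegral_iff_ofReal (Filter.Eventually.of_forall fun _ => sq_nonneg _), heq, key]
    exact ENNReal.ofReal_lt_top
  have hL : MemLp (A.yStep t 0) 2 (path π) := (memLp_two_iff_integrable_sq_norm hX).mpr hint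
  refine ⟨hL, ?_⟩
  rw [rms, lpNorm_two_sq hL]
  have h2 := ofReal_integral_eq_lintegral_ofReal hint
    (Filter.Eventually.of_forall fun _ => sq_nonneg _)
  rw [heq] at h2 ⊢
  rw [key, ENNReal.ofReal_eq_ofReal_iff (integral_nonneg fun _ => sq_nonneg _)
    (mul_nonneg h.p_pos.le (integral_nonneg fun _ => sq_nonneg _))] at h2
  rw [h2]
  exact mul_le_mul_of_nonneg_left h.disp.dispersion_le h.p_pos.le

theorem memLp_forward_init (h : A.Valid p D ν π C B ωF ωB φ) {e : Fin (E + 1)} (h0 : e ≠ 0)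
    (he : e ≠ Fin.last E) :
    MemLp (fun ζ => forward A.op (A.x 0 ζ) A.w₁ e) 2 (path π)
      ∧ rms π (fun ζ => forward A.op (A.x 0 ζ) A.w₁ e) ≤ B := by
  have hm : Measurable fun x : Act d 0 => forward A.op x A.w₁ e :=
    h.reg.measurable_forward measurable_id measurable_const e
  have hL : MemLp (fun x : Act d 0 => forward A.op x A.w₁ e) 2 D := by
    -- The bound on the initial activations concerns a Bochner integral, which is zero by convention
    -- without integrability. Square integrability therefore comes from the dispersion: for almost
    -- every x₀ the map x ↦ x − x₀ lies in L²(D), and the activation is Lipschitz in the data.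
    obtain ⟨x₀, hx₀⟩ := (h.disp.integrable.prod_left_ae).exists
    have h1 : MemLp (fun x : Act d 0 => x - x₀) 2 D :=
      (memLp_two_iff_integrable_sq_norm
        (measurable_id.sub measurable_const).aestronglyMeasurable).mpr hx₀
    have h2 : MemLp (fun _ : Act d 0 => forward A.op x₀ A.w₁ e) 2 D := memLp_const _
    refine (memLp_and_lpNorm_le₂ (c₁ := C ^ E) (c₂ := 1) (pow_nonneg h.reg.nonneg _) zero_le_one
      hm.aestronglyMeasurable h1 h2 fun x => ?_).1
    have h3 := h.reg.norm_forward_sub_le x x₀ A.w₁ A.w₁ e he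
    rw [sub_self, norm_zero, mul_zero, add_zero] at h3
    rw [one_mul]
    calc ‖forward A.op x A.w₁ e‖
        = ‖(forward A.op x A.w₁ e - forward A.op x₀ A.w₁ e) + forward A.op x₀ A.w₁ e‖ := by
          rw [sub_add_cancel]
      _ ≤ _ := (norm_add_le _ _).trans (add_le_add h3 le_rfl)
  have hL' := hL.comp_measurePreserving (h.measurePreserving_x 0)
  refine ⟨hL', ?_⟩
  refine le_of_sq_le_sq ?_ h.B_nonneg
  have e1 := lpNorm_two_sq hL'
  have e2 : ∫ ζ, ‖((fun x : Act d 0 => forward A.op x A.w₁ e) ∘ A.x 0) ζ‖ ^ 2 ∂(path π)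
      = ∫ x, ‖forward A.op x A.w₁ e‖ ^ 2 ∂D := by
    conv_rhs => rw [← (h.measurePreserving_x 0).map_eq]
    rw [integral_map (A.measurable_x 0).aemeasurable (hm.norm.pow_const 2).aestronglyMeasurable]
    rfl
  rw [e2] at e1
  exact e1.le.trans (h.init e h0 he)

theorem memLp_u_succ (h : A.Valid p D ν π C B ωF ωB φ) (t : ℕ) (h1 : MemLp (A.u t) 2 (path π))
    (h2 : ∀ e : Fin E, e.castSucc ≠ 0 → MemLp (A.bwdIn t e) 2 (path π)) :
    MemLp (A.u (t + 1)) 2 (path π) := by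
  refine (memLp_and_lpNorm_le₂ (c₁ := |1 - A.m|) (c₂ := |A.m|) (abs_nonneg _) (abs_nonneg _)
    (h.measurable_u (t + 1)).aestronglyMeasurable h1 (h.memLp_grad t h2) fun ζ => ?_).1
  rw [u_succ]
  refine (norm_add_le _ _).trans (le_of_eq ?_)
  rw [norm_smul, norm_smul, Real.norm_eq_abs, Real.norm_eq_abs]
  rfl

/-- All quantities of one iteration are square integrable. -/
theorem memLp_all (h : A.Valid p D ν π C B ωF ωB φ) (t : ℕ) :
    (∀ e : Fin E, e.succ ≠ Fin.last E → MemLp (A.fwdIn t e) 2 (path π))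
      ∧ (∀ e : Fin E, e.castSucc ≠ 0 → MemLp (A.bwdIn t e) 2 (path π))
      ∧ MemLp (A.u (t + 1)) 2 (path π) := by
  have hu := h.memLp_u_succ
  induction t with
  | zero =>
    have hfy : ∀ e : Fin (E + 1), e ≠ Fin.last E → MemLp (A.yErr 0 e) 2 (path π)
        ∧ ∀ i : Fin E, i.succ = e → MemLp (A.fwdIn 0 i) 2 (path π) := by
      intro e
      induction e using Fin.induction with
      | zero =>
        intro _
        rw [yErr_zero]
        exact ⟨MemLp.zero', fun i hi => absurd hi (Fin.succ_ne_zero i)⟩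
      | succ e ih =>
        intro he
        have hy := (ih (Fin.castSucc_lt_last e).ne).1
        have hf := h.memLp_forward_init (Fin.succ_ne_zero e) he
        have hz := (h.memLp_fwdIn_zero he hf.1 hf.2 hy).1
        refine ⟨(h.memLp_yErr_succ 0 he hz hy).1, fun i hi => ?_⟩
        rw [Fin.succ_injective _ hi]
        exact hz
    have hbv : ∀ e : Fin (E + 1), e ≠ 0 → MemLp (A.vErr 0 e) 2 (path π)
        ∧ ∀ i : Fin E, i.castSucc = e → MemLp (A.bwdIn 0 i) 2 (path π) := by
      intro e
      induction e using Fin.reverseInduction with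
      | last =>
        intro _
        rw [vErr_last]
        exact ⟨MemLp.zero', fun i hi => absurd hi (Fin.castSucc_lt_last i).ne⟩
      | cast e ih =>
        intro he
        have hv := (ih (Fin.succ_ne_zero e)).1
        have hz := (h.memLp_bwdIn_zero he hv).1
        refine ⟨(h.memLp_vErr_castSucc 0 he hz hv).1, fun i hi => ?_⟩
        rw [Fin.castSucc_injective _ hi]
        exact hz
    have hb : ∀ e : Fin E, e.castSucc ≠ 0 → MemLp (A.bwdIn 0 e) 2 (path π) := fun e he =>
      (hbv _ he).2 e rfl
    refine ⟨fun e he => (hfy _ he).2 e rfl, hb, hu 0 ?_ hb⟩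
    have : A.u 0 = fun _ => 0 := funext A.u_zero
    rw [this]
    exact MemLp.zero'
  | succ t ih =>
    obtain ⟨ihf, ihb, ihu⟩ := ih
    -- Integrability propagates in causal order: along the links of the forward pass, then back
    -- along the links of the backward pass, each time coupling a vector to compress with the
    -- increment or error it produces.
    have hfy : ∀ e : Fin (E + 1), e ≠ Fin.last E → MemLp (A.yStep t e) 2 (path π)
        ∧ ∀ i : Fin E, i.succ = e → MemLp (A.fwdIn (t + 1) i) 2 (path π) := by
      intro e
      induction e using Fin.induction with
      | zero =>
        intro _
        exact ⟨(h.memLp_yStep_zero t).1, fun i hi => absurd hi (Fin.succ_ne_zero i)⟩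
      | succ e ih =>
        intro he
        have hy := (ih (Fin.castSucc_lt_last e).ne).1
        have hz := (h.memLp_fwdIn_succ t he (ihf e he) hy ihu).1
        refine ⟨(h.memLp_yStep_succ t he hz).1, fun i hi => ?_⟩
        rw [Fin.succ_injective _ hi]
        exact hz
    have hbv : ∀ e : Fin (E + 1), e ≠ 0 → MemLp (A.vErr (t + 1) e) 2 (path π)
        ∧ ∀ i : Fin E, i.castSucc = e → MemLp (A.bwdIn (t + 1) i) 2 (path π) := by
      intro e
      induction e using Fin.reverseInduction with
      | last =>
        intro _
        rw [vErr_last]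
        exact ⟨MemLp.zero', fun i hi => absurd hi (Fin.castSucc_lt_last i).ne⟩
      | cast e ih =>
        intro he
        have hv := (ih (Fin.succ_ne_zero e)).1
        have hz := (h.memLp_bwdIn_succ t he (ihb e he)
          (h.memLp_vErr t ihb _ (Fin.succ_ne_zero e)) hv).1
        refine ⟨(h.memLp_vErr_castSucc (t + 1) he hz hv).1, fun i hi => ?_⟩
        rw [Fin.castSucc_injective _ hi]
        exact hz
    have hb : ∀ e : Fin E, e.castSucc ≠ 0 → MemLp (A.bwdIn (t + 1) e) 2 (path π) := fun e he =>
      (hbv _ he).2 e rfl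
    exact ⟨fun e he => (hfy _ he).2 e rfl, hb, hu (t + 1) ihu hb⟩

theorem memLp_fwdIn (h : A.Valid p D ν π C B ωF ωB φ) (t : ℕ) {e : Fin E}
    (he : e.succ ≠ Fin.last E) : MemLp (A.fwdIn t e) 2 (path π) := (h.memLp_all t).1 e he

theorem memLp_bwdIn (h : A.Valid p D ν π C B ωF ωB φ) (t : ℕ) {e : Fin E}
    (he : e.castSucc ≠ 0) : MemLp (A.bwdIn t e) 2 (path π) := (h.memLp_all t).2.1 e he

theorem memLp_u (h : A.Valid p D ν π C B ωF ωB φ) (t : ℕ) : MemLp (A.u (t + 1)) 2 (path π) :=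
  (h.memLp_all t).2.2

theorem memLp_yErr' (h : A.Valid p D ν π C B ωF ωB φ) (t : ℕ) {e : Fin (E + 1)}
    (he : e ≠ Fin.last E) : MemLp (A.yErr t e) 2 (path π) :=
  h.memLp_yErr t (fun _ he => h.memLp_fwdIn t he) e he

theorem memLp_vErr' (h : A.Valid p D ν π C B ωF ωB φ) (t : ℕ) {e : Fin (E + 1)}
    (he : e ≠ 0) : MemLp (A.vErr t e) 2 (path π) :=
  h.memLp_vErr t (fun _ he => h.memLp_bwdIn t he) e he

theorem memLp_yStep (h : A.Valid p D ν π C B ωF ωB φ) (t : ℕ) {e : Fin (E + 1)}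
    (he : e ≠ Fin.last E) : MemLp (A.yStep t e) 2 (path π) := by
  induction e using Fin.cases with
  | zero => exact (h.memLp_yStep_zero t).1
  | succ e => exact (h.memLp_yStep_succ t he (h.memLp_fwdIn (t + 1) he)).1

end Algo.Valid

/-! ### The bias of the stochastic gradients -/

theorem lpNorm_sum_norm_le {Ω ι : Type*} [MeasurableSpace Ω] {P : Measure Ω} (s : Finset ι)
    {F : ι → Type*} [∀ i, NormedAddCommGroup (F i)] {Y : ∀ i, Ω → F i}
    (hY : ∀ i ∈ s, MemLp (Y i) 2 P) :
    MemLp (fun ω => ∑ i ∈ s, ‖Y i ω‖) 2 P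
      ∧ lpNorm (fun ω => ∑ i ∈ s, ‖Y i ω‖) 2 P ≤ ∑ i ∈ s, lpNorm (Y i) 2 P := by
  refine ⟨memLp_finsetSum _ fun i hi => (hY i hi).norm, ?_⟩
  have h1 := lpNorm_sum_le (p := 2) (f := fun i ω => ‖Y i ω‖) (fun i hi => (hY i hi).norm)
    one_le_two
  have h2 : (∑ i ∈ s, fun ω => ‖Y i ω‖) = fun ω => ∑ i ∈ s, ‖Y i ω‖ := by
    funext ω
    simp
  rw [h2] at h1
  refine h1.trans (le_of_eq (Finset.sum_congr rfl fun i hi => ?_))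
  exact lpNorm_norm (hY i hi).aestronglyMeasurable 2

/-- Each of the two bounds in the minimum passes to the root mean square separately; the constant
one uses that the measure has mass 1. -/
theorem lpNorm_le_mul_min {Ω F : Type*} [MeasurableSpace Ω] {P : Measure Ω}
    [IsProbabilityMeasure P] [NormedAddCommGroup F] {X : Ω → F} {Y : Ω → ℝ} {K : ℝ} (hK : 0 ≤ K)
    (hY : MemLp Y 2 P) (h : ∀ ω, ‖X ω‖ ≤ K * min 1 (Y ω)) :
    lpNorm X 2 P ≤ K * min 1 (lpNorm Y 2 P) := by
  refine le_mul_min hK ?_ ?_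
  · have hc : MemLp (fun _ : Ω => K) 2 P := memLp_const _
    refine (lpNorm_mono_real hc fun ω => (h ω).trans
      (mul_le_of_le_one_right hK (min_le_left _ _))).trans (le_of_eq ?_)
    rw [lpNorm_const' two_ne_zero ENNReal.ofNat_ne_top, Real.norm_of_nonneg hK]
    simp
  · have hc : MemLp (fun ω => K * Y ω) 2 P := hY.const_mul K
    refine (lpNorm_mono_real hc fun ω => (h ω).trans
      (mul_le_mul_of_nonneg_left (min_le_right _ _) hK)).trans (le_of_eq ?_)
    have := lpNorm_const_smul (p := 2) K Y P
    rw [coe_nnnorm, Real.norm_of_nonneg hK] at this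
    exact this

theorem min_one_mul_le {K x : ℝ} (hK : 1 ≤ K) : min 1 (K * x) ≤ K * min 1 x := by
  refine le_mul_min (by linarith) ((min_le_left _ _).trans hK) (min_le_right _ _)

namespace Algo.Valid

variable {A : Algo d k Ξ} {p : ℝ} {D : Measure (Act d 0)} {ν : Measure Ξ}
  {π : Measure (Draw d Ξ)} {C B ωF ωB φ : ℝ} [IsProbabilityMeasure D] [IsProbabilityMeasure ν]
  [IsProbabilityMeasure π]

/-- The size of the vectors compressed in the forward pass, by worker. -/
def fwdRms (A : Algo d k Ξ) (π : Measure (Draw d Ξ)) (j t : ℕ) : ℝ :=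
  if hj : j < E then rms π (A.fwdIn t ⟨j, hj⟩) else 0

/-- The size of the vectors compressed in the backward pass, by worker in reversed order. -/
def bwdRms (A : Algo d k Ξ) (π : Measure (Draw d Ξ)) (j t : ℕ) : ℝ :=
  if hj : j < E then rms π (A.bwdIn t ⟨E - 1 - j, by omega⟩) else 0

/-- The size of the errors of the activation gradients, by index in reversed order. -/
def vErrRms (A : Algo d k Ξ) (π : Measure (Draw d Ξ)) (j t : ℕ) : ℝ :=
  rms π (A.vErr t ⟨E - j, by omega⟩)

/-- The total size of the vectors compressed in the forward pass. -/
def fwdTotal (A : Algo d k Ξ) (π : Measure (Draw d Ξ)) (t : ℕ) : ℝ :=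
  ∑ j ∈ Finset.range (E - 1), fwdRms A π j t

theorem fwdRms_nonneg (A : Algo d k Ξ) (π : Measure (Draw d Ξ)) (j t : ℕ) :
    0 ≤ fwdRms A π j t := by
  unfold fwdRms
  split_ifs
  · exact lpNorm_nonneg
  · exact le_rfl

theorem bwdRms_nonneg (A : Algo d k Ξ) (π : Measure (Draw d Ξ)) (j t : ℕ) :
    0 ≤ bwdRms A π j t := by
  unfold bwdRms
  split_ifs
  · exact lpNorm_nonneg
  · exact le_rfl

theorem fwdTotal_nonneg (A : Algo d k Ξ) (π : Measure (Draw d Ξ)) (t : ℕ) :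
    0 ≤ fwdTotal A π t := Finset.sum_nonneg fun _ _ => fwdRms_nonneg _ _ _ _

theorem succ_ne_last_of_lt {j : ℕ} (hj : j < E - 1) (hj' : j < E) :
    (⟨j, hj'⟩ : Fin E).succ ≠ Fin.last E := by
  intro hh
  have := congrArg Fin.val hh
  simp at this
  omega

theorem rms_le_fwdTotal (A : Algo d k Ξ) (π : Measure (Draw d Ξ)) (t : ℕ) {e : Fin E}
    (he : e.succ ≠ Fin.last E) : rms π (A.fwdIn t e) ≤ fwdTotal A π t := by
  have hlt : e.val < E - 1 := by
    have h1 := e.isLt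
    have h2 : (e.succ : Fin (E + 1)).val ≠ E := fun hh => he (Fin.ext hh)
    simp only [Fin.val_succ] at h2
    omega
  have := Finset.single_le_sum (f := fun j => fwdRms A π j t)
    (fun j _ => fwdRms_nonneg A π j t) (Finset.mem_range.mpr hlt)
  refine le_trans (le_of_eq ?_) this
  simp [fwdRms]

/-- The exogenous drive of the compression errors: sample changes and parameter changes. -/
def drive (A : Algo d k Ξ) (π : Measure (Draw d Ξ)) (t : ℕ) : ℝ :=
  rms π (A.yStep t 0) + A.γ * rms π (A.u (t + 1))

theorem drive_nonneg (h : A.Valid p D ν π C B ωF ωB φ) (t : ℕ) : 0 ≤ drive A π t :=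
  add_nonneg lpNorm_nonneg (mul_nonneg h.γ_pos.le lpNorm_nonneg)

theorem rms_yErr_zero_le (h : A.Valid p D ν π C B ωF ωB φ) (e : Fin (E + 1))
    (he : e ≠ Fin.last E) : rms π (A.yErr 0 e) ≤ B * (1 + 2 * C) ^ e.val := by
  have hC := h.reg.nonneg
  have hB := h.B_nonneg
  induction e using Fin.induction with
  | zero =>
    rw [yErr_zero, rms, lpNorm_fun_zero]
    simpa using hB
  | succ e ih =>
    have hy := h.memLp_yErr' 0 (Fin.castSucc_lt_last e).ne
    have hf := h.memLp_forward_init (Fin.succ_ne_zero e) he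
    have h1 := (h.memLp_fwdIn_zero he hf.1 hf.2 hy).2
    have h2 := (h.memLp_yErr_succ 0 he (h.memLp_fwdIn 0 he) hy).2
    have h3 := ih (Fin.castSucc_lt_last e).ne
    rw [Fin.val_castSucc] at h3
    rw [Fin.val_succ, pow_succ]
    have h4 : 1 ≤ (1 + 2 * C) ^ e.val := one_le_pow₀ (by linarith)
    have h5 := mul_le_mul_of_nonneg_left h3 hC
    have h6 : B ≤ B * (1 + 2 * C) ^ e.val := le_mul_of_one_le_right hB h4
    linarith

theorem rms_fwdIn_zero_le (h : A.Valid p D ν π C B ωF ωB φ) {e : Fin E}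
    (he : e.succ ≠ Fin.last E) : rms π (A.fwdIn 0 e) ≤ B * (1 + 2 * C) ^ (E + 1) := by
  have hC := h.reg.nonneg
  have hB := h.B_nonneg
  have hf := h.memLp_forward_init (Fin.succ_ne_zero e) he
  have h1 := (h.memLp_fwdIn_zero he hf.1 hf.2 (h.memLp_yErr' 0 (Fin.castSucc_lt_last e).ne)).2
  have h3 := h.rms_yErr_zero_le e.castSucc (Fin.castSucc_lt_last e).ne
  rw [Fin.val_castSucc] at h3
  have h4 : (1 + 2 * C) ^ e.val ≤ (1 + 2 * C) ^ E :=
    pow_le_pow_right₀ (by linarith) e.isLt.le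
  have h5 : 1 ≤ (1 + 2 * C) ^ E := one_le_pow₀ (by linarith)
  have h6 : rms π (A.yErr 0 e.castSucc) ≤ B * (1 + 2 * C) ^ E :=
    h3.trans (mul_le_mul_of_nonneg_left h4 hB)
  have h7 := mul_le_mul_of_nonneg_left h6 hC
  have h8 : B ≤ B * (1 + 2 * C) ^ E := le_mul_of_one_le_right hB h5
  have h9 : 0 ≤ C * (B * (1 + 2 * C) ^ E) := by positivity
  rw [pow_succ]
  linarith

theorem rms_fwdIn_succ_le (h : A.Valid p D ν π C B ωF ωB φ) (t : ℕ) {e : Fin E}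
    (he : e.succ ≠ Fin.last E) : rms π (A.fwdIn (t + 1) e) ≤ ωF * rms π (A.fwdIn t e)
        + C * (rms π (A.yStep t e.castSucc) + A.γ * rms π (A.u (t + 1))) :=
  (h.memLp_fwdIn_succ t he (h.memLp_fwdIn t he) (h.memLp_yStep t (Fin.castSucc_lt_last e).ne)
    (h.memLp_u t)).2

/-- The forward pass is an instance of the filter chain with n = E − 1 links: the sample change
drives the first link, doubled compressed vectors of the preceding link drive the others, and
parameter steps drive all of them. -/
theorem exists_fwdTotal_sum_le (hE : 2 ≤ E) {C B : ℝ} (hC : 1 ≤ C) (hB : 0 ≤ B) :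
    ∃ K : ℝ, 1 ≤ K ∧ ∀ (d : Fin (E + 1) → ℕ) (k : Fin E → ℕ) (Ξ : Type*) [MeasurableSpace Ξ]
      (A : Algo d k Ξ) (p : ℝ) (D : Measure (Act d 0)) (ν : Measure Ξ) (π : Measure (Draw d Ξ))
      (ωF ωB φ : ℝ) [IsProbabilityMeasure D] [IsProbabilityMeasure ν] [IsProbabilityMeasure π],
      A.Valid p D ν π C B ωF ωB φ → ∀ T : ℕ,
      ∑ t ∈ Finset.range (T + 1), min 1 (fwdTotal A π t) ^ 2
        ≤ K * (1 / (1 - ωF) ^ 2 + 1 / (1 - ωF) ^ (2 * (E - 1))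
          * ∑ t ∈ Finset.range T, drive A π t ^ 2) := by
  have hI : 0 ≤ B * (1 + 2 * C) ^ (E + 1) := by positivity
  -- One constant dominates both the Lipschitz constant C and the initial sizes B(1 + 2C)^(E+1).
  obtain ⟨K, hK, hmain⟩ := forward_sum_le (C := C + B * (1 + 2 * C) ^ (E + 1)) (by linarith)
    (n := E - 1) (by omega)
  refine ⟨K, hK, ?_⟩
  intro d k Ξ _ A p D ν π ωF ωB φ _ _ _ h T
  have hC0 : 0 ≤ C := by linarith
  refine hmain ωF (fwdRms A π) (drive A π) h.ωF_nonneg h.ωF_lt (fwdRms_nonneg A π)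
    h.drive_nonneg ?_ ?_ ?_ T
  · intro j hj
    have hj' : j < E := by omega
    rw [fwdRms, dif_pos hj']
    exact (h.rms_fwdIn_zero_le (succ_ne_last_of_lt hj hj')).trans (by linarith)
  · intro t
    have hj' : 0 < E := by omega
    simp only [fwdRms, dif_pos hj']
    have h1 := h.rms_fwdIn_succ_le t (succ_ne_last_of_lt (E := E) (j := 0) (by omega) hj')
    refine h1.trans ?_
    have h2 := mul_nonneg hI (h.drive_nonneg t)
    have h3 : rms π (A.yStep t (⟨0, hj'⟩ : Fin E).castSucc) + A.γ * rms π (A.u (t + 1))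
        = drive A π t := rfl
    rw [h3]
    linarith
  · intro j hj t
    have hj1 : j + 1 < E := by omega
    have hj0 : j < E := by omega
    simp only [fwdRms, dif_pos hj1, dif_pos hj0]
    have h1 := h.rms_fwdIn_succ_le t (succ_ne_last_of_lt hj hj1)
    have he0 := succ_ne_last_of_lt (E := E) (j := j) (by omega) hj0
    have h2 : rms π (A.yStep t (⟨j + 1, hj1⟩ : Fin E).castSucc)
        ≤ 2 * rms π (A.fwdIn (t + 1) ⟨j, hj0⟩) :=
      (h.memLp_yStep_succ t he0 (h.memLp_fwdIn (t + 1) he0)).2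
    have h3 : A.γ * rms π (A.u (t + 1)) ≤ drive A π t := le_add_of_nonneg_left lpNorm_nonneg
    have h4 := mul_le_mul_of_nonneg_left (add_le_add h2 h3) hC0
    have h5 : 0 ≤ 2 * rms π (A.fwdIn (t + 1) ⟨j, hj0⟩) + drive A π t :=
      add_nonneg (mul_nonneg zero_le_two lpNorm_nonneg) (h.drive_nonneg t)
    have h6 := mul_nonneg hI h5
    linarith

/-- Compression residuals accumulate downstream, amplified by C at each worker. -/
theorem rms_yErr_le (h : A.Valid p D ν π C B ωF ωB φ) (t : ℕ) (e : Fin (E + 1))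
    (he : e ≠ Fin.last E) : rms π (A.yErr t e) ≤ (1 + C) ^ E * fwdTotal A π t := by
  have hC := h.reg.nonneg
  have hZ := fwdTotal_nonneg A π t
  have key : rms π (A.yErr t e) ≤ (1 + C) ^ e.val * fwdTotal A π t := by
    induction e using Fin.induction with
    | zero =>
      rw [yErr_zero, rms, lpNorm_fun_zero]
      positivity
    | succ e ih =>
      have h1 := (h.memLp_yErr_succ t he (h.memLp_fwdIn t he)
        (h.memLp_yErr' t (Fin.castSucc_lt_last e).ne)).2
      have h2 := ih (Fin.castSucc_lt_last e).ne
      have h3 := rms_le_fwdTotal A π t he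
      rw [Fin.val_castSucc] at h2
      rw [Fin.val_succ, pow_succ]
      have h4 : 1 ≤ (1 + C) ^ e.val := one_le_pow₀ (by linarith)
      have h5 := mul_le_mul_of_nonneg_left h2 hC
      have h6 : fwdTotal A π t ≤ (1 + C) ^ e.val * fwdTotal A π t := le_mul_of_one_le_left hZ h4
      linarith
  exact key.trans (mul_le_mul_of_nonneg_right
    (pow_le_pow_right₀ (by linarith) e.is_le) hZ)

theorem rms_yStep_le (h : A.Valid p D ν π C B ωF ωB φ) (t : ℕ) {e : Fin (E + 1)} (h0 : e ≠ 0)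
    (he : e ≠ Fin.last E) : rms π (A.yStep t e) ≤ 2 * fwdTotal A π (t + 1) := by
  obtain ⟨i, rfl⟩ := Fin.exists_succ_eq.mpr h0
  exact (h.memLp_yStep_succ t he (h.memLp_fwdIn (t + 1) he)).2.trans
    (mul_le_mul_of_nonneg_left (rms_le_fwdTotal A π (t + 1) he) zero_le_two)

/-- Exact back-propagation moves with the activations and the parameters, and never by more than a
constant. The saturated right side is the exogenous input of the backward filters. -/
theorem rms_vStep_le (h : A.Valid p D ν π C B ωF ωB φ) (t : ℕ) {e : Fin (E + 1)} (he : e ≠ 0) :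
    rms π (A.vStep t e) ≤ gradConst E C
      * min 1 (2 * E * fwdTotal A π (t + 1) + A.γ * rms π (A.u (t + 1))) := by
  have hE : 1 ≤ E := by have := h.two_le; omega
  have hK := zero_le_one.trans (one_le_gradConst hE h.reg.one_le)
  have hs := lpNorm_sum_norm_le (P := path π) (Finset.univ.filter fun e : Fin E => e.castSucc ≠ 0)
    (Y := fun e : Fin E => A.yStep t e.castSucc)
    (fun e _ => h.memLp_yStep t (Fin.castSucc_lt_last e).ne)
  have hu : MemLp (fun ζ => A.γ * ‖A.u (t + 1) ζ‖) 2 (path π) := (h.memLp_u t).norm.const_mul _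
  have hsum := memLp_and_lpNorm_le₂ (X := fun ζ => (∑ e : Fin E with e.castSucc ≠ 0,
    ‖A.yStep t e.castSucc ζ‖) + A.γ * ‖A.u (t + 1) ζ‖) (c₁ := 1) zero_le_one h.γ_pos.le
    (hs.1.add hu).aestronglyMeasurable hs.1 (h.memLp_u t) (fun ζ => by
      have : 0 ≤ ∑ e : Fin E with e.castSucc ≠ 0, ‖A.yStep t e.castSucc ζ‖ :=
        Finset.sum_nonneg fun _ _ => norm_nonneg _
      rw [Real.norm_of_nonneg this, Real.norm_of_nonneg
        (add_nonneg this (mul_nonneg h.γ_pos.le (norm_nonneg _))), one_mul])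
  refine (lpNorm_le_mul_min hK hsum.1 (fun ζ => ?_)).trans ?_
  · rw [← h.norm_w_step t ζ]
    exact h.reg.norm_backprop_sub_le hE _ _ _ _ e he
  · refine mul_le_mul_of_nonneg_left (min_le_min_left _ (hsum.2.trans ?_)) hK
    rw [one_mul]
    refine add_le_add (hs.2.trans ?_) le_rfl
    calc _ ≤ ∑ e : Fin E with e.castSucc ≠ 0, 2 * fwdTotal A π (t + 1) := by
          refine Finset.sum_le_sum fun e he => ?_
          exact h.rms_yStep_le t (Finset.mem_filter.mp he).2 (Fin.castSucc_lt_last e).ne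
      _ ≤ ∑ _e : Fin E, 2 * fwdTotal A π (t + 1) :=
          Finset.sum_le_sum_of_subset_of_nonneg (Finset.filter_subset _ _)
            fun _ _ _ => mul_nonneg zero_le_two (fwdTotal_nonneg _ _ _)
      _ = _ := by
          rw [Finset.sum_const, Finset.card_univ, Fintype.card_fin, nsmul_eq_mul]
          ring

end Algo.Valid

theorem sq_min_one_add_le {K a b : ℝ} (hK : 1 ≤ K) (ha : 0 ≤ a) (hb : 0 ≤ b) :
    min 1 (K * a + b) ^ 2 ≤ 2 * K ^ 2 * min 1 a ^ 2 + 2 * b ^ 2 := by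
  have h1 : min 1 (K * a + b) ≤ K * min 1 a + b := by
    rcases le_total 1 a with h | h
    · rw [min_eq_left h]
      exact (min_le_left _ _).trans (by linarith)
    · rw [min_eq_right h]
      exact min_le_right _ _
  have h2 : 0 ≤ min 1 (K * a + b) := le_min zero_le_one (by positivity)
  nlinarith [sq_nonneg (K * min 1 a - b)]

namespace Algo

/-- The error of the stochastic gradient relative to the gradient of the loss at the current
sample. -/
def bias (A : Algo d k Ξ) (t : ℕ) (ζ : ℕ → Draw d Ξ) : Params k :=
  A.grad t ζ - lossGrad A.op (A.x t ζ) (A.w t ζ)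

namespace Valid

variable {A : Algo d k Ξ} {p : ℝ} {D : Measure (Act d 0)} {ν : Measure Ξ}
  {π : Measure (Draw d Ξ)} {C B ωF ωB φ : ℝ} [IsProbabilityMeasure D] [IsProbabilityMeasure ν]
  [IsProbabilityMeasure π]

/-- `backward_sum_le` with links counted from the output end; the increments of exact
back-propagation serve as input. -/
theorem exists_vErr_sum_le {C : ℝ} (hC : 1 ≤ C) :
    ∃ K : ℝ, 0 ≤ K ∧ ∀ (d : Fin (E + 1) → ℕ) (k : Fin E → ℕ) (Ξ : Type*) [MeasurableSpace Ξ]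
      (A : Algo d k Ξ) (p : ℝ) (D : Measure (Act d 0)) (ν : Measure Ξ) (π : Measure (Draw d Ξ))
      (B ωF ωB φ : ℝ) [IsProbabilityMeasure D] [IsProbabilityMeasure ν] [IsProbabilityMeasure π],
      A.Valid p D ν π C B ωF ωB φ → ∀ (e : Fin E) (T : ℕ),
      ∑ t ∈ Finset.range (T + 1), rms π (A.vErr t e.succ) ^ 2
        ≤ K * (ωB ^ 2 / (1 - ωB) ^ (2 * (E - 1)) * (1 + ∑ t ∈ Finset.range T, (gradConst E C
          * min 1 (2 * E * fwdTotal A π (t + 1) + A.γ * rms π (A.u (t + 1)))) ^ 2)) := by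
  have hC0 : 0 ≤ C := by linarith
  have hCE : 1 ≤ C ^ E := one_le_pow₀ hC
  have hC' : C ≤ C * C ^ E := le_mul_of_one_le_right hC0 hCE
  -- The constant C·C^E covers the initial vectors as well, where C^E bounds exact back-propagation.
  have hall := backward_sum_le (C := C * C ^ E) (hC.trans hC')
  choose K hK hmain using hall
  have hK0 : ∀ j, 0 ≤ K j := fun j => by linarith [hK j]
  refine ⟨∑ j ∈ Finset.range E, K j, Finset.sum_nonneg fun j _ => hK0 j, ?_⟩
  intro d k Ξ _ A p D ν π B ωF ωB φ _ _ _ h e T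
  have he := e.isLt
  have hp : 0 < 1 - ωB := by linarith [h.ωB_lt]
  have hp1 : 1 - ωB ≤ 1 := by linarith [h.ωB_nonneg]
  set H : ℕ → ℝ := fun t => gradConst E C
    * min 1 (2 * E * fwdTotal A π (t + 1) + A.γ * rms π (A.u (t + 1))) with hH
  have hidx : ∀ (t : ℕ) (e e' : Fin (E + 1)), e = e' →
      rms π (A.vErr t e) = rms π (A.vErr t e') := by
    intro t e e' hee
    rw [hee]
  -- The activation index of `e.succ` is E − j for j = E − 1 − e, so at most E − 1 links lie between
  -- it and the output.
  have hsum := (hmain (E - 1 - e.val) (E - 1) ωB (bwdRms A π) (vErrRms A π) H (by omega)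
    h.ωB_nonneg h.ωB_lt (bwdRms_nonneg A π) (fun _ _ => lpNorm_nonneg) ?_ ?_ ?_ ?_).2 T
  · have heq : ∀ t, rms π (A.vErr t e.succ) = vErrRms A π (E - 1 - e.val) t := by
      intro t
      refine hidx t _ _ (Fin.ext ?_)
      simp only [Fin.val_succ]
      omega
    simp only [heq]
    refine hsum.trans ?_
    have hS : 0 ≤ ∑ t ∈ Finset.range T, H t ^ 2 := Finset.sum_nonneg fun _ _ => sq_nonneg _
    have h1 : K (E - 1 - e.val) ≤ ∑ j ∈ Finset.range E, K j :=
      Finset.single_le_sum (fun j _ => hK0 j) (Finset.mem_range.mpr (by omega))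
    have h2 : ωB ^ 2 / (1 - ωB) ^ (2 * (E - 1 - e.val)) ≤ ωB ^ 2 / (1 - ωB) ^ (2 * (E - 1)) :=
      div_le_div_of_nonneg_left (sq_nonneg _) (by positivity)
        (pow_le_pow_of_le_one hp.le hp1 (by omega))
    refine mul_le_mul h1 (mul_le_mul_of_nonneg_right h2 (by linarith)) (by positivity)
      (Finset.sum_nonneg fun j _ => hK0 j)
  · intro t
    have : vErrRms A π 0 t = rms π (A.vErr t (Fin.last E)) := rfl
    rw [this, vErr_last, rms, lpNorm_fun_zero]
  · intro j hj t
    have hj' : j < E := by omega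
    rw [bwdRms, dif_pos hj']
    have h0 : (⟨E - 1 - j, by omega⟩ : Fin E).castSucc ≠ 0 := by
      intro hh
      have := congrArg Fin.val hh
      simp at this
      omega
    have h1 := (h.memLp_vErr_castSucc t h0 (h.memLp_bwdIn t h0)
      (h.memLp_vErr' t (Fin.succ_ne_zero _))).2
    have e1 : vErrRms A π (j + 1) t
        = rms π (A.vErr t (⟨E - 1 - j, by omega⟩ : Fin E).castSucc) :=
      hidx t _ _ (Fin.ext (by simp only [Fin.val_castSucc]; omega))
    have e2 : vErrRms A π j t = rms π (A.vErr t (⟨E - 1 - j, by omega⟩ : Fin E).succ) :=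
      hidx t _ _ (Fin.ext (by simp only [Fin.val_succ]; omega))
    rw [e1, e2]
    exact h1.trans (add_le_add le_rfl (mul_le_mul_of_nonneg_right hC' lpNorm_nonneg))
  · intro j hj
    have hj' : j < E := by omega
    rw [bwdRms, dif_pos hj']
    have h0 : (⟨E - 1 - j, by omega⟩ : Fin E).castSucc ≠ 0 := by
      intro hh
      have := congrArg Fin.val hh
      simp at this
      omega
    have h1 := (h.memLp_bwdIn_zero h0 (h.memLp_vErr' 0 (Fin.succ_ne_zero _))).2
    have e2 : vErrRms A π j 0 = rms π (A.vErr 0 (⟨E - 1 - j, by omega⟩ : Fin E).succ) :=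
      hidx 0 _ _ (Fin.ext (by simp only [Fin.val_succ]; omega))
    rw [e2, mul_add, mul_one]
    exact h1.trans (add_le_add le_rfl (mul_le_mul_of_nonneg_right hC' lpNorm_nonneg))
  · intro j hj t
    have hj' : j < E := by omega
    simp only [bwdRms, dif_pos hj']
    have h0 : (⟨E - 1 - j, by omega⟩ : Fin E).castSucc ≠ 0 := by
      intro hh
      have := congrArg Fin.val hh
      simp at this
      omega
    have h1 := (h.memLp_bwdIn_succ t h0 (h.memLp_bwdIn t h0)
      (h.memLp_vErr' t (Fin.succ_ne_zero _)) (h.memLp_vErr' (t + 1) (Fin.succ_ne_zero _))).2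
    have e2 : ∀ t, vErrRms A π j t = rms π (A.vErr t (⟨E - 1 - j, by omega⟩ : Fin E).succ) :=
      fun t => hidx t _ _ (Fin.ext (by simp only [Fin.val_succ]; omega))
    rw [e2, e2]
    refine h1.trans (add_le_add le_rfl ?_)
    have h2 := h.rms_vStep_le t h0
    refine mul_le_mul hC' (add_le_add le_rfl h2) ?_ (by linarith)
    exact add_nonneg (add_nonneg lpNorm_nonneg lpNorm_nonneg) lpNorm_nonneg

theorem measurable_bias (h : A.Valid p D ν π C B ωF ωB φ) (t : ℕ) : Measurable (A.bias t) :=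
  (h.measurable_grad t).sub (h.reg.measurable_lossGrad (A.measurable_x t) (h.measurable_w t))

theorem memLp_bias (h : A.Valid p D ν π C B ωF ωB φ) (t : ℕ) : MemLp (A.bias t) 2 (path π) := by
  have h1 : MemLp (fun ζ => lossGrad A.op (A.x t ζ) (A.w t ζ)) 2 (path π) :=
    MemLp.of_bound (h.reg.measurable_lossGrad (A.measurable_x t)
      (h.measurable_w t)).aestronglyMeasurable (gradConst E C)
      (Filter.Eventually.of_forall fun _ => h.reg.norm_lossGrad_le _ _)
  exact (h.memLp_grad t fun _ he => h.memLp_bwdIn t he).sub h1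

/-- The exact gradient assembled at the compressed activations is inserted: one difference is linear
in the backward errors, the other is saturated in the forward errors. -/
theorem rms_bias_le (h : A.Valid p D ν π C B ωF ωB φ) (t : ℕ) :
    rms π (A.bias t) ≤ C * ∑ e : Fin E, rms π (A.vErr t e.succ)
      + gradConst E C * (E * (1 + C) ^ E * min 1 (fwdTotal A π t)) := by
  have hE : 1 ≤ E := by have := h.two_le; omega
  have hE1 : (1 : ℝ) ≤ E := by exact_mod_cast hE
  have hC := h.reg.nonneg
  have hK := zero_le_one.trans (one_le_gradConst hE h.reg.one_le)
  have hv := lpNorm_sum_norm_le (P := path π) (Finset.univ : Finset (Fin E))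
    (Y := fun e : Fin E => A.vErr t e.succ) (fun e _ => h.memLp_vErr' t (Fin.succ_ne_zero e))
  have hy := lpNorm_sum_norm_le (P := path π) (Finset.univ.filter fun e : Fin E => e.castSucc ≠ 0)
    (Y := fun e : Fin E => A.yErr t e.castSucc)
    (fun e _ => h.memLp_yErr' t (Fin.castSucc_lt_last e).ne)
  set F : (ℕ → Draw d Ξ) → Params k := fun ζ =>
    paramGrad A.op (A.w t ζ) (A.y (t + 1) ζ) (backprop A.op (A.w t ζ) (A.y (t + 1) ζ))
      - lossGrad A.op (A.x t ζ) (A.w t ζ) with hF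
  have hFm : Measurable F := (h.reg.measurable_paramGrad (h.measurable_w t)
    (fun _ he => h.measurable_y (t + 1) he) (fun e _ => h.measurable_backprop t e)).sub
    (h.reg.measurable_lossGrad (A.measurable_x t) (h.measurable_w t))
  have hFL : MemLp F 2 (path π) := by
    refine MemLp.of_bound hFm.aestronglyMeasurable (gradConst E C + gradConst E C)
      (Filter.Eventually.of_forall fun ζ => ?_)
    exact (norm_sub_le _ _).trans (add_le_add (h.reg.norm_backGrad_le _ _)
      (h.reg.norm_lossGrad_le _ _))
  have hFle : rms π F ≤ gradConst E C * (E * (1 + C) ^ E * min 1 (fwdTotal A π t)) := by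
    refine (lpNorm_le_mul_min hK hy.1 fun ζ => ?_).trans ?_
    · have := h.reg.norm_backGrad_sub_le hE (A.w t ζ) (A.w t ζ) (A.y (t + 1) ζ)
        (forward A.op (A.x t ζ) (A.w t ζ)) (by rw [y_succ_zero, forward_zero])
      rw [sub_self, norm_zero, add_zero] at this
      exact this
    · refine mul_le_mul_of_nonneg_left ?_ hK
      have h1 : ∑ e : Fin E with e.castSucc ≠ 0, rms π (A.yErr t e.castSucc)
          ≤ E * (1 + C) ^ E * fwdTotal A π t := by
        calc _ ≤ ∑ _e : Fin E with _e.castSucc ≠ 0, (1 + C) ^ E * fwdTotal A π t :=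
              Finset.sum_le_sum fun e _ => h.rms_yErr_le t _ (Fin.castSucc_lt_last e).ne
          _ ≤ ∑ _e : Fin E, (1 + C) ^ E * fwdTotal A π t :=
              Finset.sum_le_sum_of_subset_of_nonneg (Finset.filter_subset _ _)
                fun _ _ _ => mul_nonneg (by positivity) (fwdTotal_nonneg _ _ _)
          _ = _ := by
              rw [Finset.sum_const, Finset.card_univ, Fintype.card_fin, nsmul_eq_mul]
              ring
      refine (min_le_min_left _ (hy.2.trans h1)).trans (min_one_mul_le ?_)
      exact one_le_mul_of_one_le_of_one_le hE1 (one_le_pow₀ (by linarith))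
  have := memLp_and_lpNorm_le₂ (c₁ := C) (c₂ := 1) hC zero_le_one
    (h.measurable_bias t).aestronglyMeasurable hv.1 hFL (fun ζ => by
      have e1 : A.bias t ζ = (A.grad t ζ - paramGrad A.op (A.w t ζ) (A.y (t + 1) ζ)
          (backprop A.op (A.w t ζ) (A.y (t + 1) ζ))) + F ζ := by
        rw [bias, hF]
        exact (sub_add_sub_cancel _ _ _).symm
      rw [e1, one_mul, Real.norm_of_nonneg (Finset.sum_nonneg fun _ _ => norm_nonneg _)]
      exact (norm_add_le _ _).trans (add_le_add (h.reg.norm_paramGrad_sub_le _ _ _ _) le_rfl))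
  refine this.2.trans ?_
  rw [one_mul]
  exact add_le_add (mul_le_mul_of_nonneg_left hv.2 hC) hFle

/-- For ωF ≥ 1/2 the numerator ωF² + ωB is at least 1/4; for ωF ≤ 1/2 the left side is at most 4.
This puts the transient of the forward pass under δ. -/
theorem one_div_sq_le {n : ℕ} {ωF ωB : ℝ} (hF0 : 0 ≤ ωF) (hF1 : ωF < 1) (hB0 : 0 ≤ ωB)
    (hB1 : ωB < 1) : 1 / (1 - ωF) ^ 2 ≤ 4 * (1 / ((1 - ωF) ^ n * (1 - ωB) ^ n)
      + (ωF ^ 2 + ωB) / ((1 - ωF) ^ 2 * (1 - ωB) ^ (2 * n))) := by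
  have hf : 0 < 1 - ωF := by linarith
  have hb : 0 < 1 - ωB := by linarith
  have hbn : (1 - ωB) ^ (2 * n) ≤ 1 := pow_le_one₀ hb.le (by linarith)
  have h1 : 1 ≤ 1 / ((1 - ωF) ^ n * (1 - ωB) ^ n) := by
    rw [le_div_iff₀ (by positivity), one_mul]
    exact mul_le_one₀ (pow_le_one₀ hf.le (by linarith)) (by positivity)
      (pow_le_one₀ hb.le (by linarith))
  have h2 : 0 ≤ (ωF ^ 2 + ωB) / ((1 - ωF) ^ 2 * (1 - ωB) ^ (2 * n)) := by positivity
  rcases le_total (1 / 2) ωF with h | h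
  · have h3 : 1 / (1 - ωF) ^ 2
        ≤ 4 * ((ωF ^ 2 + ωB) / ((1 - ωF) ^ 2 * (1 - ωB) ^ (2 * n))) := by
      rw [mul_div_assoc', div_le_div_iff₀ (by positivity) (by positivity), one_mul]
      have h4 : 1 ≤ 4 * (ωF ^ 2 + ωB) := by nlinarith
      have h5 : (1 - ωF) ^ 2 * (1 - ωB) ^ (2 * n) ≤ (1 - ωF) ^ 2 :=
        mul_le_of_le_one_right (by positivity) hbn
      exact h5.trans (le_mul_of_one_le_left (by positivity) h4)
    linarith
  · have h3 : 1 / (1 - ωF) ^ 2 ≤ 4 := by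
      rw [div_le_iff₀ (by positivity)]
      nlinarith
    linarith

/-- The sum of the squared gradient errors. -/
theorem exists_bias_sum_le (hE : 2 ≤ E) {C B : ℝ} (hC : 1 ≤ C) (hB : 0 ≤ B) :
    ∃ K : ℝ, 0 ≤ K ∧ ∀ (d : Fin (E + 1) → ℕ) (k : Fin E → ℕ) (Ξ : Type*) [MeasurableSpace Ξ]
      (A : Algo d k Ξ) (p : ℝ) (D : Measure (Act d 0)) (ν : Measure Ξ) (π : Measure (Draw d Ξ))
      (ωF ωB φ : ℝ) [IsProbabilityMeasure D] [IsProbabilityMeasure ν] [IsProbabilityMeasure π],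
      A.Valid p D ν π C B ωF ωB φ → ∀ T : ℕ,
      ∑ t ∈ Finset.range (T + 1), rms π (A.bias t) ^ 2
        ≤ K * ((1 / ((1 - ωF) ^ (E - 1) * (1 - ωB) ^ (E - 1))
          + (ωF ^ 2 + ωB) / ((1 - ωF) ^ 2 * (1 - ωB) ^ (2 * (E - 1))))
          + 1 / ((1 - ωF) ^ (2 * (E - 1)) * (1 - ωB) ^ (2 * (E - 1)))
            * ∑ t ∈ Finset.range T, drive A π t ^ 2) := by
  obtain ⟨K₁, hK₁, h₁⟩ := exists_fwdTotal_sum_le (E := E) hE hC hB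
  obtain ⟨K₂, hK₂, h₂⟩ := exists_vErr_sum_le (E := E) hC
  have hC0 : 0 ≤ C := by linarith
  have hE1 : (1 : ℝ) ≤ E := by exact_mod_cast (by omega : 1 ≤ E)
  set g := gradConst E C with hg
  have hg1 : 1 ≤ g := one_le_gradConst (by omega) hC
  set c₁ : ℝ := 2 * C ^ 2 * E * (E * K₂) with hc₁
  set c₂ : ℝ := 2 * (g * (E * (1 + C) ^ E)) ^ 2 with hc₂
  set c₃ : ℝ := g ^ 2 * (2 * (2 * E) ^ 2 * K₁ + 2) with hc₃
  have hc₁0 : 0 ≤ c₁ := by positivity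
  have hc₂0 : 0 ≤ c₂ := by positivity
  have hc₃0 : 0 ≤ c₃ := by positivity
  refine ⟨c₂ * K₁ * 4 + c₁ * (1 + c₃), by positivity, ?_⟩
  intro d k Ξ _ A p D ν π ωF ωB φ _ _ _ h T
  have hF0 := h.ωF_nonneg
  have hB0 := h.ωB_nonneg
  have hf : 0 < 1 - ωF := by linarith [h.ωF_lt]
  have hb : 0 < 1 - ωB := by linarith [h.ωB_lt]
  have hf1 : 1 - ωF ≤ 1 := by linarith
  have hb1 : 1 - ωB ≤ 1 := by linarith
  set S := ∑ t ∈ Finset.range T, drive A π t ^ 2 with hS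
  have hS0 : 0 ≤ S := Finset.sum_nonneg fun _ _ => sq_nonneg _
  set M := ∑ t ∈ Finset.range (T + 1), min 1 (fwdTotal A π t) ^ 2 with hM
  set f2 := 1 / (1 - ωF) ^ 2 with hf2
  set fn := 1 / (1 - ωF) ^ (2 * (E - 1)) with hfn
  have hf2' : 1 ≤ f2 := by
    rw [hf2, le_div_iff₀ (by positivity), one_mul]
    exact pow_le_one₀ hf.le hf1
  have hfn' : 1 ≤ fn := by
    rw [hfn, le_div_iff₀ (by positivity), one_mul]
    exact pow_le_one₀ hf.le hf1
  have hM1 : M ≤ K₁ * (f2 + fn * S) := h₁ d k Ξ A p D ν π ωF ωB φ h T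
  -- The energy fed into the backward filters is again the saturated energy of the forward pass plus
  -- the drive, so the backward pass meets (1 − ωF)^(−2) and not a higher power at the start.
  have hH : ∑ t ∈ Finset.range T, (g * min 1 (2 * E * fwdTotal A π (t + 1)
      + A.γ * rms π (A.u (t + 1)))) ^ 2 ≤ c₃ * (f2 + fn * S) := by
    calc _ ≤ ∑ t ∈ Finset.range T, g ^ 2 * (2 * (2 * E) ^ 2 * min 1 (fwdTotal A π (t + 1)) ^ 2
          + 2 * drive A π t ^ 2) := by
          refine Finset.sum_le_sum fun t _ => ?_
          rw [mul_pow]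
          refine mul_le_mul_of_nonneg_left ?_ (sq_nonneg g)
          have hγu : 0 ≤ A.γ * rms π (A.u (t + 1)) := mul_nonneg h.γ_pos.le lpNorm_nonneg
          refine (sq_min_one_add_le (by linarith) (fwdTotal_nonneg A π (t + 1)) hγu).trans ?_
          have : A.γ * rms π (A.u (t + 1)) ≤ drive A π t := le_add_of_nonneg_left lpNorm_nonneg
          gcongr
      _ = g ^ 2 * (2 * (2 * E) ^ 2 * ∑ t ∈ Finset.range T, min 1 (fwdTotal A π (t + 1)) ^ 2
          + 2 * S) := by
          rw [← Finset.mul_sum, Finset.sum_add_distrib, ← Finset.mul_sum, ← Finset.mul_sum]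
      _ ≤ g ^ 2 * (2 * (2 * E) ^ 2 * (K₁ * (f2 + fn * S)) + 2 * (f2 + fn * S)) := by
          have e1 := sum_range_shift_le (A := fun t => min 1 (fwdTotal A π t) ^ 2)
            (fun _ => sq_nonneg _) T
          have e2 : S ≤ f2 + fn * S := by
            have := le_mul_of_one_le_left hS0 hfn'
            linarith
          gcongr
          exact e1.trans hM1
      _ = _ := by rw [hc₃]; ring
  set bn := 1 / (1 - ωB) ^ (2 * (E - 1)) with hbn
  have hbn' : 1 ≤ bn := by
    rw [hbn, le_div_iff₀ (by positivity), one_mul]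
    exact pow_le_one₀ hb.le hb1
  have hV : ∀ e : Fin E, ∑ t ∈ Finset.range (T + 1), rms π (A.vErr t e.succ) ^ 2
      ≤ K₂ * (ωB ^ 2 * bn * ((1 + c₃) * (f2 + fn * S))) := by
    intro e
    refine (h₂ d k Ξ A p D ν π B ωF ωB φ h e T).trans ?_
    rw [hbn, mul_one_div]
    refine mul_le_mul_of_nonneg_left (mul_le_mul_of_nonneg_left ?_ (by positivity)) hK₂
    have : 0 ≤ fn * S := by positivity
    nlinarith
  have hsum : ∑ t ∈ Finset.range (T + 1), rms π (A.bias t) ^ 2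
      ≤ c₁ * (ωB ^ 2 * bn * ((1 + c₃) * (f2 + fn * S))) + c₂ * (K₁ * (f2 + fn * S)) := by
    calc _ ≤ ∑ t ∈ Finset.range (T + 1), (2 * C ^ 2 * E * ∑ e : Fin E,
          rms π (A.vErr t e.succ) ^ 2 + c₂ * min 1 (fwdTotal A π t) ^ 2) := by
          refine Finset.sum_le_sum fun t _ => ?_
          have e1 := h.rms_bias_le t
          have e2 := sq_sum_le_card_mul_sum_sq (s := (Finset.univ : Finset (Fin E)))
            (f := fun e => rms π (A.vErr t e.succ))
          rw [Finset.card_univ, Fintype.card_fin] at e2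
          refine (pow_le_pow_left₀ lpNorm_nonneg e1 2).trans ?_
          refine (add_sq_le).trans ?_
          rw [mul_add, mul_pow]
          have e3 : 2 * (C ^ 2 * (∑ e : Fin E, rms π (A.vErr t e.succ)) ^ 2)
              ≤ 2 * (C ^ 2 * (E * ∑ e : Fin E, rms π (A.vErr t e.succ) ^ 2)) := by gcongr
          refine add_le_add (e3.trans (le_of_eq (by ring))) (le_of_eq ?_)
          rw [hc₂]
          ring
      _ = 2 * C ^ 2 * E * ∑ e : Fin E, ∑ t ∈ Finset.range (T + 1),
          rms π (A.vErr t e.succ) ^ 2 + c₂ * M := by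
          rw [Finset.sum_add_distrib, ← Finset.mul_sum, ← Finset.mul_sum, Finset.sum_comm]
      _ ≤ 2 * C ^ 2 * E * ∑ _e : Fin E, K₂ * (ωB ^ 2 * bn * ((1 + c₃) * (f2 + fn * S)))
          + c₂ * (K₁ * (f2 + fn * S)) := by
          refine add_le_add (mul_le_mul_of_nonneg_left (Finset.sum_le_sum fun e _ => hV e)
            (by positivity)) (mul_le_mul_of_nonneg_left hM1 hc₂0)
      _ = _ := by
          rw [Finset.sum_const, Finset.card_univ, Fintype.card_fin, nsmul_eq_mul, hc₁]
          ring
  refine hsum.trans ?_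
  set dl := 1 / ((1 - ωF) ^ (E - 1) * (1 - ωB) ^ (E - 1))
    + (ωF ^ 2 + ωB) / ((1 - ωF) ^ 2 * (1 - ωB) ^ (2 * (E - 1))) with hdl
  have hq : 1 / ((1 - ωF) ^ (2 * (E - 1)) * (1 - ωB) ^ (2 * (E - 1))) = fn * bn := by
    rw [hfn, hbn, one_div_mul_one_div]
  rw [hq]
  have t1 : f2 ≤ 4 * dl := one_div_sq_le hF0 h.ωF_lt hB0 h.ωB_lt
  -- The surviving factor ωB² places the product of both transients below the second summand of δ.
  have t2 : ωB ^ 2 * bn * f2 ≤ dl := by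
    have e1 : ωB ^ 2 * bn * f2 = ωB ^ 2 / ((1 - ωF) ^ 2 * (1 - ωB) ^ (2 * (E - 1))) := by
      rw [hbn, hf2]
      field_simp
    have e2 : ωB ^ 2 ≤ ωF ^ 2 + ωB := by nlinarith [sq_nonneg ωF, h.ωB_lt]
    rw [e1, hdl]
    exact (div_le_div_of_nonneg_right e2 (by positivity)).trans
      (le_add_of_nonneg_left (by positivity))
  have hR0 : 0 ≤ fn * bn * S := by positivity
  have hdl0 : 0 ≤ dl := by positivity
  have t3 : f2 + fn * S ≤ 4 * (dl + fn * bn * S) := by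
    have : fn * S ≤ fn * bn * S := by
      rw [mul_right_comm]
      exact le_mul_of_one_le_right (by positivity) hbn'
    linarith
  have t4 : ωB ^ 2 * bn * (f2 + fn * S) ≤ dl + fn * bn * S := by
    rw [mul_add]
    refine add_le_add t2 ?_
    have : ωB ^ 2 ≤ 1 := pow_le_one₀ hB0 h.ωB_lt.le
    calc ωB ^ 2 * bn * (fn * S) = ωB ^ 2 * (fn * bn * S) := by ring
      _ ≤ 1 * (fn * bn * S) := mul_le_mul_of_nonneg_right this hR0
      _ = _ := one_mul _
  calc c₁ * (ωB ^ 2 * bn * ((1 + c₃) * (f2 + fn * S))) + c₂ * (K₁ * (f2 + fn * S))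
      = c₁ * (1 + c₃) * (ωB ^ 2 * bn * (f2 + fn * S)) + c₂ * K₁ * (f2 + fn * S) := by ring
    _ ≤ c₁ * (1 + c₃) * (dl + fn * bn * S) + c₂ * K₁ * (4 * (dl + fn * bn * S)) := by
        gcongr
    _ = _ := by ring

end Valid

end Algo

/-! ### The sampling noise -/

/-- The deviation of the gradient at one sample from the gradient of the objective. -/
def noise (D : Measure (Act d 0)) (a : Operators d k) (x : Act d 0) (w : Params k) : Params k :=
  lossGrad a x w - gradient (risk D a) w

/-- A Lipschitz constant of the noise in the parameters. -/
def noiseConst (E : ℕ) (C : ℝ) : ℝ := gradConst E C * (E * (C ^ E * E) + 1) + C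

theorem noiseConst_nonneg (hE : 1 ≤ E) {C : ℝ} (hC : 1 ≤ C) : 0 ≤ noiseConst E C := by
  have h1 := one_le_gradConst hE hC
  have h2 : 0 ≤ C := by linarith
  have h3 : 0 ≤ gradConst E C := by linarith
  unfold noiseConst
  positivity

/-- The assumptions on the objective. -/
structure Objective (D : Measure (Act d 0)) (a : Operators d k) (C σ : ℝ) : Prop where
  reg : Regular a C
  unbiased : UnbiasedGradient D a σ
  differentiable : Differentiable ℝ (risk D a)
  lipschitz : ∀ w w' : Params k,
    ‖gradient (risk D a) w - gradient (risk D a) w'‖ ≤ C * ‖w - w'‖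

namespace Objective

variable {D : Measure (Act d 0)} [IsProbabilityMeasure D] {a : Operators d k} {C σ : ℝ}

theorem integrable_lossGrad (h : Objective D a C σ) (w : Params k) :
    Integrable (fun x => lossGrad a x w) D := by
  have := h.unbiased.integrable w
  simpa only [h.reg.gradient_loss] using this

theorem integral_lossGrad (h : Objective D a C σ) (w : Params k) :
    ∫ x, lossGrad a x w ∂D = gradient (risk D a) w := by
  have := h.unbiased.unbiased w
  simpa only [h.reg.gradient_loss] using this

theorem norm_gradient_le (h : Objective D a C σ) (w : Params k) :
    ‖gradient (risk D a) w‖ ≤ gradConst E C := by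
  rw [← h.integral_lossGrad w]
  have := norm_integral_le_of_norm_le_const (μ := D) (f := fun x => lossGrad a x w)
    (Filter.Eventually.of_forall fun x => h.reg.norm_lossGrad_le x w)
  simpa using this

theorem continuous_gradient (h : Objective D a C σ) : Continuous (gradient (risk D a)) :=
  (LipschitzWith.of_dist_le_mul (K := ⟨C, h.reg.nonneg⟩) fun w w' => by
    rw [dist_eq_norm, dist_eq_norm]
    exact h.lipschitz w w').continuous

theorem norm_noise_le (h : Objective D a C σ) (x : Act d 0) (w : Params k) :
    ‖noise D a x w‖ ≤ 2 * gradConst E C := by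
  have h1 := norm_sub_le (lossGrad a x w) (gradient (risk D a) w)
  have h2 := h.reg.norm_lossGrad_le x w
  have h3 := h.norm_gradient_le w
  rw [noise]
  linarith

theorem norm_noise_sub_le (h : Objective D a C σ) (hE : 1 ≤ E) (x : Act d 0) (w w' : Params k) :
    ‖noise D a x w - noise D a x w'‖ ≤ noiseConst E C * ‖w - w'‖ := by
  have h1 := h.reg.norm_lossGrad_sub_le hE x w w'
  have h2 := h.lipschitz w w'
  rw [noise, noise, sub_sub_sub_comm, noiseConst, add_mul]
  exact (norm_sub_le _ _).trans (add_le_add h1 h2)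

theorem continuous_noise (h : Objective D a C σ) (hE : 1 ≤ E) (x : Act d 0) :
    Continuous (noise D a x) :=
  (LipschitzWith.of_dist_le_mul (K := ⟨_, noiseConst_nonneg hE h.reg.one_le⟩) fun w w' => by
    rw [dist_eq_norm, dist_eq_norm]
    exact h.norm_noise_sub_le hE x w w').continuous

theorem measurable_noise (h : Objective D a C σ) {Ω : Type*} [MeasurableSpace Ω]
    {X : Ω → Act d 0} {W : Ω → Params k} (hX : Measurable X) (hW : Measurable W) :
    Measurable fun ω => noise D a (X ω) (W ω) :=
  (h.reg.measurable_lossGrad hX hW).sub (h.continuous_gradient.measurable.comp hW)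

theorem integrable_noise (h : Objective D a C σ) (w : Params k) :
    Integrable (fun x => noise D a x w) D :=
  (h.integrable_lossGrad w).sub (integrable_const _)

theorem integral_noise (h : Objective D a C σ) (w : Params k) : ∫ x, noise D a x w ∂D = 0 := by
  unfold noise
  rw [integral_sub (h.integrable_lossGrad w) (integrable_const _), h.integral_lossGrad w]
  simp

theorem integrable_norm_noise_sq (h : Objective D a C σ) (w : Params k) :
    Integrable (fun x => ‖noise D a x w‖ ^ 2) D := by
  have := h.unbiased.variance_integrable w
  simpa only [noise, h.reg.gradient_loss] using this

theorem integral_norm_noise_sq_le (h : Objective D a C σ) (w : Params k) :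
    ∫ x, ‖noise D a x w‖ ^ 2 ∂D ≤ σ ^ 2 := by
  have := h.unbiased.variance_le w
  simpa only [noise, h.reg.gradient_loss] using this

/-- Bias-variance decomposition for a fresh sample. -/
theorem integral_norm_add_noise_sq_le (h : Objective D a C σ) (w V : Params k) (r : ℝ) :
    ∫ x, ‖V + r • noise D a x w‖ ^ 2 ∂D ≤ ‖V‖ ^ 2 + r ^ 2 * σ ^ 2 := by
  have e : ∀ x, ‖V + r • noise D a x w‖ ^ 2
      = ‖V‖ ^ 2 + 2 * r * inner ℝ V (noise D a x w) + r ^ 2 * ‖noise D a x w‖ ^ 2 := by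
    intro x
    rw [norm_add_sq_real, real_inner_smul_right, norm_smul, mul_pow, Real.norm_eq_abs, sq_abs]
    ring
  have hi : Integrable (fun x => 2 * r * inner ℝ V (noise D a x w)) D :=
    ((h.integrable_noise w).const_inner V).const_mul _
  have h0 : ∫ x, inner ℝ V (noise D a x w) ∂D = 0 := by
    rw [integral_inner (h.integrable_noise w) V, h.integral_noise, inner_zero_right]
  simp only [e]
  have hi2 := (h.integrable_norm_noise_sq w).const_mul (r ^ 2)
  have hi1 : Integrable (fun x => ‖V‖ ^ 2 + 2 * r * inner ℝ V (noise D a x w)) D :=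
    (integrable_const _).add hi
  rw [integral_add hi1 hi2, integral_add (integrable_const _) hi, integral_const_mul,
    integral_const_mul, h0]
  have := mul_le_mul_of_nonneg_left (h.integral_norm_noise_sq_le w) (sq_nonneg r)
  simpa using this

/-- Zero variance kills the noise almost surely at each parameter. A countable dense set of
parameters gives one common null set, and continuity in w does the rest; this matters because the
noise is later evaluated at random parameters. -/
theorem ae_noise_eq_zero (h : Objective D a C 0) (hE : 1 ≤ E) :
    ∀ᵐ x ∂D, ∀ w, noise D a x w = 0 := by
  have h1 : ∀ w, ∀ᵐ x ∂D, noise D a x w = 0 := by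
    intro w
    have h2 := h.integral_norm_noise_sq_le w
    rw [zero_pow two_ne_zero] at h2
    have h3 : ∫ x, ‖noise D a x w‖ ^ 2 ∂D = 0 :=
      le_antisymm h2 (integral_nonneg fun _ => sq_nonneg _)
    rw [integral_eq_zero_iff_of_nonneg (fun _ => sq_nonneg _) (h.integrable_norm_noise_sq w)] at h3
    filter_upwards [h3] with x hx
    simpa using hx
  have h2 := ae_all_iff.mpr fun n => h1 (TopologicalSpace.denseSeq (Params k) n)
  filter_upwards [h2] with x hx
  have := (TopologicalSpace.denseRange_denseSeq (Params k)).equalizer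
    (h.continuous_noise hE x) continuous_const (funext hx)
  exact fun w => congrFun this w

end Objective

namespace Algo

/-- The noise at iteration `t`. -/
def noise (A : Algo d k Ξ) (D : Measure (Act d 0)) (t : ℕ) (ζ : ℕ → Draw d Ξ) : Params k :=
  Clapping.noise D A.op (A.x t ζ) (A.w t ζ)

/-- The momentum average of the noise. -/
def avgNoise (A : Algo d k Ξ) (D : Measure (Act d 0)) : ℕ → (ℕ → Draw d Ξ) → Params k
  | 0, ζ => A.m • A.noise D 0 ζ
  | t + 1, ζ => (1 - A.m) • avgNoise A D t ζ + A.m • A.noise D (t + 1) ζ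

theorem noise_congr (A : Algo d k Ξ) (D : Measure (Act d 0)) {t : ℕ} {ζ ζ' : ℕ → Draw d Ξ}
    (h : ∀ s ≤ t, ζ s = ζ' s) : A.noise D t ζ = A.noise D t ζ' := by
  rw [noise, noise, x, x, w, w, A.st_congr fun s hs => h s (Nat.lt_succ_iff.mp hs),
    A.st_congr fun s hs => h s hs.le]

theorem avgNoise_congr (A : Algo d k Ξ) (D : Measure (Act d 0)) {t : ℕ} {ζ ζ' : ℕ → Draw d Ξ}
    (h : ∀ s ≤ t, ζ s = ζ' s) : A.avgNoise D t ζ = A.avgNoise D t ζ' := by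
  induction t with
  | zero => rw [avgNoise, avgNoise, A.noise_congr D h]
  | succ t ih =>
    rw [avgNoise, avgNoise, A.noise_congr D h, ih fun s hs => h s (hs.trans t.le_succ)]

theorem avgNoise_update (A : Algo d k Ξ) (D : Measure (Act d 0)) (t : ℕ) (ζ : ℕ → Draw d Ξ)
    (z : Draw d Ξ) : A.avgNoise D t (Function.update ζ (t + 1) z) = A.avgNoise D t ζ :=
  A.avgNoise_congr D fun _ hs => Function.update_of_ne (Nat.lt_succ_of_le hs).ne _ _

namespace Valid

variable {A : Algo d k Ξ} {p : ℝ} {D : Measure (Act d 0)} {ν : Measure Ξ}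
  {π : Measure (Draw d Ξ)} {C B ωF ωB φ σ : ℝ} [IsProbabilityMeasure D] [IsProbabilityMeasure ν]
  [IsProbabilityMeasure π]

theorem measurable_noise (h : A.Valid p D ν π C B ωF ωB φ) (ho : Objective D A.op C σ) (t : ℕ) :
    Measurable (A.noise D t) :=
  ho.measurable_noise (A.measurable_x t) (h.measurable_w t)

theorem measurable_avgNoise (h : A.Valid p D ν π C B ωF ωB φ) (ho : Objective D A.op C σ)
    (t : ℕ) : Measurable (A.avgNoise D t) := by
  induction t with
  | zero => exact (h.measurable_noise ho 0).const_smul A.m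
  | succ t ih =>
    have h1 : Measurable fun ζ => (1 - A.m) • A.avgNoise D t ζ := ih.const_smul (1 - A.m)
    have h2 : Measurable fun ζ => A.m • A.noise D (t + 1) ζ :=
      (h.measurable_noise ho (t + 1)).const_smul A.m
    simp only [avgNoise]
    exact h1.add h2

theorem norm_avgNoise_le (ho : Objective D A.op C σ) (h0 : 0 ≤ A.m) (h1 : A.m ≤ 1) (t : ℕ)
    (ζ : ℕ → Draw d Ξ) : ‖A.avgNoise D t ζ‖ ≤ 2 * gradConst E C := by
  have hn : ∀ t, ‖A.noise D t ζ‖ ≤ 2 * gradConst E C := fun t => ho.norm_noise_le _ _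
  induction t with
  | zero =>
    rw [avgNoise, norm_smul, Real.norm_of_nonneg h0]
    exact (mul_le_of_le_one_left (norm_nonneg _) h1).trans (hn 0)
  | succ t ih =>
    rw [avgNoise]
    refine (norm_add_le _ _).trans ?_
    rw [norm_smul, norm_smul, Real.norm_of_nonneg h0, Real.norm_of_nonneg (by linarith)]
    have e1 := mul_le_mul_of_nonneg_left ih (by linarith : 0 ≤ 1 - A.m)
    have e2 := mul_le_mul_of_nonneg_left (hn (t + 1)) h0
    linarith

theorem integrable_norm_sq_of_bound {X : (ℕ → Draw d Ξ) → Params k} (hX : Measurable X) {K : ℝ}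
    (hK : ∀ ζ, ‖X ζ‖ ≤ K) : Integrable (fun ζ => ‖X ζ‖ ^ 2) (path π) :=
  (MemLp.of_bound hX.aestronglyMeasurable K (Filter.Eventually.of_forall hK)).integrable_norm_pow
    two_ne_zero

/-- The effect of lazy sampling on the second moment of a shifted noise. -/
theorem integral_norm_add_noise_succ_sq_le (h : A.Valid p D ν π C B ωF ωB φ)
    (ho : Objective D A.op C σ) (t : ℕ) {V : (ℕ → Draw d Ξ) → Params k} (hV : Measurable V) {K : ℝ}
    (hK : ∀ ζ, ‖V ζ‖ ≤ K) (hinv : ∀ ζ z, V (Function.update ζ (t + 1) z) = V ζ) (r : ℝ) :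
    ∫ ζ, ‖V ζ + r • A.noise D (t + 1) ζ‖ ^ 2 ∂(path π)
      ≤ p * (∫ ζ, ‖V ζ‖ ^ 2 ∂(path π) + r ^ 2 * σ ^ 2) + (1 - p) * ∫ ζ, ‖V ζ
        + r • Clapping.noise D A.op (A.x t ζ) (A.w (t + 1) ζ)‖ ^ 2 ∂(path π) := by
  have hp := h.p_pos.le
  have hm : Measurable (Function.uncurry fun (ζ : ℕ → Draw d Ξ) (x : Act d 0) =>
      ‖V ζ + r • Clapping.noise D A.op x (A.w (t + 1) ζ)‖ ^ 2) :=
    ((hV.comp measurable_fst).add ((ho.measurable_noise measurable_snd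
      ((h.measurable_w (t + 1)).comp measurable_fst)).const_smul r)).norm.pow_const 2
  have hb : ∀ ζ x, |‖V ζ + r • Clapping.noise D A.op x (A.w (t + 1) ζ)‖ ^ 2|
      ≤ (K + |r| * (2 * gradConst E C)) ^ 2 := by
    intro ζ x
    rw [abs_of_nonneg (sq_nonneg _)]
    refine pow_le_pow_left₀ (norm_nonneg _) ((norm_add_le _ _).trans (add_le_add (hK ζ) ?_)) 2
    rw [norm_smul, Real.norm_eq_abs]
    exact mul_le_mul_of_nonneg_left (ho.norm_noise_le _ _) (abs_nonneg _)
  have key := h.integral_x_succ t hm hb (fun ζ z => by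
    funext x
    rw [hinv, w_update])
  refine (le_of_eq key).trans (add_le_add (mul_le_mul_of_nonneg_left ?_ hp) le_rfl)
  have hi := integrable_norm_sq_of_bound (π := π) hV hK
  have e1 : ∫ ζ, ‖V ζ‖ ^ 2 ∂(path π) + r ^ 2 * σ ^ 2
      = ∫ ζ, (‖V ζ‖ ^ 2 + r ^ 2 * σ ^ 2) ∂(path π) := by
    rw [integral_add hi (integrable_const _)]
    simp
  rw [e1]
  refine integral_mono_of_nonneg (Filter.Eventually.of_forall fun ζ =>
    integral_nonneg fun _ => sq_nonneg _) (hi.add (integrable_const _))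
    (Filter.Eventually.of_forall fun ζ => ?_)
  exact ho.integral_norm_add_noise_sq_le _ _ _

end Valid

end Algo

/-! ### The averaged noise under lazy sampling -/

/-- Solving both equations gives c = m(1 − p)/(p − m) and h = m(1 − m)/(p − m). With n' the noise of
the old sample at the new parameters, S + c·n has next conditional mean (1 − m)S + h(1 − p)n', which
is (1 − m)(S + c·n) when n' = n. For m = p²/4 one has h ≤ p/2 = √m. -/
theorem exists_correction {p m : ℝ} (h0 : 0 < p) (h1 : p ≤ 1) (hm : m = p ^ 2 / 4) :
    ∃ c h : ℝ, 0 ≤ c ∧ c ≤ p / 2 ∧ 0 ≤ h ∧ h ^ 2 ≤ m ∧ h = m + c ∧ (1 - m) * c = h * (1 - p) := by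
  have hm0 : 0 < m := by rw [hm]; positivity
  have hmp : m ≤ p / 4 := by nlinarith
  have hpm : 0 < p - m := by linarith
  have hc0 : 0 ≤ m * (1 - p) / (p - m) := div_nonneg (mul_nonneg hm0.le (by linarith)) hpm.le
  have hh : m + m * (1 - p) / (p - m) = m * (1 - m) / (p - m) := by
    field_simp
    ring
  have hle : m + m * (1 - p) / (p - m) ≤ p / 2 := by
    rw [hh, div_le_iff₀ hpm]
    nlinarith
  refine ⟨m * (1 - p) / (p - m), m + m * (1 - p) / (p - m), hc0, by linarith, by linarith, ?_, rfl,
    ?_⟩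
  · refine (pow_le_pow_left₀ (by linarith) hle 2).trans (le_of_eq ?_)
    rw [hm]
    ring
  · rw [hh]
    field_simp

/-- Mean and variance of a vector that is V + h·n with probability 1 − p and V otherwise. -/
theorem lazy_norm_sq {F : Type*} [NormedAddCommGroup F] [InnerProductSpace ℝ F] (p h : ℝ)
    (V n : F) : p * ‖V‖ ^ 2 + (1 - p) * ‖V + h • n‖ ^ 2
      = ‖V + (h * (1 - p)) • n‖ ^ 2 + h ^ 2 * (p * (1 - p)) * ‖n‖ ^ 2 := by
  rw [norm_add_sq_real, norm_add_sq_real, real_inner_smul_right, real_inner_smul_right, norm_smul,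
    norm_smul, mul_pow, mul_pow, Real.norm_eq_abs, sq_abs, Real.norm_eq_abs, sq_abs]
  ring

/-- Young's inequality with weight p/2: half of the contraction 1 − p is spent on the cross term. -/
theorem sq_lazy_bound {p s g : ℝ} (h0 : 0 < p) (h1 : p ≤ 1) :
    (1 - p) * (s + g) ^ 2 ≤ (1 - p / 2) * s ^ 2 + 2 / p * g ^ 2 := by
  have e1 : 2 * s * g ≤ p / 2 * s ^ 2 + 2 / p * g ^ 2 := by
    have e2 : p / 2 * s ^ 2 + 2 / p * g ^ 2 - 2 * s * g = (p * s - 2 * g) ^ 2 / (2 * p) := by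
      field_simp
      ring
    have e3 : 0 ≤ (p * s - 2 * g) ^ 2 / (2 * p) := by positivity
    linarith
  have e4 : (1 - p) * (2 * s * g) ≤ (1 - p) * (p / 2 * s ^ 2 + 2 / p * g ^ 2) :=
    mul_le_mul_of_nonneg_left e1 (by linarith)
  have e5 : p * (2 / p * g ^ 2) = 2 * g ^ 2 := by
    field_simp
  nlinarith [sq_nonneg s, sq_nonneg g, mul_nonneg (sq_nonneg p) (sq_nonneg s),
    mul_nonneg h0.le (sq_nonneg g)]

namespace Algo

/-- The noise of the old sample at the new parameters. -/
def staleNoise (A : Algo d k Ξ) (D : Measure (Act d 0)) (t : ℕ) (ζ : ℕ → Draw d Ξ) : Params k :=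
  Clapping.noise D A.op (A.x t ζ) (A.w (t + 1) ζ)

namespace Valid

variable {A : Algo d k Ξ} {p : ℝ} {D : Measure (Act d 0)} {ν : Measure Ξ}
  {π : Measure (Draw d Ξ)} {C B ωF ωB φ σ : ℝ} [IsProbabilityMeasure D] [IsProbabilityMeasure ν]
  [IsProbabilityMeasure π]

theorem memLp_noise (h : A.Valid p D ν π C B ωF ωB φ) (ho : Objective D A.op C σ) (t : ℕ) :
    MemLp (A.noise D t) 2 (path π) :=
  MemLp.of_bound (h.measurable_noise ho t).aestronglyMeasurable (2 * gradConst E C)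
    (Filter.Eventually.of_forall fun _ => ho.norm_noise_le _ _)

theorem memLp_avgNoise (h : A.Valid p D ν π C B ωF ωB φ) (ho : Objective D A.op C σ)
    (h0 : 0 ≤ A.m) (h1 : A.m ≤ 1) (t : ℕ) : MemLp (A.avgNoise D t) 2 (path π) :=
  MemLp.of_bound (h.measurable_avgNoise ho t).aestronglyMeasurable (2 * gradConst E C)
    (Filter.Eventually.of_forall fun _ => norm_avgNoise_le ho h0 h1 _ _)

theorem measurable_staleNoise (h : A.Valid p D ν π C B ωF ωB φ) (ho : Objective D A.op C σ)
    (t : ℕ) : Measurable (A.staleNoise D t) :=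
  ho.measurable_noise (A.measurable_x t) (h.measurable_w (t + 1))

theorem memLp_staleNoise (h : A.Valid p D ν π C B ωF ωB φ) (ho : Objective D A.op C σ) (t : ℕ) :
    MemLp (A.staleNoise D t) 2 (path π) :=
  MemLp.of_bound (h.measurable_staleNoise ho t).aestronglyMeasurable (2 * gradConst E C)
    (Filter.Eventually.of_forall fun _ => ho.norm_noise_le _ _)

theorem norm_staleNoise_sub_le (h : A.Valid p D ν π C B ωF ωB φ) (ho : Objective D A.op C σ)
    (t : ℕ) (ζ : ℕ → Draw d Ξ) : ‖A.staleNoise D t ζ - A.noise D t ζ‖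
      ≤ noiseConst E C * A.γ * ‖A.u (t + 1) ζ‖ := by
  have := ho.norm_noise_sub_le (by have := h.two_le; omega) (A.x t ζ) (A.w (t + 1) ζ) (A.w t ζ)
  rw [h.norm_w_step, ← mul_assoc] at this
  exact this

theorem rms_staleNoise_le (h : A.Valid p D ν π C B ωF ωB φ) (ho : Objective D A.op C σ)
    (t : ℕ) : rms π (A.staleNoise D t)
      ≤ rms π (A.noise D t) + noiseConst E C * A.γ * rms π (A.u (t + 1)) := by
  have hc : 0 ≤ noiseConst E C * A.γ :=
    mul_nonneg (noiseConst_nonneg (by have := h.two_le; omega) h.reg.one_le) h.γ_pos.le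
  have := (memLp_and_lpNorm_le₂ zero_le_one hc
    (h.measurable_staleNoise ho t).aestronglyMeasurable (h.memLp_noise ho t) (h.memLp_u t)
    fun ζ => by
      have e1 := h.norm_staleNoise_sub_le ho t ζ
      have e2 := norm_add_le (A.noise D t ζ) (A.staleNoise D t ζ - A.noise D t ζ)
      rw [add_sub_cancel] at e2
      linarith).2
  rwa [one_mul] at this

theorem rms_noise_le (ho : Objective D A.op C σ) (t : ℕ) :
    rms π (A.noise D t) ≤ 2 * gradConst E C := by
  have hg : 0 ≤ 2 * gradConst E C := (norm_nonneg _).trans (ho.norm_noise_le 0 0)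
  have hc : MemLp (fun _ : ℕ → Draw d Ξ => 2 * gradConst E C) 2 (path π) := memLp_const _
  refine (lpNorm_mono_real hc fun ζ => ho.norm_noise_le _ _).trans (le_of_eq ?_)
  rw [lpNorm_const' two_ne_zero ENNReal.ofNat_ne_top, Real.norm_of_nonneg hg]
  simp

theorem rms_noise_succ_sq_le (h : A.Valid p D ν π C B ωF ωB φ) (ho : Objective D A.op C σ)
    (t : ℕ) : rms π (A.noise D (t + 1)) ^ 2
      ≤ p * σ ^ 2 + (1 - p) * rms π (A.staleNoise D t) ^ 2 := by
  have := h.integral_norm_add_noise_succ_sq_le ho t (V := fun _ => 0) measurable_const (K := 0)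
    (fun _ => norm_zero.le) (fun _ _ => rfl) 1
  rw [lpNorm_two_sq (h.memLp_noise ho _), lpNorm_two_sq (h.memLp_staleNoise ho _)]
  simpa [staleNoise] using this

/-- The noise at time t need not have second moment at most σ², since a reused sample is correlated
with the parameters. A fresh sample resets it to σ² with probability p; in between it drifts by the
parameter step. -/
theorem rms_noise_recurrence (h : A.Valid p D ν π C B ωF ωB φ) (ho : Objective D A.op C σ)
    (t : ℕ) : rms π (A.noise D (t + 1)) ^ 2 ≤ (1 - p / 2) * rms π (A.noise D t) ^ 2
      + (p * σ ^ 2 + 2 / p * (noiseConst E C * A.γ * rms π (A.u (t + 1))) ^ 2) := by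
  have e1 := h.rms_noise_succ_sq_le ho t
  have e2 := pow_le_pow_left₀ lpNorm_nonneg (h.rms_staleNoise_le ho t) 2
  have e3 := mul_le_mul_of_nonneg_left e2 (by linarith [h.p_le] : 0 ≤ 1 - p)
  have e4 := sq_lazy_bound (s := rms π (A.noise D t))
    (g := noiseConst E C * A.γ * rms π (A.u (t + 1))) h.p_pos h.p_le
  linarith

/-- One step of the corrected noise average. -/
theorem rms_corrected_succ_sq_le (h : A.Valid p D ν π C B ωF ωB φ) (ho : Objective D A.op C σ)
    (hm0 : 0 < A.m) (hm1 : A.m ≤ 1) {c r : ℝ} (hr0 : 0 ≤ r) (hrm : r ^ 2 ≤ A.m)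
    (hr : r = A.m + c) (hc : (1 - A.m) * c = r * (1 - p)) (t : ℕ) :
    rms π (fun ζ => A.avgNoise D (t + 1) ζ + c • A.noise D (t + 1) ζ) ^ 2
      ≤ (1 - A.m) * rms π (fun ζ => A.avgNoise D t ζ + c • A.noise D t ζ) ^ 2
        + ((noiseConst E C * A.γ * rms π (A.u (t + 1))) ^ 2
          + A.m * p * (rms π (A.staleNoise D t) ^ 2 + σ ^ 2)) := by
  have hp := h.p_pos.le
  have hp1 := h.p_le
  have hS := h.memLp_avgNoise ho hm0.le hm1 t
  have hn := h.memLp_staleNoise ho t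
  have hZ : ∀ t, MemLp (fun ζ => A.avgNoise D t ζ + c • A.noise D t ζ) 2 (path π) := fun t =>
    (h.memLp_avgNoise ho hm0.le hm1 t).add ((h.memLp_noise ho t).const_smul c)
  have hV : MemLp (fun ζ => (1 - A.m) • A.avgNoise D t ζ) 2 (path π) := hS.const_smul (1 - A.m)
  have hVn : MemLp (fun ζ => (1 - A.m) • A.avgNoise D t ζ + r • A.staleNoise D t ζ) 2 (path π) :=
    hV.add (hn.const_smul r)
  have hY : MemLp (fun ζ => (1 - A.m) • A.avgNoise D t ζ + (r * (1 - p)) • A.staleNoise D t ζ) 2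
    (path π) := hV.add (hn.const_smul (r * (1 - p)))
  -- The new noise enters with total weight m + c = r.
  have e1 : ∀ ζ, A.avgNoise D (t + 1) ζ + c • A.noise D (t + 1) ζ
      = (1 - A.m) • A.avgNoise D t ζ + r • A.noise D (t + 1) ζ := by
    intro ζ
    rw [avgNoise, hr, add_smul, add_assoc]
  have key := h.integral_norm_add_noise_succ_sq_le ho t
    (V := fun ζ => (1 - A.m) • A.avgNoise D t ζ)
    ((h.measurable_avgNoise ho t).const_smul (1 - A.m)) (K := 2 * gradConst E C)
    (fun ζ => by
      rw [norm_smul, Real.norm_of_nonneg (by linarith)]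
      exact (mul_le_of_le_one_left (norm_nonneg _) (by linarith)).trans
        (norm_avgNoise_le ho hm0.le hm1 t ζ))
    (fun ζ z => by rw [avgNoise_update]) r
  -- Split into conditional mean and the variance of the coin; the variance carries r²p ≤ mp.
  have e2 : p * ∫ ζ, ‖(1 - A.m) • A.avgNoise D t ζ‖ ^ 2 ∂(path π)
      + (1 - p) * ∫ ζ, ‖(1 - A.m) • A.avgNoise D t ζ + r • A.staleNoise D t ζ‖ ^ 2 ∂(path π)
      = rms π (fun ζ => (1 - A.m) • A.avgNoise D t ζ + (r * (1 - p)) • A.staleNoise D t ζ) ^ 2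
        + r ^ 2 * (p * (1 - p)) * rms π (A.staleNoise D t) ^ 2 := by
    rw [lpNorm_two_sq hY, lpNorm_two_sq hn, ← integral_const_mul, ← integral_const_mul,
      ← integral_const_mul, ← integral_add, ← integral_add]
    · exact integral_congr_ae (Filter.Eventually.of_forall fun ζ => lazy_norm_sq _ _ _ _)
    · exact hY.integrable_norm_pow two_ne_zero
    · exact (hn.integrable_norm_pow two_ne_zero).const_mul _
    · exact (hV.integrable_norm_pow two_ne_zero).const_mul _
    · exact (hVn.integrable_norm_pow two_ne_zero).const_mul _
  have hnc : 0 ≤ noiseConst E C * A.γ :=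
    mul_nonneg (noiseConst_nonneg (by have := h.two_le; omega) h.reg.one_le) h.γ_pos.le
  have e3 : rms π (fun ζ => (1 - A.m) • A.avgNoise D t ζ + (r * (1 - p)) • A.staleNoise D t ζ)
      ≤ (1 - A.m) * rms π (fun ζ => A.avgNoise D t ζ + c • A.noise D t ζ)
        + r * (noiseConst E C * A.γ) * rms π (A.u (t + 1)) := by
    refine (memLp_and_lpNorm_le₂ (by linarith) (mul_nonneg hr0 hnc) hY.aestronglyMeasurable (hZ t)
      (h.memLp_u t) fun ζ => ?_).2
    -- By the choice of c the conditional mean is 1 − m times the old corrected average, up to the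
    -- parameter drift of the old sample's noise.
    have e4 : (1 - A.m) • A.avgNoise D t ζ + (r * (1 - p)) • A.staleNoise D t ζ
        = (1 - A.m) • (A.avgNoise D t ζ + c • A.noise D t ζ)
          + (r * (1 - p)) • (A.staleNoise D t ζ - A.noise D t ζ) := by
      rw [smul_add, smul_smul, hc, smul_sub]
      abel
    rw [e4]
    refine (norm_add_le _ _).trans ?_
    rw [norm_smul, norm_smul, Real.norm_of_nonneg (by linarith : 0 ≤ 1 - A.m),
      Real.norm_of_nonneg (mul_nonneg hr0 (by linarith))]
    refine add_le_add le_rfl ?_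
    rw [mul_assoc r (noiseConst E C * A.γ)]
    exact mul_le_mul (mul_le_of_le_one_right hr0 (by linarith))
      (h.norm_staleNoise_sub_le ho t ζ) (norm_nonneg _) hr0
  have e5 : rms π (fun ζ => (1 - A.m) • A.avgNoise D t ζ
      + (r * (1 - p)) • A.staleNoise D t ζ) ^ 2
      ≤ (1 - A.m) * rms π (fun ζ => A.avgNoise D t ζ + c • A.noise D t ζ) ^ 2
        + (noiseConst E C * A.γ * rms π (A.u (t + 1))) ^ 2 := by
    refine (pow_le_pow_left₀ lpNorm_nonneg e3 2).trans ?_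
    refine (sq_convex_bound (by linarith) (by linarith)).trans (add_le_add le_rfl ?_)
    rw [sub_sub_cancel, div_le_iff₀ hm0]
    calc _ = r ^ 2 * (noiseConst E C * A.γ * rms π (A.u (t + 1))) ^ 2 := by ring
      _ ≤ A.m * (noiseConst E C * A.γ * rms π (A.u (t + 1))) ^ 2 := by gcongr
      _ = _ := mul_comm _ _
  rw [lpNorm_two_sq (hZ (t + 1))]
  simp only [e1]
  have e6 : r ^ 2 * (p * (1 - p)) * rms π (A.staleNoise D t) ^ 2
      ≤ A.m * p * rms π (A.staleNoise D t) ^ 2 := by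
    rw [← mul_assoc]
    refine mul_le_mul_of_nonneg_right ?_ (sq_nonneg _)
    exact (mul_le_of_le_one_right (by positivity) (by linarith)).trans
      (mul_le_mul_of_nonneg_right hrm hp)
  have e7 : r ^ 2 * (p * σ ^ 2) ≤ A.m * (p * σ ^ 2) :=
    mul_le_mul_of_nonneg_right hrm (by positivity)
  have key' := key
  rw [show (fun ζ => ‖(1 - A.m) • A.avgNoise D t ζ
    + r • Clapping.noise D A.op (A.x t ζ) (A.w (t + 1) ζ)‖ ^ 2) = fun ζ =>
      ‖(1 - A.m) • A.avgNoise D t ζ + r • A.staleNoise D t ζ‖ ^ 2 from rfl] at key'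
  linarith

/-- The averaged noise for the momentum coefficient `p² / 4`. -/
theorem sum_avgNoise_le (h : A.Valid p D ν π C B ωF ωB φ) (ho : Objective D A.op C σ)
    (hm : A.m = p ^ 2 / 4) (T : ℕ) :
    ∑ t ∈ Finset.range (T + 1), rms π (A.avgNoise D t) ^ 2
      ≤ 11 * (2 * gradConst E C) ^ 2 + 11 * (p * T * σ ^ 2)
        + 30 * noiseConst E C ^ 2 * ((A.γ / p) ^ 2
          * ∑ t ∈ Finset.range T, rms π (A.u (t + 1)) ^ 2) := by
  have hp := h.p_pos
  have hp1 := h.p_le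
  have hm0 : 0 < A.m := by rw [hm]; positivity
  have hm1 : A.m ≤ 1 := by rw [hm]; nlinarith
  obtain ⟨c, r, hc0, hcp, hr0, hrm, hr, hc⟩ := exists_correction hp hp1 hm
  set W := ∑ t ∈ Finset.range T, (noiseConst E C * A.γ * rms π (A.u (t + 1))) ^ 2 with hW
  have hW0 : 0 ≤ W := Finset.sum_nonneg fun _ _ => sq_nonneg _
  have hWe : W / p ^ 2 = noiseConst E C ^ 2 * ((A.γ / p) ^ 2
      * ∑ t ∈ Finset.range T, rms π (A.u (t + 1)) ^ 2) := by
    rw [hW, Finset.sum_div, Finset.mul_sum, Finset.mul_sum]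
    refine Finset.sum_congr rfl fun t _ => ?_
    field_simp
  have hWp : W / p ≤ W / p ^ 2 := by
    refine div_le_div_of_nonneg_left hW0 (by positivity) ?_
    nlinarith
  have hWp' : p * W ≤ W / p ^ 2 := by
    rw [le_div_iff₀ (by positivity)]
    have : p * p ^ 2 ≤ 1 := mul_le_one₀ hp1 (by positivity) (pow_le_one₀ hp.le hp1)
    nlinarith
  have hinit := pow_le_pow_left₀ lpNorm_nonneg (rms_noise_le (π := π) ho 0) 2
  set a₀ := rms π (A.noise D 0) ^ 2 with ha₀
  set a := fun t => rms π (A.noise D t) with ha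
  set Sa := ∑ t ∈ Finset.range (T + 1), a t ^ 2 with hSa
  have hSaT : ∑ t ∈ Finset.range T, a t ^ 2 ≤ Sa :=
    Finset.sum_le_sum_of_subset_of_nonneg (Finset.range_mono T.le_succ) fun _ _ _ => sq_nonneg _
  -- The contraction rate p/2 controls p times the sum. This weight suffices: the noise enters the
  -- estimates below with factors of order p only.
  have ha_sum : p * Sa ≤ 2 * a₀ + 2 * (p * T * σ ^ 2) + 4 * (W / p ^ 2) := by
    have := sum_le_of_recurrence (A := fun t => a t ^ 2) (by linarith : 0 ≤ 1 - p / 2)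
      (fun _ => sq_nonneg _) (fun t => h.rms_noise_recurrence ho t) T
    rw [Finset.sum_add_distrib, Finset.sum_const, Finset.card_range, nsmul_eq_mul,
      ← Finset.mul_sum, ← hW, ← hSa, sub_sub_cancel] at this
    have e : 2 / p * W = 2 * (W / p) := by ring
    rw [e] at this
    change _ ≤ a₀ + _ at this
    linarith
  set z := fun t => rms π (fun ζ => A.avgNoise D t ζ + c • A.noise D t ζ) with hz
  set Sz := ∑ t ∈ Finset.range (T + 1), z t ^ 2 with hSz
  -- The initial corrected average is (m + c)·n = r·n, and r² ≤ m cancels the 1/m of the summed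
  -- recurrence.
  have hz0 : z 0 ^ 2 ≤ A.m * a₀ := by
    have e0 : z 0 = r * rms π (A.noise D 0) := by
      have e1 : (fun ζ => A.avgNoise D 0 ζ + c • A.noise D 0 ζ) = r • A.noise D 0 := by
        funext ζ
        rw [avgNoise, hr, add_smul]
        rfl
      have e2 := lpNorm_const_smul (p := 2) r (A.noise D 0) (path π)
      rw [coe_nnnorm, Real.norm_of_nonneg hr0] at e2
      rw [hz]
      simp only [e1]
      exact e2
    rw [e0, mul_pow]
    exact mul_le_mul_of_nonneg_right hrm (sq_nonneg _)
  -- Each step injects variance of order mp against a contraction rate m, which leaves p. The drift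
  -- is divided by m = p²/4, hence W/p².
  have hz_sum : Sz ≤ a₀ + 6 * (W / p ^ 2) + 2 * (p * Sa) + p * T * σ ^ 2 := by
    have hrec : ∀ t, z (t + 1) ^ 2 ≤ (1 - A.m) * z t ^ 2
        + ((1 + 2 * (A.m * p)) * (noiseConst E C * A.γ * rms π (A.u (t + 1))) ^ 2
          + (2 * (A.m * p) * a t ^ 2 + A.m * p * σ ^ 2)) := by
      intro t
      have e1 := h.rms_corrected_succ_sq_le ho hm0 hm1 hr0 hrm hr hc t
      have e2 := (pow_le_pow_left₀ lpNorm_nonneg (h.rms_staleNoise_le ho t) 2).trans add_sq_le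
      have e3 := mul_le_mul_of_nonneg_left e2 (mul_pos hm0 hp).le
      have e4 : (a t) = rms π (A.noise D t) := rfl
      rw [← e4] at e3
      refine e1.trans ?_
      linarith
    have := sum_le_of_recurrence (A := fun t => z t ^ 2) (by linarith : 0 ≤ 1 - A.m)
      (fun _ => sq_nonneg _) hrec T
    rw [Finset.sum_add_distrib, Finset.sum_add_distrib, Finset.sum_const, Finset.card_range,
      nsmul_eq_mul, ← Finset.mul_sum, ← Finset.mul_sum, ← hW, ← hSz, sub_sub_cancel] at this
    have e1 : 2 * (A.m * p) * ∑ t ∈ Finset.range T, a t ^ 2 ≤ 2 * (A.m * p) * Sa :=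
      mul_le_mul_of_nonneg_left hSaT (by positivity)
    have e2 : A.m * Sz ≤ A.m * (a₀ + (W / A.m + 2 * (p * W)) + 2 * (p * Sa) + p * T * σ ^ 2) := by
      have e3 : A.m * (W / A.m) = W := by field_simp
      calc A.m * Sz ≤ A.m * a₀ + ((1 + 2 * (A.m * p)) * W + (2 * (A.m * p) * Sa
            + T * (A.m * p * σ ^ 2))) := by
            refine this.trans ?_
            linarith
        _ = A.m * a₀ + (W + 2 * (A.m * p) * W) + 2 * (A.m * p) * Sa + T * (A.m * p * σ ^ 2) := by
            ring
        _ = A.m * a₀ + (A.m * (W / A.m) + 2 * (A.m * p) * W) + 2 * (A.m * p) * Sa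
            + T * (A.m * p * σ ^ 2) := by rw [e3]
        _ = _ := by ring
    have e3 := le_of_mul_le_mul_left e2 hm0
    have e4 : W / A.m = 4 * (W / p ^ 2) := by
      rw [hm]
      field_simp
    linarith
  -- The correction c·n is removed again at the cost of c² ≤ p/4.
  have hS : ∀ t, rms π (A.avgNoise D t) ^ 2 ≤ 2 * z t ^ 2 + p / 2 * a t ^ 2 := by
    intro t
    have e1 := (memLp_and_lpNorm_le₂ (P := path π) zero_le_one hc0
      (h.measurable_avgNoise ho t).aestronglyMeasurable
      ((h.memLp_avgNoise ho hm0.le hm1 t).add ((h.memLp_noise ho t).const_smul c))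
      (h.memLp_noise ho t) fun ζ => by
        have := norm_sub_le (A.avgNoise D t ζ + c • A.noise D t ζ) (c • A.noise D t ζ)
        rw [add_sub_cancel_right, norm_smul, Real.norm_of_nonneg hc0] at this
        rw [one_mul]
        exact this).2
    rw [one_mul] at e1
    refine ((pow_le_pow_left₀ lpNorm_nonneg e1 2).trans add_sq_le).trans ?_
    have e2 : c ^ 2 ≤ p / 4 := by nlinarith
    have e3 : (c * a t) ^ 2 ≤ p / 4 * a t ^ 2 := by
      rw [mul_pow]
      exact mul_le_mul_of_nonneg_right e2 (sq_nonneg _)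
    change 2 * (z t ^ 2 + (c * a t) ^ 2) ≤ _
    linarith
  have hS' := Finset.sum_le_sum fun t (_ : t ∈ Finset.range (T + 1)) => hS t
  rw [Finset.sum_add_distrib, ← Finset.mul_sum, ← Finset.mul_sum, ← hSz, ← hSa] at hS'
  rw [mul_assoc 30, ← hWe]
  linarith

/-- Without variance the averaged noise vanishes. -/
theorem sum_avgNoise_eq_zero (h : A.Valid p D ν π C B ωF ωB φ) (ho : Objective D A.op C 0)
    (T : ℕ) : ∑ t ∈ Finset.range T, rms π (A.avgNoise D t) ^ 2 = 0 := by
  have hn : ∀ t, ∀ᵐ ζ ∂(path π), A.noise D t ζ = 0 := by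
    intro t
    have h1 := ho.ae_noise_eq_zero (by have := h.two_le; omega)
    filter_upwards [(h.measurePreserving_x t).quasiMeasurePreserving.ae h1] with ζ hζ
    exact hζ _
  have hS : ∀ t, ∀ᵐ ζ ∂(path π), A.avgNoise D t ζ = 0 := by
    intro t
    induction t with
    | zero =>
      filter_upwards [hn 0] with ζ hζ
      rw [avgNoise, hζ, smul_zero]
    | succ t ih =>
      filter_upwards [hn (t + 1), ih] with ζ h1 h2
      rw [avgNoise, h1, h2, smul_zero, smul_zero, add_zero]
  refine Finset.sum_eq_zero fun t _ => ?_
  have hL : MemLp (A.avgNoise D t) 2 (path π) :=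
    MemLp.of_bound (h.measurable_avgNoise ho t).aestronglyMeasurable 0
      ((hS t).mono fun ζ hζ => by rw [hζ, norm_zero])
  have e : rms π (A.avgNoise D t) = 0 := (lpNorm_eq_zero hL two_ne_zero).mpr (hS t)
  rw [e, zero_pow two_ne_zero]

end Valid

end Algo

/-! ### Momentum and descent -/

/-- Mean value inequality on the ball of radius ‖y − x‖, which gives L in place of the sharp L/2. -/
theorem le_add_inner_gradient {F : Type*} [NormedAddCommGroup F] [InnerProductSpace ℝ F]
    [CompleteSpace F] {f : F → ℝ} {L : ℝ} (hL : 0 ≤ L) (hf : Differentiable ℝ f)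
    (hlip : ∀ w w', ‖gradient f w - gradient f w'‖ ≤ L * ‖w - w'‖) (x y : F) :
    f y ≤ f x + inner ℝ (gradient f x) (y - x) + L * ‖y - x‖ ^ 2 := by
  have hfd : ∀ z, ‖fderiv ℝ f z - fderiv ℝ f x‖ = ‖gradient f z - gradient f x‖ := by
    intro z
    rw [gradient, gradient, ← map_sub, LinearIsometryEquiv.norm_map]
  have key := (convex_closedBall x ‖y - x‖).norm_image_sub_le_of_norm_hasFDerivWithin_le'
    (f := f) (f' := fderiv ℝ f) (φ := fderiv ℝ f x) (C := L * ‖y - x‖) (x := x) (y := y)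
    (fun z _ => (hf z).hasFDerivAt.hasFDerivWithinAt)
    (fun z hz => by
      rw [hfd]
      refine (hlip z x).trans (mul_le_mul_of_nonneg_left ?_ hL)
      rwa [mem_closedBall_iff_norm] at hz)
    (Metric.mem_closedBall_self (norm_nonneg _)) (mem_closedBall_iff_norm.mpr le_rfl)
  have e : fderiv ℝ f x (y - x) = inner ℝ (gradient f x) (y - x) := by
    rw [gradient, InnerProductSpace.toDual_symm_apply]
  have h1 := (le_abs_self _).trans key
  rw [e] at h1
  nlinarith

/-- Polarization of the inner product of u with the gradient. The smoothness term uses up half of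
‖u‖², and the other half stays on the left to absorb later errors. -/
theorem descent_step {F : Type*} [NormedAddCommGroup F] [InnerProductSpace ℝ F]
    [CompleteSpace F] {f : F → ℝ} {L γ : ℝ} (hL : 0 ≤ L) (hf : Differentiable ℝ f)
    (hlip : ∀ w w', ‖gradient f w - gradient f w'‖ ≤ L * ‖w - w'‖) (hγ : 0 < γ)
    (hLγ : L * γ ≤ 1 / 4) (w u : F) :
    ‖gradient f w‖ ^ 2 + 1 / 2 * ‖u‖ ^ 2
      ≤ 2 / γ * (f w - f (w - γ • u)) + ‖u - gradient f w‖ ^ 2 := by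
  have h1 := le_add_inner_gradient hL hf hlip w (w - γ • u)
  rw [sub_sub_cancel_left, norm_neg, inner_neg_right, real_inner_smul_right, norm_smul,
    Real.norm_of_nonneg hγ.le, mul_pow] at h1
  have h2 : ‖u - gradient f w‖ ^ 2
      = ‖u‖ ^ 2 - 2 * inner ℝ (gradient f w) u + ‖gradient f w‖ ^ 2 := by
    rw [norm_sub_sq_real, real_inner_comm]
  have h3 : L * (γ ^ 2 * ‖u‖ ^ 2) ≤ γ * (1 / 4 * ‖u‖ ^ 2) := by
    calc L * (γ ^ 2 * ‖u‖ ^ 2) = γ * (L * γ * ‖u‖ ^ 2) := by ring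
      _ ≤ γ * (1 / 4 * ‖u‖ ^ 2) := by gcongr
  have h4 : inner ℝ (gradient f w) u - 1 / 4 * ‖u‖ ^ 2 ≤ (f w - f (w - γ • u)) / γ := by
    rw [le_div_iff₀ hγ]
    linarith
  have h5 : 2 / γ * (f w - f (w - γ • u)) = 2 * ((f w - f (w - γ • u)) / γ) := by ring
  rw [h5, h2]
  linarith

namespace Algo

/-- The deviation of the momentum from the exact gradient. -/
def momErr (A : Algo d k Ξ) (D : Measure (Act d 0)) (t : ℕ) (ζ : ℕ → Draw d Ξ) : Params k :=
  A.u (t + 1) ζ - gradient (risk D A.op) (A.w t ζ)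

/-- The part of the momentum error that is not averaged noise. -/
def momRes (A : Algo d k Ξ) (D : Measure (Act d 0)) (t : ℕ) (ζ : ℕ → Draw d Ξ) : Params k :=
  A.momErr D t ζ - A.avgNoise D t ζ

theorem u_succ_eq (A : Algo d k Ξ) (D : Measure (Act d 0)) (t : ℕ) (ζ : ℕ → Draw d Ξ) :
    A.u (t + 1) ζ = (1 - A.m) • A.u t ζ + A.m • (A.bias t ζ + A.noise D t ζ
      + gradient (risk D A.op) (A.w t ζ)) := by
  have e : A.bias t ζ + A.noise D t ζ + gradient (risk D A.op) (A.w t ζ)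
      = paramGrad A.op (A.w t ζ) (A.y (t + 1) ζ) (A.v (t + 1) ζ) := by
    rw [bias, noise, Clapping.noise, grad]
    module
  rw [u_succ, e]

theorem momRes_zero (A : Algo d k Ξ) (D : Measure (Act d 0)) (ζ : ℕ → Draw d Ξ) :
    A.momRes D 0 ζ = A.m • A.bias 0 ζ - (1 - A.m) • gradient (risk D A.op) (A.w 0 ζ) := by
  rw [momRes, momErr, A.u_succ_eq D, u_zero, avgNoise]
  module

/-- Subtracting the averaged noise removes the noise exactly. What remains is a filter driven by
gradient increments and the bias. -/
theorem momRes_succ (A : Algo d k Ξ) (D : Measure (Act d 0)) (t : ℕ) (ζ : ℕ → Draw d Ξ) :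
    A.momRes D (t + 1) ζ = (1 - A.m) • A.momRes D t ζ
      + (1 - A.m) • (gradient (risk D A.op) (A.w t ζ) - gradient (risk D A.op) (A.w (t + 1) ζ))
      + A.m • A.bias (t + 1) ζ := by
  rw [momRes, momRes, momErr, momErr, A.u_succ_eq D (t + 1), avgNoise]
  module

namespace Valid

variable {A : Algo d k Ξ} {p : ℝ} {D : Measure (Act d 0)} {ν : Measure Ξ}
  {π : Measure (Draw d Ξ)} {C B ωF ωB φ σ : ℝ} [IsProbabilityMeasure D] [IsProbabilityMeasure ν]
  [IsProbabilityMeasure π]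

theorem measurable_gradient (h : A.Valid p D ν π C B ωF ωB φ) (ho : Objective D A.op C σ)
    (t : ℕ) : Measurable fun ζ => gradient (risk D A.op) (A.w t ζ) :=
  ho.continuous_gradient.measurable.comp (h.measurable_w t)

theorem memLp_gradient (h : A.Valid p D ν π C B ωF ωB φ) (ho : Objective D A.op C σ) (t : ℕ) :
    MemLp (fun ζ => gradient (risk D A.op) (A.w t ζ)) 2 (path π) :=
  MemLp.of_bound (h.measurable_gradient ho t).aestronglyMeasurable (gradConst E C)
    (Filter.Eventually.of_forall fun _ => ho.norm_gradient_le _)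

theorem rms_gradient_le (ho : Objective D A.op C σ) (t : ℕ) :
    rms π (fun ζ => gradient (risk D A.op) (A.w t ζ)) ≤ gradConst E C := by
  have hg : 0 ≤ gradConst E C := (norm_nonneg _).trans (ho.norm_gradient_le 0)
  have hc : MemLp (fun _ : ℕ → Draw d Ξ => gradConst E C) 2 (path π) := memLp_const _
  refine (lpNorm_mono_real hc fun ζ => ho.norm_gradient_le _).trans (le_of_eq ?_)
  rw [lpNorm_const' two_ne_zero ENNReal.ofNat_ne_top, Real.norm_of_nonneg hg]
  simp

theorem memLp_momErr (h : A.Valid p D ν π C B ωF ωB φ) (ho : Objective D A.op C σ) (t : ℕ) :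
    MemLp (A.momErr D t) 2 (path π) := (h.memLp_u t).sub (h.memLp_gradient ho t)

theorem memLp_momRes (h : A.Valid p D ν π C B ωF ωB φ) (ho : Objective D A.op C σ)
    (h0 : 0 ≤ A.m) (h1 : A.m ≤ 1) (t : ℕ) : MemLp (A.momRes D t) 2 (path π) :=
  (h.memLp_momErr ho t).sub (h.memLp_avgNoise ho h0 h1 t)

/-- Filter of rate m: the bias, weighted by m, keeps its energy; the gradient increment, of size
Cγ‖u‖, is amplified by 1/m. The start u = 0 costs the squared gradient bound divided by m. -/
theorem sum_momRes_le (h : A.Valid p D ν π C B ωF ωB φ) (ho : Objective D A.op C σ)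
    (h0 : 0 < A.m) (h1 : A.m ≤ 1) (T : ℕ) :
    ∑ t ∈ Finset.range (T + 1), rms π (A.momRes D t) ^ 2
      ≤ 2 * gradConst E C ^ 2 / A.m + 4 * ∑ t ∈ Finset.range (T + 1), rms π (A.bias t) ^ 2
        + 2 * (C * A.γ / A.m) ^ 2 * ∑ t ∈ Finset.range (T + 1), rms π (A.u (t + 1)) ^ 2 := by
  have hC := ho.reg.nonneg
  have hm1 : 0 ≤ 1 - A.m := by linarith
  have hzero : rms π (A.momRes D 0) ≤ A.m * rms π (A.bias 0) + gradConst E C := by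
    have := (memLp_and_lpNorm_le₂ (P := path π) h0.le zero_le_one
      (h.memLp_momRes ho h0.le h1 0).aestronglyMeasurable (h.memLp_bias 0)
      (h.memLp_gradient ho 0) fun ζ => by
        rw [momRes_zero]
        refine (norm_sub_le _ _).trans ?_
        rw [norm_smul, norm_smul, Real.norm_of_nonneg h0.le, Real.norm_of_nonneg hm1]
        exact add_le_add le_rfl (mul_le_mul_of_nonneg_right (by linarith) (norm_nonneg _))).2
    rw [one_mul] at this
    exact this.trans (add_le_add le_rfl (rms_gradient_le ho 0))
  have hsucc : ∀ t, rms π (A.momRes D (t + 1)) ≤ (1 - A.m) * rms π (A.momRes D t)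
      + (C * A.γ * rms π (A.u (t + 1)) + A.m * rms π (A.bias (t + 1))) := by
    intro t
    have := (memLp_and_lpNorm_le₃ (P := path π) hm1 (mul_nonneg hC h.γ_pos.le) h0.le
      (h.memLp_momRes ho h0.le h1 (t + 1)).aestronglyMeasurable (h.memLp_momRes ho h0.le h1 t)
      (h.memLp_u t) (h.memLp_bias (t + 1)) fun ζ => by
        rw [momRes_succ]
        refine norm_add₃_le.trans ?_
        rw [norm_smul, norm_smul, norm_smul, Real.norm_of_nonneg h0.le, Real.norm_of_nonneg hm1]
        refine add_le_add (add_le_add le_rfl ?_) le_rfl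
        refine (mul_le_of_le_one_left (norm_nonneg _) (by linarith)).trans ?_
        refine (ho.lipschitz _ _).trans (le_of_eq ?_)
        rw [norm_sub_rev, h.norm_w_step, mul_assoc]).2
    rwa [add_assoc] at this
  have key := sum_sq_le_of_recurrence hm1 (by linarith) (fun _ => lpNorm_nonneg) hsucc T
  rw [sub_sub_cancel] at key
  refine key.trans ?_
  set β := fun t => rms π (A.bias t) with hβ
  set U := fun t => rms π (A.u (t + 1)) with hU
  have hβs : ∑ t ∈ Finset.range (T + 1), β t ^ 2
      = ∑ t ∈ Finset.range T, β (t + 1) ^ 2 + β 0 ^ 2 := Finset.sum_range_succ' _ _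
  have hUs : ∑ t ∈ Finset.range T, U t ^ 2 ≤ ∑ t ∈ Finset.range (T + 1), U t ^ 2 :=
    Finset.sum_le_sum_of_subset_of_nonneg (Finset.range_mono T.le_succ) fun _ _ _ => sq_nonneg _
  have e1 : rms π (A.momRes D 0) ^ 2 / A.m ≤ 2 * β 0 ^ 2 + 2 * gradConst E C ^ 2 / A.m := by
    rw [div_le_iff₀ h0, add_mul, div_mul_cancel₀ _ h0.ne']
    refine ((pow_le_pow_left₀ lpNorm_nonneg hzero 2).trans add_sq_le).trans ?_
    have : A.m ^ 2 ≤ A.m := by nlinarith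
    have e2 := mul_le_mul_of_nonneg_right this (sq_nonneg (β 0))
    rw [mul_pow]
    change 2 * (A.m ^ 2 * β 0 ^ 2 + _) ≤ _
    linarith
  have e2 : (∑ t ∈ Finset.range T, (C * A.γ * U t + A.m * β (t + 1)) ^ 2) / A.m ^ 2
      ≤ 2 * (C * A.γ / A.m) ^ 2 * ∑ t ∈ Finset.range T, U t ^ 2
        + 2 * ∑ t ∈ Finset.range T, β (t + 1) ^ 2 := by
    rw [Finset.sum_div, Finset.mul_sum, Finset.mul_sum, ← Finset.sum_add_distrib]
    refine Finset.sum_le_sum fun t _ => ?_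
    have e3 : (C * A.γ * U t + A.m * β (t + 1)) ^ 2 / A.m ^ 2
        = (C * A.γ / A.m * U t + β (t + 1)) ^ 2 := by
      field_simp
    rw [e3]
    refine add_sq_le.trans (le_of_eq ?_)
    ring
  have e3 := mul_le_mul_of_nonneg_left hUs
    (by positivity : 0 ≤ 2 * (C * A.γ / A.m) ^ 2)
  have e4 : 0 ≤ ∑ t ∈ Finset.range T, β (t + 1) ^ 2 := Finset.sum_nonneg fun _ _ => sq_nonneg _
  rw [hβs]
  linarith [sq_nonneg (β 0)]

/-- The descent inequality telescopes along each path before the expectation is taken. The momentum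
error is then split into its residual part and the averaged noise. -/
theorem sum_gradient_le (h : A.Valid p D ν π C B ωF ωB φ) (ho : Objective D A.op C σ)
    (h0 : 0 < A.m) (h1 : A.m ≤ 1) (hγ : C * A.γ ≤ 1 / 4) {Δ : ℝ}
    (hΔ : ∀ w, risk D A.op A.w₁ - risk D A.op w ≤ Δ) (T : ℕ) :
    ∑ t ∈ Finset.range (T + 1), rms π (fun ζ => gradient (risk D A.op) (A.w t ζ)) ^ 2
      + 1 / 2 * ∑ t ∈ Finset.range (T + 1), rms π (A.u (t + 1)) ^ 2
      ≤ 2 / A.γ * Δ + 4 * gradConst E C ^ 2 / A.m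
        + 8 * ∑ t ∈ Finset.range (T + 1), rms π (A.bias t) ^ 2
        + 4 * (C * A.γ / A.m) ^ 2 * ∑ t ∈ Finset.range (T + 1), rms π (A.u (t + 1)) ^ 2
        + 2 * ∑ t ∈ Finset.range (T + 1), rms π (A.avgNoise D t) ^ 2 := by
  have hpt : ∀ (T : ℕ) (ζ : ℕ → Draw d Ξ), ∑ t ∈ Finset.range T,
      (‖gradient (risk D A.op) (A.w t ζ)‖ ^ 2 + 1 / 2 * ‖A.u (t + 1) ζ‖ ^ 2)
      ≤ 2 / A.γ * (risk D A.op A.w₁ - risk D A.op (A.w T ζ))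
        + ∑ t ∈ Finset.range T, ‖A.momErr D t ζ‖ ^ 2 := by
    intro T ζ
    induction T with
    | zero => simp [w_zero]
    | succ T ih =>
      rw [Finset.sum_range_succ, Finset.sum_range_succ]
      have := descent_step ho.reg.nonneg ho.differentiable ho.lipschitz h.γ_pos hγ
        (A.w T ζ) (A.u (T + 1) ζ)
      rw [← w_succ] at this
      change _ ≤ _ + ‖A.momErr D T ζ‖ ^ 2 at this
      linarith
  have iG : ∀ t, Integrable (fun ζ => ‖gradient (risk D A.op) (A.w t ζ)‖ ^ 2) (path π) :=
    fun t => (h.memLp_gradient ho t).integrable_norm_pow two_ne_zero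
  have iU : ∀ t, Integrable (fun ζ => ‖A.u (t + 1) ζ‖ ^ 2) (path π) :=
    fun t => (h.memLp_u t).integrable_norm_pow two_ne_zero
  have iM : ∀ t, Integrable (fun ζ => ‖A.momErr D t ζ‖ ^ 2) (path π) :=
    fun t => (h.memLp_momErr ho t).integrable_norm_pow two_ne_zero
  have iGU : ∀ t, Integrable (fun ζ => ‖gradient (risk D A.op) (A.w t ζ)‖ ^ 2
      + 1 / 2 * ‖A.u (t + 1) ζ‖ ^ 2) (path π) := fun t => (iG t).add ((iU t).const_mul _)
  have hint : ∑ t ∈ Finset.range (T + 1), rms π (fun ζ => gradient (risk D A.op) (A.w t ζ)) ^ 2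
      + 1 / 2 * ∑ t ∈ Finset.range (T + 1), rms π (A.u (t + 1)) ^ 2
      ≤ 2 / A.γ * Δ + ∑ t ∈ Finset.range (T + 1), rms π (A.momErr D t) ^ 2 := by
    have e1 : ∑ t ∈ Finset.range (T + 1), rms π (fun ζ => gradient (risk D A.op) (A.w t ζ)) ^ 2
        + 1 / 2 * ∑ t ∈ Finset.range (T + 1), rms π (A.u (t + 1)) ^ 2
        = ∫ ζ, ∑ t ∈ Finset.range (T + 1),
          (‖gradient (risk D A.op) (A.w t ζ)‖ ^ 2 + 1 / 2 * ‖A.u (t + 1) ζ‖ ^ 2) ∂(path π) := by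
      rw [integral_finsetSum _ fun t _ => iGU t, Finset.mul_sum,
        ← Finset.sum_add_distrib]
      refine Finset.sum_congr rfl fun t _ => ?_
      rw [integral_add (iG t) ((iU t).const_mul _), integral_const_mul,
        lpNorm_two_sq (h.memLp_gradient ho t), lpNorm_two_sq (h.memLp_u t)]
    have e2 : 2 / A.γ * Δ + ∑ t ∈ Finset.range (T + 1), rms π (A.momErr D t) ^ 2
        = ∫ ζ, (2 / A.γ * Δ + ∑ t ∈ Finset.range (T + 1), ‖A.momErr D t ζ‖ ^ 2) ∂(path π) := by
      rw [integral_add (integrable_const _) (integrable_finsetSum _ fun t _ => iM t),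
        integral_finsetSum _ fun t _ => iM t, integral_const, probReal_univ, one_smul]
      congr 1
      exact Finset.sum_congr rfl fun t _ => lpNorm_two_sq (h.memLp_momErr ho t)
    rw [e1, e2]
    refine integral_mono (integrable_finsetSum _ fun t _ => iGU t)
      ((integrable_const _).add (integrable_finsetSum _ fun t _ => iM t)) fun ζ => ?_
    refine (hpt (T + 1) ζ).trans (add_le_add (mul_le_mul_of_nonneg_left (hΔ _) ?_) le_rfl)
    exact div_nonneg zero_le_two h.γ_pos.le
  have hM : ∀ t, rms π (A.momErr D t) ^ 2
      ≤ 2 * rms π (A.momRes D t) ^ 2 + 2 * rms π (A.avgNoise D t) ^ 2 := by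
    intro t
    have := (memLp_and_lpNorm_le₂ (P := path π) zero_le_one zero_le_one
      (h.memLp_momErr ho t).aestronglyMeasurable (h.memLp_momRes ho h0.le h1 t)
      (h.memLp_avgNoise ho h0.le h1 t) fun ζ => by
        rw [one_mul, one_mul]
        have e := norm_add_le (A.momRes D t ζ) (A.avgNoise D t ζ)
        rwa [momRes, sub_add_cancel] at e).2
    rw [one_mul, one_mul] at this
    refine ((pow_le_pow_left₀ lpNorm_nonneg this 2).trans add_sq_le).trans (le_of_eq ?_)
    ring
  have hM' := Finset.sum_le_sum fun t (_ : t ∈ Finset.range (T + 1)) => hM t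
  rw [Finset.sum_add_distrib, ← Finset.mul_sum, ← Finset.mul_sum] at hM'
  have hR := h.sum_momRes_le ho h0 h1 T
  have e : 4 * gradConst E C ^ 2 / A.m = 2 * (2 * gradConst E C ^ 2 / A.m) := by ring
  rw [e]
  linarith

end Valid

end Algo

/-! ### The convergence bound -/

namespace Algo

namespace Valid

theorem sum_drive_le {A : Algo d k Ξ} {p : ℝ} {D : Measure (Act d 0)} {ν : Measure Ξ}
    {π : Measure (Draw d Ξ)} {C B ωF ωB φ : ℝ} [IsProbabilityMeasure D] [IsProbabilityMeasure ν]
    [IsProbabilityMeasure π] (h : A.Valid p D ν π C B ωF ωB φ) (T : ℕ) :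
    ∑ t ∈ Finset.range T, drive A π t ^ 2
      ≤ 2 * (p * φ ^ 2 * T)
        + 2 * (A.γ ^ 2 * ∑ t ∈ Finset.range T, rms π (A.u (t + 1)) ^ 2) := by
  have e : ∀ t, drive A π t ^ 2
      ≤ 2 * (p * φ ^ 2) + 2 * A.γ ^ 2 * rms π (A.u (t + 1)) ^ 2 := by
    intro t
    have e1 : drive A π t ^ 2 ≤ _ := add_sq_le
    have e2 := (h.memLp_yStep_zero t).2
    rw [mul_pow] at e1
    linarith
  refine (Finset.sum_le_sum fun t _ => e t).trans (le_of_eq ?_)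
  rw [Finset.sum_add_distrib, ← Finset.mul_sum _ _ (2 * A.γ ^ 2), Finset.sum_const,
    Finset.card_range, nsmul_eq_mul]
  ring

/-- Bias, gradient increments and noise drift each bring a multiple of the squared momenta. With γ
small against m, against p (since m ≤ p when m = p²/4) and against the product of the compression
factors, these fit into the half kept by the descent step. -/
theorem exists_gradient_sum_le (hE : 2 ≤ E) {C B Δ : ℝ} (hC : 1 ≤ C) (hB : 0 ≤ B)
    (hΔ : 0 ≤ Δ) :
    ∃ K c₀ : ℝ, 0 < K ∧ 0 < c₀ ∧ ∀ (d : Fin (E + 1) → ℕ) (k : Fin E → ℕ) (Ξ : Type*)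
      [MeasurableSpace Ξ] (A : Algo d k Ξ) (p : ℝ) (D : Measure (Act d 0)) (ν : Measure Ξ)
      (π : Measure (Draw d Ξ)) (ωF ωB φ σ : ℝ) [IsProbabilityMeasure D] [IsProbabilityMeasure ν]
      [IsProbabilityMeasure π],
      A.Valid p D ν π C B ωF ωB φ → Objective D A.op C σ → 0 < A.m → A.m ≤ 1 →
      (σ = 0 ∨ A.m = p ^ 2 / 4) → A.γ ≤ c₀ * A.m →
      A.γ ≤ c₀ * ((1 - ωF) ^ (E - 1) * (1 - ωB) ^ (E - 1)) →
      (∀ w, risk D A.op A.w₁ - risk D A.op w ≤ Δ) → ∀ T : ℕ,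
      ∑ t ∈ Finset.range (T + 1), rms π (fun ζ => gradient (risk D A.op) (A.w t ζ)) ^ 2
        ≤ K * (1 / A.γ + 1 / A.m + (1 / ((1 - ωF) ^ (E - 1) * (1 - ωB) ^ (E - 1))
            + (ωF ^ 2 + ωB) / ((1 - ωF) ^ 2 * (1 - ωB) ^ (2 * (E - 1))))
          + p * φ ^ 2 * T / ((1 - ωF) ^ (E - 1) * (1 - ωB) ^ (E - 1)) ^ 2
          + 1 + p * T * σ ^ 2) := by
  obtain ⟨Kb, hKb, hbias⟩ := exists_bias_sum_le hE hC hB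
  set g := gradConst E C with hg
  set nc := noiseConst E C with hnc
  -- The coefficients of the squared momenta from the bias, the momentum residual and the averaged
  -- noise; c₀ is chosen so that c₀²Q ≤ 1/2.
  set Q := 16 * Kb + 4 * C ^ 2 + 60 * nc ^ 2 with hQ
  have hQ0 : 0 ≤ Q := by positivity
  set c₀ := 1 / (2 * (1 + Q)) with hc₀
  have hc₀0 : 0 < c₀ := by positivity
  have hc₀1 : c₀ ≤ 1 / 2 := by
    rw [hc₀]
    exact one_div_le_one_div_of_le two_pos (by linarith)
  have hc₀Q : c₀ * Q ≤ 1 / 2 := by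
    rw [hc₀, one_div_mul_eq_div, div_le_iff₀ (by positivity)]
    linarith
  have hc₀Q2 : c₀ ^ 2 * Q ≤ 1 / 2 := by
    calc c₀ ^ 2 * Q = c₀ * (c₀ * Q) := by ring
      _ ≤ 1 / 2 * (1 / 2) := by gcongr
      _ ≤ 1 / 2 := by norm_num
  have hc₀C : C * c₀ ≤ 1 / 4 := by
    rw [hc₀, mul_one_div, div_le_iff₀ (by positivity)]
    nlinarith [sq_nonneg nc]
  set K := 2 * Δ + 4 * g ^ 2 + 24 * Kb + 22 * (2 * g) ^ 2 + 22 with hK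
  have hK0 : 0 < K := by positivity
  refine ⟨K, c₀, hK0, hc₀0, ?_⟩
  intro d k Ξ _ A p D ν π ωF ωB φ σ _ _ _ h ho h0 h1 hcase hγm hγq hgap T
  have hf : 0 < 1 - ωF := by linarith [h.ωF_lt]
  have hb : 0 < 1 - ωB := by linarith [h.ωB_lt]
  have hγ := h.γ_pos
  have hp := h.p_pos
  have hCγ : C * A.γ ≤ 1 / 4 := by
    have : A.γ ≤ c₀ := hγm.trans (mul_le_of_le_one_right hc₀0.le h1)
    exact (mul_le_mul_of_nonneg_left this (by linarith)).trans hc₀C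
  have key := h.sum_gradient_le ho h0 h1 hCγ hgap T
  have hβ := hbias d k Ξ A p D ν π ωF ωB φ h T
  have hdr := h.sum_drive_le T
  set q := (1 - ωF) ^ (E - 1) * (1 - ωB) ^ (E - 1) with hq
  have hq0 : 0 < q := by positivity
  have hq2 : (1 - ωF) ^ (2 * (E - 1)) * (1 - ωB) ^ (2 * (E - 1)) = q ^ 2 := by
    rw [hq]
    ring
  rw [hq2] at hβ
  set dl := 1 / q + (ωF ^ 2 + ωB) / ((1 - ωF) ^ 2 * (1 - ωB) ^ (2 * (E - 1))) with hdl
  have hdl0 : 0 ≤ dl := by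
    have := h.ωB_nonneg
    positivity
  set X := ∑ t ∈ Finset.range (T + 1), rms π (A.u (t + 1)) ^ 2 with hX
  have hX0 : 0 ≤ X := Finset.sum_nonneg fun _ _ => sq_nonneg _
  have hXT : ∑ t ∈ Finset.range T, rms π (A.u (t + 1)) ^ 2 ≤ X :=
    Finset.sum_le_sum_of_subset_of_nonneg (Finset.range_mono T.le_succ) fun _ _ _ => sq_nonneg _
  have hratio : ∀ r : ℝ, 0 < r → A.γ ≤ c₀ * r → (A.γ / r) ^ 2 ≤ c₀ ^ 2 := by
    intro r hr hle
    refine pow_le_pow_left₀ (by positivity) ?_ 2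
    rwa [div_le_iff₀ hr]
  have hbias' : 8 * ∑ t ∈ Finset.range (T + 1), rms π (A.bias t) ^ 2
      ≤ 8 * Kb * dl + 16 * Kb * (p * φ ^ 2 * T / q ^ 2) + 16 * Kb * c₀ ^ 2 * X := by
    have e1 : 1 / q ^ 2 * ∑ t ∈ Finset.range T, drive A π t ^ 2
        ≤ 2 * (p * φ ^ 2 * T / q ^ 2) + 2 * (c₀ ^ 2 * X) := by
      calc 1 / q ^ 2 * ∑ t ∈ Finset.range T, drive A π t ^ 2
          ≤ 1 / q ^ 2 * (2 * (p * φ ^ 2 * T) + 2 * (A.γ ^ 2 * X)) := by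
            refine mul_le_mul_of_nonneg_left (hdr.trans ?_) (by positivity)
            gcongr
        _ = 2 * (p * φ ^ 2 * T / q ^ 2) + 2 * ((A.γ / q) ^ 2 * X) := by
            field_simp
        _ ≤ _ := by
            have := hratio q hq0 hγq
            exact add_le_add le_rfl (mul_le_mul_of_nonneg_left
              (mul_le_mul_of_nonneg_right this hX0) zero_le_two)
    have e2 := mul_le_mul_of_nonneg_left e1 hKb
    linarith only [e2, hβ]
  have hmom : 4 * (C * A.γ / A.m) ^ 2 * X ≤ 4 * C ^ 2 * c₀ ^ 2 * X := by
    have e1 := hratio A.m h0 hγm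
    have e2 : 4 * (C * A.γ / A.m) ^ 2 * X = 4 * C ^ 2 * X * (A.γ / A.m) ^ 2 := by
      field_simp
    have e3 : 4 * C ^ 2 * c₀ ^ 2 * X = 4 * C ^ 2 * X * c₀ ^ 2 := by ring
    rw [e2, e3]
    exact mul_le_mul_of_nonneg_left e1 (by positivity)
  have hnoise : 2 * ∑ t ∈ Finset.range (T + 1), rms π (A.avgNoise D t) ^ 2
      ≤ 22 * (2 * g) ^ 2 + 22 * (p * T * σ ^ 2) + 60 * nc ^ 2 * c₀ ^ 2 * X := by
    -- Without variance there is no noise, and m need not be tied to p.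
    rcases hcase with hσ | hm
    · subst hσ
      rw [h.sum_avgNoise_eq_zero ho (T + 1), mul_zero]
      positivity
    · have e1 := h.sum_avgNoise_le ho hm T
      have hmp : A.m ≤ p := by
        have h2 := h.p_le
        rw [hm]
        nlinarith only [hp, h2]
      have e2 := hratio p hp (hγm.trans (mul_le_mul_of_nonneg_left hmp hc₀0.le))
      have e3 : (A.γ / p) ^ 2 * ∑ t ∈ Finset.range T, rms π (A.u (t + 1)) ^ 2 ≤ c₀ ^ 2 * X :=
        mul_le_mul e2 hXT (Finset.sum_nonneg fun _ _ => sq_nonneg _) (sq_nonneg _)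
      have e4 := mul_le_mul_of_nonneg_left e3 (by positivity : 0 ≤ 30 * nc ^ 2)
      refine (mul_le_mul_of_nonneg_left (e1.trans (add_le_add le_rfl e4)) zero_le_two).trans
        (le_of_eq ?_)
      ring
  have hXQ := mul_le_mul_of_nonneg_right hc₀Q2 hX0
  have hXQ' : c₀ ^ 2 * Q * X = 16 * Kb * c₀ ^ 2 * X + 4 * C ^ 2 * c₀ ^ 2 * X
      + 60 * nc ^ 2 * c₀ ^ 2 * X := by
    rw [hQ]
    ring
  have hmain : ∑ t ∈ Finset.range (T + 1),
      rms π (fun ζ => gradient (risk D A.op) (A.w t ζ)) ^ 2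
      ≤ 2 * Δ * (1 / A.γ) + 4 * g ^ 2 * (1 / A.m) + 8 * Kb * dl
        + 16 * Kb * (p * φ ^ 2 * T / q ^ 2) + 22 * (2 * g) ^ 2 * 1 + 22 * (p * T * σ ^ 2) := by
    have e1 : 2 / A.γ * Δ = 2 * Δ * (1 / A.γ) := by ring
    have e2 : 4 * g ^ 2 / A.m = 4 * g ^ 2 * (1 / A.m) := by ring
    rw [e1, e2] at key
    linarith only [key, hbias', hmom, hnoise, hXQ, hXQ']
  refine hmain.trans ?_
  have hp' := hp.le
  simp only [mul_add K]
  have hle : ∀ c x : ℝ, 0 ≤ x → c ≤ K → c * x ≤ K * x := fun c x hx hc =>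
    mul_le_mul_of_nonneg_right hc hx
  have i1 : 0 ≤ g ^ 2 := sq_nonneg g
  have i2 : 0 ≤ (2 * g) ^ 2 := sq_nonneg _
  refine add_le_add (add_le_add (add_le_add (add_le_add (add_le_add ?_ ?_) ?_) ?_) ?_) ?_
  · exact hle _ _ (by positivity) (by rw [hK]; linarith only [i1, i2, hΔ, hKb])
  · exact hle _ _ (by positivity) (by rw [hK]; linarith only [i1, i2, hΔ, hKb])
  · exact hle _ _ hdl0 (by rw [hK]; linarith only [i1, i2, hΔ, hKb])
  · exact hle _ _ (by positivity) (by rw [hK]; linarith only [i1, i2, hΔ, hKb])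
  · exact hle _ _ zero_le_one (by rw [hK]; linarith only [i1, i2, hΔ, hKb])
  · exact hle _ _ (by positivity) (by rw [hK]; linarith only [i1, i2, hΔ, hKb])

end Valid

end Algo

/-! ### The choice of the parameters -/

/-- Here `R` is the leading term of the rate, given by its cube. It is the common value of 1/(p²T)
and pσ²/q² at the p that balances them. -/
theorem exists_parameters {c₀ : ℝ} (hc₀ : 0 < c₀) {κ σ φ q R T : ℝ} (hσ : 0 ≤ σ) (hφ : 0 ≤ φ)
    (hκ : σ = 0 ∨ φ ≤ κ * σ) (hq0 : 0 < q) (hq1 : q ≤ 1) (hT : 1 ≤ T) (hR : 0 ≤ R)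
    (hR3 : R ^ 3 * (q ^ 4 * T) = σ ^ 4) :
    ∃ γ m p : ℝ, 0 < γ ∧ 0 < m ∧ m < 1 ∧ 0 < p ∧ p ≤ 1 ∧ (σ = 0 ∨ m = p ^ 2 / 4) ∧
      γ ≤ c₀ * m ∧ γ ≤ c₀ * q ∧ ∀ dl δ : ℝ, 1 / q ≤ δ → dl ≤ δ →
        1 / T * (1 / γ + 1 / m + dl + p * φ ^ 2 * T / q ^ 2 + 1 + p * T * σ ^ 2)
          ≤ (5 / c₀ + κ ^ 2 + 8) * (R + δ / T) := by
  have hT0 : 0 < T := by linarith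
  have hq : 1 ≤ 1 / q := by
    rw [le_div_iff₀ hq0]
    linarith
  have hγ : ∀ m : ℝ, 0 < m → 0 < c₀ * min m q ∧ c₀ * min m q ≤ c₀ * m ∧ c₀ * min m q ≤ c₀ * q ∧
      1 / (c₀ * min m q) ≤ 1 / c₀ * (1 / m + 1 / q) := by
    intro m hm
    refine ⟨mul_pos hc₀ (lt_min hm hq0), by gcongr; exact min_le_left _ _,
      by gcongr; exact min_le_right _ _, ?_⟩
    rw [← one_div_mul_one_div]
    refine mul_le_mul_of_nonneg_left ?_ (by positivity)
    have h1 : 0 ≤ 1 / m := by positivity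
    have h2 : 0 ≤ 1 / q := by positivity
    rcases min_cases m q with ⟨h, _⟩ | ⟨h, _⟩ <;> rw [h] <;> linarith
  have hc : 0 ≤ 1 / c₀ := by positivity
  have hc5 : 5 / c₀ = 5 * (1 / c₀) := by ring
  by_cases hσ0 : σ = 0
  · obtain ⟨h1, h2, h3, h4⟩ := hγ (1 / 4) (by norm_num)
    have hden : 0 < φ ^ 2 * T + 1 := by positivity
    -- For σ = 0 the momentum stays constant, and p is taken so small that the sample changes
    -- contribute at most 1 over all iterations.
    refine ⟨c₀ * min (1 / 4) q, 1 / 4, q ^ 2 / (φ ^ 2 * T + 1), h1, by norm_num, by norm_num,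
      by positivity, ?_, Or.inl hσ0, h2, h3, ?_⟩
    · rw [div_le_one hden]
      have : q ^ 2 ≤ 1 := pow_le_one₀ hq0.le hq1
      have : 0 ≤ φ ^ 2 * T := by positivity
      linarith
    · intro dl δ hδ hdl
      have e1 : q ^ 2 / (φ ^ 2 * T + 1) * φ ^ 2 * T / q ^ 2 ≤ 1 := by
        have : q ^ 2 / (φ ^ 2 * T + 1) * φ ^ 2 * T / q ^ 2 = φ ^ 2 * T / (φ ^ 2 * T + 1) := by
          field_simp
        rw [this, div_le_one hden]
        linarith
      have e2 : 1 / (1 / 4 : ℝ) = 4 := by norm_num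
      rw [e2] at h4 ⊢
      have e3 : 1 / c₀ * (4 + 1 / q) ≤ 1 / c₀ * (5 * δ) :=
        mul_le_mul_of_nonneg_left (by linarith) hc
      have e4 : 1 / (c₀ * min (1 / 4) q) + 4 + dl
          + q ^ 2 / (φ ^ 2 * T + 1) * φ ^ 2 * T / q ^ 2 + 1
          + q ^ 2 / (φ ^ 2 * T + 1) * T * σ ^ 2 ≤ (5 / c₀ + κ ^ 2 + 8) * δ := by
        rw [hσ0, zero_pow two_ne_zero, mul_zero, hc5]
        have : 0 ≤ κ ^ 2 * δ := mul_nonneg (sq_nonneg _) (by linarith)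
        linarith
      calc _ ≤ 1 / T * ((5 / c₀ + κ ^ 2 + 8) * δ) :=
            mul_le_mul_of_nonneg_left e4 (by positivity)
        _ = (5 / c₀ + κ ^ 2 + 8) * (δ / T) := by ring
        _ ≤ _ := by
            refine mul_le_mul_of_nonneg_left (by linarith) ?_
            positivity
  · have hσp : 0 < σ := lt_of_le_of_ne hσ (Ne.symm hσ0)
    have hφκ : φ ≤ κ * σ := hκ.resolve_left hσ0
    have hRp : 0 < R := by
      refine lt_of_le_of_ne hR fun h => ?_
      rw [← h, zero_pow three_ne_zero, zero_mul] at hR3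
      exact (pow_pos hσp 4).ne hR3
    -- The balance τ³ = q²/(σ²T). When τ > 1, p is capped at 1, and then 1/(p²T) = 1/T is below δ/T.
    set τ := R * q ^ 2 / σ ^ 2 with hτ
    have hτ0 : 0 < τ := by positivity
    have hτT : 1 / (τ ^ 2 * T) = R := by
      rw [div_eq_iff (by positivity), hτ]
      field_simp
      linarith
    set p := min 1 τ with hp
    have hp0 : 0 < p := lt_min one_pos hτ0
    have hp1 : p ≤ 1 := min_le_left _ _
    have hm0 : 0 < p ^ 2 / 4 := by positivity
    have hp2 : p ^ 2 ≤ 1 := pow_le_one₀ hp0.le hp1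
    have hpσ : p * σ ^ 2 ≤ R * q ^ 2 := by
      have : p ≤ R * q ^ 2 / σ ^ 2 := min_le_right _ _
      rwa [le_div_iff₀ (by positivity)] at this
    have hpT : 1 / (p ^ 2 * T) ≤ R + 1 / T := by
      rcases min_cases 1 τ with ⟨h, _⟩ | ⟨h, _⟩
      · rw [hp, h, one_pow, one_mul]
        linarith
      · rw [hp, h, hτT]
        have : 0 ≤ 1 / T := by positivity
        linarith
    obtain ⟨h1, h2, h3, h4⟩ := hγ (p ^ 2 / 4) hm0
    refine ⟨c₀ * min (p ^ 2 / 4) q, p ^ 2 / 4, p, h1, hm0, by linarith, hp0, hp1, Or.inr rfl, h2,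
      h3, ?_⟩
    intro dl δ hδ hdl
    set Y := R + δ / T with hY
    have hT1 : 1 / T ≤ δ / T := div_le_div_of_nonneg_right (by linarith) hT0.le
    have hδY : δ / T ≤ Y := by linarith
    have hRY : R ≤ Y := by
      have : 0 ≤ 1 / T := by positivity
      linarith
    have hm : 1 / T * (1 / (p ^ 2 / 4)) ≤ 4 * Y := by
      calc 1 / T * (1 / (p ^ 2 / 4)) = 4 * (1 / (p ^ 2 * T)) := by
            field_simp
        _ ≤ 4 * Y := by linarith
    have hqT : 1 / T * (1 / q) ≤ Y := by
      refine le_trans (le_of_eq ?_) ((div_le_div_of_nonneg_right hδ hT0.le).trans hδY)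
      ring
    have hγT : 1 / T * (1 / (c₀ * min (p ^ 2 / 4) q)) ≤ 5 / c₀ * Y := by
      calc _ ≤ 1 / T * (1 / c₀ * (1 / (p ^ 2 / 4) + 1 / q)) :=
            mul_le_mul_of_nonneg_left h4 (by positivity)
        _ = 1 / c₀ * (1 / T * (1 / (p ^ 2 / 4)) + 1 / T * (1 / q)) := by ring
        _ ≤ 1 / c₀ * (4 * Y + Y) := by gcongr
        _ = _ := by ring
    have hdlT : 1 / T * dl ≤ Y := by
      refine le_trans (le_of_eq ?_) ((div_le_div_of_nonneg_right hdl hT0.le).trans hδY)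
      ring
    have hφT : 1 / T * (p * φ ^ 2 * T / q ^ 2) ≤ κ ^ 2 * Y := by
      have e1 : φ ^ 2 ≤ κ ^ 2 * σ ^ 2 := by
        rw [← mul_pow]
        exact pow_le_pow_left₀ hφ hφκ 2
      calc 1 / T * (p * φ ^ 2 * T / q ^ 2) = p * φ ^ 2 / q ^ 2 := by field_simp
        _ ≤ κ ^ 2 * R := by
            rw [div_le_iff₀ (by positivity)]
            calc p * φ ^ 2 ≤ p * (κ ^ 2 * σ ^ 2) := by gcongr
              _ = κ ^ 2 * (p * σ ^ 2) := by ring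
              _ ≤ κ ^ 2 * (R * q ^ 2) := by gcongr
              _ = _ := by ring
        _ ≤ κ ^ 2 * Y := by gcongr
    have hσT : 1 / T * (p * T * σ ^ 2) ≤ Y := by
      calc 1 / T * (p * T * σ ^ 2) = p * σ ^ 2 := by field_simp
        _ ≤ R * q ^ 2 := hpσ
        _ ≤ R := mul_le_of_le_one_right hR (pow_le_one₀ hq0.le hq1)
        _ ≤ Y := hRY
    have hYY : 1 / T * 1 ≤ Y := by
      rw [mul_one]
      exact hT1.trans hδY
    have hY0 : 0 ≤ Y := hR.trans hRY
    rw [mul_add, mul_add, mul_add, mul_add, mul_add, add_mul, add_mul]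
    linarith

/-- Cubing turns the fractional powers of the rate into natural ones. -/
theorem rate_cube {E : ℕ} (hE : 1 ≤ E) {σ f b T : ℝ} (hσ : 0 ≤ σ) (hf : 0 < f) (hb : 0 < b)
    (hT : 0 < T) : (σ ^ (4 / 3 : ℝ) / (T ^ (1 / 3 : ℝ) * b ^ (4 * ((E : ℝ) - 1) / 3)
      * f ^ (4 * ((E : ℝ) - 1) / 3))) ^ 3 * ((f ^ (E - 1) * b ^ (E - 1)) ^ 4 * T) = σ ^ 4 := by
  have hr : ∀ r : ℝ, 0 ≤ r → (r ^ (4 * ((E : ℝ) - 1) / 3)) ^ 3 = (r ^ (E - 1)) ^ 4 := by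
    intro r hr
    rw [← Real.rpow_natCast _ 3, ← Real.rpow_mul hr, ← pow_mul, ← Real.rpow_natCast r]
    congr 1
    push_cast [Nat.cast_sub hE]
    ring
  have hσ3 : (σ ^ (4 / 3 : ℝ)) ^ 3 = σ ^ 4 := by
    rw [← Real.rpow_natCast _ 3, ← Real.rpow_mul hσ, ← Real.rpow_natCast σ]
    norm_num
  have hT3 : (T ^ (1 / 3 : ℝ)) ^ 3 = T := by
    rw [← Real.rpow_natCast _ 3, ← Real.rpow_mul hT.le]
    norm_num
  rw [div_pow, mul_pow, mul_pow, hσ3, hT3, hr b hb.le, hr f hf.le]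
  field_simp

/-- The first two summands of `delta` suffice; the third is only known to be nonnegative here. -/
theorem le_delta {E : ℕ} {ωF ωB : ℝ} (hF : ωF < 1) (hB0 : 0 ≤ ωB) (hB : ωB < 1) :
    1 / ((1 - ωF) ^ (E - 1) * (1 - ωB) ^ (E - 1)) ≤ delta E ωF ωB ∧
    1 / ((1 - ωF) ^ (E - 1) * (1 - ωB) ^ (E - 1))
      + (ωF ^ 2 + ωB) / ((1 - ωF) ^ 2 * (1 - ωB) ^ (2 * (E - 1))) ≤ delta E ωF ωB := by
  have hf : 0 < 1 - ωF := by linarith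
  have hb : 0 < 1 - ωB := by linarith
  have h1 : 0 ≤ (ωF ^ 2 + ωB) / ((1 - ωF) ^ 2 * (1 - ωB) ^ (2 * (E - 1))) := by positivity
  have h2 : 0 ≤ 1 / (1 - ωF) ^ (2 * ((E : ℤ) - 2) - 1) := by positivity
  unfold delta
  constructor <;> linarith

end Clapping
end

/-! ### The convergence theorem. -/

theorem mainTheorem1 (E : ℕ) (hE : 2 ≤ E) (Lℓ Ca La Lg Δ B κ : ℝ)
    (hLℓ : 0 ≤ Lℓ) (hCa : 0 ≤ Ca) (hLa : 0 ≤ La) (hLg : 0 ≤ Lg)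
    (hΔ : 0 ≤ Δ) (hB : 0 ≤ B) (hκ : 0 ≤ κ) :
    ∃ K : ℝ, 0 < K ∧
      ∀ σ φ ωF ωB : ℝ, 0 ≤ σ → 0 ≤ φ → (σ = 0 ∨ φ ≤ κ * σ) →
        0 ≤ ωF → ωF < 1 → 0 ≤ ωB → ωB < 1 → ∀ T : ℕ, 0 < T →
      ∃ γ m p : ℝ, 0 < γ ∧ 0 < m ∧ m < 1 ∧ 0 < p ∧ p ≤ 1 ∧
        ∀ (d : Fin (E + 1) → ℕ) (k : Fin E → ℕ) (a : Clapping.Operators d k)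
          (D : MeasureTheory.Measure (Clapping.Act d 0))
          (Ξ : Type*) [MeasurableSpace Ξ] (ν : MeasureTheory.Measure Ξ)
          (CF CB : Clapping.Compressors d Ξ) (w₁ : Clapping.Params k),
          d (Fin.last E) = 1 →
          MeasureTheory.IsProbabilityMeasure D →
          MeasureTheory.IsProbabilityMeasure ν →
          Clapping.Smooth D a Lℓ Ca La Lg →
          Clapping.UnbiasedGradient D a σ →
          Clapping.Contractive ν CF ωF →
          Clapping.Contractive ν CB ωB →
          Clapping.SampleDispersion D φ →
          (∀ w, Clapping.risk D a w₁ - Clapping.risk D a w ≤ Δ) →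
          (∀ e : Fin (E + 1), e ≠ 0 → e ≠ Fin.last E →
            ∫ x, ‖Clapping.forward a x w₁ e‖ ^ 2 ∂D ≤ B ^ 2) →
          ∀ (Ω : Type*) [MeasurableSpace Ω] (μ : MeasureTheory.Measure Ω)
            (ζ : ℕ → Ω → Clapping.Draw d Ξ),
            MeasureTheory.IsProbabilityMeasure μ →
            (∀ t, Measurable (ζ t)) →
            ProbabilityTheory.iIndepFun ζ μ →
            (∀ t, μ.map (ζ t) = Clapping.drawLaw p D ν) →
            (∀ t, t < T → MeasureTheory.Integrable (fun ω => ‖gradient (Clapping.risk D a)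
              (Clapping.run γ m a CF CB w₁ (fun s => ζ s ω) t).w‖ ^ 2) μ) ∧
            (1 / (T : ℝ)) * ∑ t ∈ Finset.range T, ∫ ω, ‖gradient (Clapping.risk D a)
                (Clapping.run γ m a CF CB w₁ (fun s => ζ s ω) t).w‖ ^ 2 ∂μ
              ≤ K * (σ ^ (4 / 3 : ℝ) / ((T : ℝ) ^ (1 / 3 : ℝ)
                    * (1 - ωB) ^ (4 * ((E : ℝ) - 1) / 3) * (1 - ωF) ^ (4 * ((E : ℝ) - 1) / 3))
                  + Clapping.delta E ωF ωB / (T : ℝ)) := by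
  set C := max 1 (max Ca (max La (max Lg Lℓ))) with hCdef
  have hC : 1 ≤ C := le_max_left _ _
  have hC1 : Ca ≤ C := (le_max_left _ _).trans (le_max_right _ _)
  have hC2 : La ≤ C := ((le_max_left _ _).trans (le_max_right _ _)).trans (le_max_right _ _)
  have hC3 : Lg ≤ C :=
    (((le_max_left _ _).trans (le_max_right _ _)).trans (le_max_right _ _)).trans (le_max_right _ _)
  have hC4 : Lℓ ≤ C :=
    (((le_max_right _ _).trans (le_max_right _ _)).trans (le_max_right _ _)).trans
      (le_max_right _ _)
  obtain ⟨K, c₀, hK, hc₀, hsum⟩ := Clapping.Algo.Valid.exists_gradient_sum_le hE hC hB hΔ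
  refine ⟨K * (5 / c₀ + κ ^ 2 + 8), by positivity, ?_⟩
  intro σ φ ωF ωB hσ hφ hκσ hF0 hF1 hB0 hB1 T hT
  have hf : 0 < 1 - ωF := by linarith
  have hb : 0 < 1 - ωB := by linarith
  have hT1 : (1 : ℝ) ≤ T := by exact_mod_cast hT
  have hE1 : 1 ≤ E := by omega
  obtain ⟨γ, m, p, hγ, hm0, hm1, hp0, hp1, hcase, hγm, hγq, hbound⟩ :=
    Clapping.exists_parameters hc₀ hσ hφ hκσ
      (q := (1 - ωF) ^ (E - 1) * (1 - ωB) ^ (E - 1)) (by positivity)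
      (mul_le_one₀ (pow_le_one₀ hf.le (by linarith)) (by positivity)
        (pow_le_one₀ hb.le (by linarith))) hT1 (by positivity)
      (Clapping.rate_cube hE1 hσ hf hb (zero_lt_one.trans_le hT1))
  refine ⟨γ, m, p, hγ, hm0, hm1, hp0, hp1, ?_⟩
  intro d k a D Ξ _ ν CF CB w₁ hd hD hν hs hu hcF hcB hφD hgap hinit Ω _ μ ζ hμ hζ hind hlaw
  have hπ : MeasureTheory.IsProbabilityMeasure (Clapping.drawLaw p D ν) :=
    Clapping.isProbabilityMeasure_drawLaw hp0.le hp1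
  have hreg := hs.regular hLa hLg hC hC1 hC2 hC3 hd
  have ho : Clapping.Objective D a C σ :=
    ⟨hreg, hu, hs.risk_differentiable, fun w w' => (hs.risk_gradient_lipschitz w w').trans
      (mul_le_mul_of_nonneg_right hC4 (norm_nonneg _))⟩
  set A : Clapping.Algo d k Ξ := ⟨γ, m, a, CF, CB, w₁⟩ with hA
  have hv : A.Valid p D ν (Clapping.drawLaw p D ν) C B ωF ωB φ :=
    ⟨hE, hreg, hγ, hcF, hcB, hF0, hF1, hB0, hB1, hp0, hp1, rfl, hφD, hφ, hB, hinit⟩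
  -- Independent draws with the prescribed marginals have the product law, so all expectations
  -- transfer to the canonical sequence space.
  have hmap : μ.map (fun ω s => ζ s ω) = Clapping.path (Clapping.drawLaw p D ν) := by
    rw [hind.map_fun_eq_infinitePi_map hζ]
    simp only [hlaw]
  have hZ : Measurable fun ω s => ζ s ω := measurable_pi_iff.mpr hζ
  have hw : ∀ t ζ', (Clapping.run γ m a CF CB w₁ ζ' t).w = A.w t ζ' := by
    intro t ζ'
    rw [Clapping.Algo.w, Clapping.Algo.st]
  have hmeas : ∀ t, Measurable fun ζ' => ‖gradient (Clapping.risk D a) (A.w t ζ')‖ ^ 2 :=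
    fun t => (hv.measurable_gradient ho t).norm.pow_const 2
  have hint : ∀ t, MeasureTheory.Integrable
      (fun ζ' => ‖gradient (Clapping.risk D a) (A.w t ζ')‖ ^ 2)
      (Clapping.path (Clapping.drawLaw p D ν)) :=
    fun t => (hv.memLp_gradient ho t).integrable_norm_pow two_ne_zero
  simp only [hw]
  refine ⟨fun t _ => ?_, ?_⟩
  · have := hint t
    rw [← hmap, MeasureTheory.integrable_map_measure (hmeas t).aestronglyMeasurable
      hZ.aemeasurable] at this
    exact this
  · have hE' : ∀ t, ∫ ω, ‖gradient (Clapping.risk D a) (A.w t fun s => ζ s ω)‖ ^ 2 ∂μ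
        = Clapping.rms (Clapping.drawLaw p D ν)
          (fun ζ' => gradient (Clapping.risk D a) (A.w t ζ')) ^ 2 := by
      intro t
      rw [Clapping.lpNorm_two_sq (hv.memLp_gradient ho t), ← hmap,
        MeasureTheory.integral_map hZ.aemeasurable (hmeas t).aestronglyMeasurable]
    simp only [hE']
    -- T iterates are separated by T − 1 increments: the summed bound contains S, while the
    -- parameters were chosen for T = S + 1, and S is enlarged to T below.
    obtain ⟨S, rfl⟩ : ∃ S, T = S + 1 := ⟨T - 1, by omega⟩
    have key := hsum d k Ξ A p D ν (Clapping.drawLaw p D ν) ωF ωB φ σ hv ho hm0 hm1.le hcase hγm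
      hγq hgap S
    have hδ := Clapping.le_delta (E := E) hF1 hB0 hB1
    have hb' := hbound _ _ hδ.1 hδ.2
    have hS : (S : ℝ) ≤ ((S + 1 : ℕ) : ℝ) := by
      push_cast
      linarith
    have hmono := key.trans (mul_le_mul_of_nonneg_left (add_le_add (add_le_add (add_le_add le_rfl
      (div_le_div_of_nonneg_right (mul_le_mul_of_nonneg_left hS
        (mul_nonneg hp0.le (sq_nonneg φ))) (sq_nonneg _))) le_rfl)
      (mul_le_mul_of_nonneg_right (mul_le_mul_of_nonneg_left hS hp0.le) (sq_nonneg σ))) hK.le)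
    have h1 := mul_le_mul_of_nonneg_left hmono (by positivity : 0 ≤ 1 / ((S + 1 : ℕ) : ℝ))
    refine h1.trans ?_
    rw [mul_left_comm, mul_assoc K]
    exact mul_le_mul_of_nonneg_left hb' hK.le
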